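/- **Theorem.** Let $\Omega$ be the Riemann sphere $\widehat{\mathbb C}$ with the spherical metric (length element $2|dz|/(1+|z|^2)$) or the closed unit disk $\overline{\mathbb D}$ with the Euclidean metric. Let $X$ be a length metric space homeomorphic to $\Omega$ with $\mathcal H^2(X)<\infty$, and let $(X_n)_{n\in\mathbb N}$ be polyhedral Riemann surfaces homeomorphic to $\Omega$. Let $f_n\colon X_n\to X$ (not necessarily continuous) be an approximately isometric sequence, that is, there are $\varepsilon_n>0$ with $\varepsilon_n\to 0$ such that every point of $X$ has distance less than $\varepsilon_n$ from some point of $f_n(X_n)$, and $|d_{X_n}(x,y)-d_X(f_n(x),f_n(y))|<\varepsilon_n$ for all $x,y\in X_n$ (in particular, $X_n\to X$ in the Gromov–Hausdorff sense). Suppose that $K\ge 1$ is such that $$\limsup_{n\to\infty}\mathcal H^2\bigl(f_n^{-1}(A)\bigr)\le K\,\mathcal H^2(A)\qquad\text{for all compact } A\subset X.$$ Let $h_n\colon\Omega\to X_n$ be conformal homeomorphisms that are normalized: there are $\delta>0$ and points $a_n,b_n,c_n\in\Omega$ such that, for every $n$, the mutual distances of $a_n,b_n,c_n$ and the mutual distances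 of $h_n(a_n),h_n(b_n),h_n(c_n)$ are all at least $\delta$. Then $(f_n\circ h_n)$ has a subsequence that converges uniformly on $\Omega$ to a weakly $K$-quasiconformal map $h\colon\Omega\to X$, and $h\in N^{1,2}(\Omega,X)$. *Definitions.* - $\mathcal H^2$ is the Hausdorff 2-measure, normalized to agree with Lebesgue measure in the Euclidean plane (for non-measurable sets, it is the outer measure). A length space is a metric space in which the distance of two points is the infimum of the lengths of the paths joining them. Paths are continuous and are parametrized by compact intervals. - A *polyhedral surface* is obtained from planar polygonal domains homeomorphic to a closed disk (finitely many, in the compact case considered here), with boundaries subdivided into finitely many segments called edges, by gluing them along their boundaries, edge to edge, isometrically on edges and without identifying distinct points of one polygon. Its metric is $d(x,y)=\inf\sum_{k}d_{P_k}(x_k,y_k)$, the infimum over finite chains from $x=x_1$ to $y$, the last $y_k$, such that $x_k,y_k$ lie in a common polygon $P_k$ and $y_k$ is identified with $x_{k+1}$; here $d_{P}$ is the length metric on $P$ induced by the Euclidean metric. It is a *polyhedral Riemann surface* if, moreover, the polygons are placed in the plane (possibly after reflections) so that, with the positive boundary orientations, the two copies of each shared edge are identified with opposite directions. Its complex structure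 is given by the following natural chart near a point $v$: each polygon containing $v$ is a circular sector of small radius at $v$; let $\theta$ be the sum of the angles of these sectors. Each sector is mapped by $z\mapsto (z-v)^{\alpha}$ followed by a rotation, where $\alpha=2\pi/\theta$ if $v$ is an interior point of the surface and $\alpha=\pi/\theta$ if $v$ is a boundary point, so that the images fit together to a disk, respectively a half-disk. - A homeomorphism $h_n\colon\Omega\to X_n$ is *conformal* if near every point of $\Omega$ it is given in local coordinates by a map that extends to a conformal map (holomorphic with non-zero derivative) of a neighbourhood in $\mathbb C$. The coordinates on $\Omega$ are $z$ and $1/z$ on $\widehat{\mathbb C}$, and $z$ on $\overline{\mathbb D}$. - For a family $\Gamma$ of paths in a metric space $Z$, $\operatorname{Mod}\Gamma=\inf_\rho\int_Z\rho^2\,d\mathcal H^2$, the infimum over all Borel functions $\rho\colon Z\to[0,\infty]$ with $\int_\gamma\rho\,ds\ge1$ for all rectifiable $\gamma\in\Gamma$ ($\inf\emptyset=\infty$). A map $h\colon\Omega\to X$ is *weakly $K$-quasiconformal* if it is continuous and surjective, the preimage of every point is connected, and $\operatorname{Mod}\Gamma\le K\operatorname{Mod}\{h\circ\gamma:\gamma\in\Gamma\}$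 for every family $\Gamma$ of paths in $\Omega$. - $h\in N^{1,2}(\Omega,X)$ means that $h$ is Borel, that $x\mapsto d_X(y,h(x))$ is in $L^2(\Omega,\mathcal H^2)$ for some $y\in X$, and that there is a Borel function $g\colon\Omega\to[0,\infty]$ in $L^2(\Omega,\mathcal H^2)$ such that $d_X(h(a),h(b))\le\int_\gamma g\,ds$ for all rectifiable paths $\gamma$ in $\Omega$, $a,b$ being the end points of $\gamma$, outside a family of modulus zero. -/

import Mathlib

open Set Filter Topology MeasureTheory
open scoped ENNReal NNReal unitInterval

noncomputable section

/-! ### Paths, length, line integrals, Hausdorff measure and modulus -/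

/-- The length of a path. Paths are parametrized by `[0, 1]`; lengths and line integrals do not
depend on the choice of the compact parameter interval. -/
def pathLength {X : Type*} [PseudoEMetricSpace X] (γ : C(I, X)) : ℝ≥0∞ :=
  eVariationOn γ univ

/-- A metric space in which the distance of two points is the infimum of the lengths of the paths
joining them. -/
def IsLengthSpace (X : Type*) [MetricSpace X] : Prop :=
  ∀ x y : X, edist x y = ⨅ (γ : C(I, X)) (_ : γ 0 = x ∧ γ 1 = y), pathLength γ

/-- The line integral `∫_γ ρ ds` of `ρ` along a rectifiable path: the integral over `[0, ℓ(γ)]` of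
`ρ` composed with the arc length parametrization of `γ`. -/
def lineIntegral {X : Type*} [MetricSpace X] (ρ : X → ℝ≥0∞) (γ : C(I, X)) : ℝ≥0∞ :=
  ∫⁻ s in Icc (0 : ℝ) (pathLength γ).toReal, ρ (naturalParameterization γ univ 0 s)

/-- The Hausdorff 2-measure, normalized (by the factor `π / 4` in front of `diam ^ 2`) so as to agree
with the Lebesgue measure on the Euclidean plane. -/
def hausdorffTwo (X : Type*) [MetricSpace X] [MeasurableSpace X] [BorelSpace X] : Measure X :=
  ENNReal.ofReal (Real.pi / 4) • Measure.hausdorffMeasure 2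

/-- A Borel function `ρ ≥ 0` is admissible for a family of paths if its integral along every
rectifiable path of the family is at least one. -/
def IsAdmissible {X : Type*} [MetricSpace X] [MeasurableSpace X] (Γ : Set C(I, X))
    (ρ : X → ℝ≥0∞) : Prop :=
  Measurable ρ ∧ ∀ γ ∈ Γ, pathLength γ ≠ ∞ → 1 ≤ lineIntegral ρ γ

/-- The 2-modulus of a family of paths, with respect to the Hausdorff 2-measure. -/
def modulus {X : Type*} [MetricSpace X] [MeasurableSpace X] [BorelSpace X]
    (Γ : Set C(I, X)) : ℝ≥0∞ :=
  ⨅ (ρ : X → ℝ≥0∞) (_ : IsAdmissible Γ ρ), ∫⁻ x, ρ x ^ 2 ∂(hausdorffTwo X)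

/-- The family `h(Γ) = {h ∘ γ : γ ∈ Γ}`, for continuous `h`. -/
def imageFamily {X Y : Type*} [TopologicalSpace X] [TopologicalSpace Y] (h : X → Y)
    (Γ : Set C(I, X)) : Set C(I, Y) :=
  {η | ∃ γ ∈ Γ, ∀ t, η t = h (γ t)}

/-- Weakly `K`-quasiconformal maps: continuous, surjective, monotone (preimages of points are
connected), with `Mod Γ ≤ K Mod h(Γ)` for every family of paths. -/
structure IsWeaklyQuasiconformal {X Y : Type*} [MetricSpace X] [MeasurableSpace X] [BorelSpace X]
    [MetricSpace Y] [MeasurableSpace Y] [BorelSpace Y] (K : ℝ) (h : X → Y) : Prop where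
  continuous : Continuous h
  surjective : Function.Surjective h
  monotone : ∀ y, IsConnected (h ⁻¹' {y})
  modulus_le : ∀ Γ : Set C(I, X), modulus Γ ≤ ENNReal.ofReal K * modulus (imageFamily h Γ)

/-! ### Metric Sobolev maps -/

/-- A Borel function `g ≥ 0` is a weak upper gradient of `h` if the upper gradient inequality holds
along all rectifiable paths outside a family of 2-modulus zero. -/
def IsWeakUpperGradient {X Y : Type*} [MetricSpace X] [MeasurableSpace X] [BorelSpace X]
    [MetricSpace Y] (h : X → Y) (g : X → ℝ≥0∞) : Prop :=
  Measurable g ∧ ∃ Γ₀ : Set C(I, X), modulus Γ₀ = 0 ∧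
    ∀ γ : C(I, X), γ ∉ Γ₀ → pathLength γ ≠ ∞ → edist (h (γ 0)) (h (γ 1)) ≤ lineIntegral g γ

/-- Membership in the Sobolev space `N^{1,2}(X, Y)`: Borel maps with a weak upper gradient in `L²`
and with `x ↦ d(y, h x)` in `L²` for some `y`. -/
def MemSobolevN12 {X Y : Type*} [MetricSpace X] [MeasurableSpace X] [BorelSpace X]
    [MetricSpace Y] [MeasurableSpace Y] (h : X → Y) : Prop :=
  Measurable h ∧
    (∃ g : X → ℝ≥0∞, IsWeakUpperGradient h g ∧ ∫⁻ x, g x ^ 2 ∂(hausdorffTwo X) < ∞) ∧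
    ∃ y : Y, MemLp (fun x => dist y (h x)) 2 (hausdorffTwo X)

/-! ### Approximate isometries and normalized sequences -/

/-- `f` is an `ε`-isometry: its image is `ε`-dense and it distorts distances by less than `ε`. -/
def IsEpsIsometry {X Y : Type*} [MetricSpace X] [MetricSpace Y] (ε : ℝ) (f : X → Y) : Prop :=
  (∀ y, ∃ x, dist y (f x) < ε) ∧ ∀ x x', |dist x x' - dist (f x) (f x')| < ε

/-- `f n` is an `ε n`-isometry for all `n`, where `ε n > 0` tends to zero. -/
def IsApproxIsometricSeq {Y : ℕ → Type*} [∀ n, MetricSpace (Y n)] {X : Type*} [MetricSpace X]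
    (f : ∀ n, Y n → X) : Prop :=
  ∃ ε : ℕ → ℝ, (∀ n, 0 < ε n) ∧ Tendsto ε atTop (𝓝 0) ∧ ∀ n, IsEpsIsometry (ε n) (f n)

/-- The three mutual distances of `a, b, c` are at least `δ`. -/
def IsSeparatedTriple {X : Type*} [MetricSpace X] (δ : ℝ) (a b c : X) : Prop :=
  δ ≤ dist a b ∧ δ ≤ dist b c ∧ δ ≤ dist a c

/-- Normalized sequences of maps: uniformly separated triples have uniformly separated images. -/
def IsNormalizedSeq {Ω : Type*} [MetricSpace Ω] {Y : ℕ → Type*} [∀ n, MetricSpace (Y n)]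
    (h : ∀ n, Ω → Y n) : Prop :=
  ∃ δ > 0, ∃ a b c : ℕ → Ω, ∀ n, IsSeparatedTriple δ (a n) (b n) (c n) ∧
    IsSeparatedTriple δ (h n (a n)) (h n (b n)) (h n (c n))

/-! ### Polyhedral Riemann surfaces -/

/-- A closed planar polygonal domain homeomorphic to a closed disk, with its boundary subdivided
into finitely many non-overlapping segments `[v k, v (k+1)]` (indices modulo the number
`extraSides + 3` of sides), listed counterclockwise: the interior lies to the left of each of them.
Consecutive sides may be collinear. -/
structure PolygonalDisk where
  carrier : Set ℂ
  extraSides : ℕ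
  v : Fin (extraSides + 3) → ℂ
  isCompact : IsCompact carrier
  homeo_disk : Nonempty (carrier ≃ₜ Metric.closedBall (0 : ℂ) 1)
  v_injective : Function.Injective v
  edges_disjoint : ∀ j k, j ≠ k →
    Disjoint (openSegment ℝ (v j) (v (j + 1))) (segment ℝ (v k) (v (k + 1)))
  frontier_eq : frontier carrier = ⋃ k, segment ℝ (v k) (v (k + 1))
  counterclockwise : ∀ k, ∀ z ∈ openSegment ℝ (v k) (v (k + 1)),
    ∀ᶠ ε : ℝ in 𝓝[>] 0, z + (ε : ℂ) * Complex.I * (v (k + 1) - v k) ∈ interior carrier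

/-- The length (extended) metric of a planar set `P`: the infimum of the Euclidean lengths of the
paths in `P` from `x` to `y`. -/
def innerEDist (P : Set ℂ) (x y : ℂ) : ℝ≥0∞ :=
  ⨅ (γ : C(I, ℂ)) (_ : γ 0 = x ∧ γ 1 = y ∧ range γ ⊆ P), pathLength γ

/-- A presentation of the metric space `Y` as a compact polyhedral surface with oriented faces:
`Y` is obtained from finitely many planar polygonal disks by gluing their boundaries edge to edge,
isometrically, and it carries the polyhedral metric. The map `glue i` is the identification of the
`i`-th polygon with a face of `Y`; only its values on the polygon matter. The polygons are placed
in the plane with compatible orientations (possibly after reflections), so that the two copies of a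
shared edge point in opposite directions. -/
structure PolyhedralRiemannSurface (Y : Type*) [MetricSpace Y] where
  Face : Type
  finite_face : Finite Face
  poly : Face → PolygonalDisk
  glue : Face → ℂ → Y
  glue_injOn : ∀ i, InjOn (glue i) (poly i).carrier
  glue_covers : ∀ y, ∃ i, ∃ x ∈ (poly i).carrier, glue i x = y
  /-- Distinct faces are identified only along their boundaries. -/
  glue_boundary : ∀ i j, i ≠ j → ∀ x ∈ (poly i).carrier, ∀ y ∈ (poly j).carrier,
    glue i x = glue j y → x ∈ frontier (poly i).carrier
  /-- Vertices are identified only with vertices. -/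
  glue_vertex : ∀ i j k, ∀ y ∈ (poly j).carrier,
    glue i ((poly i).v k) = glue j y → ∃ l, y = (poly j).v l
  /-- Open edges of distinct faces are disjoint in `Y`, unless the two closed edges have the same
  length and are identified with each other by arc length, in opposite directions. -/
  glue_edge : ∀ i j k l, i ≠ j →
    (∃ x ∈ openSegment ℝ ((poly i).v k) ((poly i).v (k + 1)),
      ∃ y ∈ openSegment ℝ ((poly j).v l) ((poly j).v (l + 1)), glue i x = glue j y) →
    dist ((poly i).v k) ((poly i).v (k + 1)) = dist ((poly j).v l) ((poly j).v (l + 1)) ∧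
    ∀ t ∈ Icc (0 : ℝ) 1,
      glue i (AffineMap.lineMap ((poly i).v k) ((poly i).v (k + 1)) t) =
        glue j (AffineMap.lineMap ((poly j).v (l + 1)) ((poly j).v l) t)
  /-- The polyhedral metric: the infimum, over all chains `x 0, y 0, …, x m, y m` from `p` to `q`
  such that `x k, y k` lie in a common polygon and `y k` is identified with `x (k + 1)`, of the sum
  of the distances of `x k` and `y k` in the length metric of that polygon. -/
  edist_eq : ∀ p q : Y, edist p q =
    ⨅ (m : ℕ) (i : ℕ → Face) (x : ℕ → ℂ) (y : ℕ → ℂ)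
      (_ : (∀ k ≤ m, x k ∈ (poly (i k)).carrier ∧ y k ∈ (poly (i k)).carrier) ∧
        (∀ k < m, glue (i k) (y k) = glue (i (k + 1)) (x (k + 1))) ∧
        glue (i 0) (x 0) = p ∧ glue (i m) (y m) = q),
      ∑ k ∈ Finset.range (m + 1), innerEDist (poly (i k)).carrier (x k) (y k)

namespace PolyhedralRiemannSurface

variable {Y : Type*} [MetricSpace Y]

/-- The union in `Y` of the pieces of radius `r` around `y` of the faces that contain `y`. -/
def star (S : PolyhedralRiemannSurface Y) (y : Y) (r : ℝ) : Set Y :=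
  {p | ∃ i, ∃ x ∈ (S.poly i).carrier, S.glue i x = y ∧
    ∃ z ∈ (S.poly i).carrier ∩ Metric.ball x r, S.glue i z = p}

/-- The natural conformal charts `ψ` centred at `y`. Each face containing `y` is a circular sector
of radius `r` (a half-disk or a disk, if `y` is not a vertex of it) near `y`; the chart `ψ` maps each
sector by the power map `z ↦ z ^ α`, up to a rotation, and fits the images of the sectors together
homeomorphically to a disk, or to a half-disk when `y` is a boundary point. This forces `α = 2π / θ`,
respectively `α = π / θ`, where `θ` is the total angle at `y`, and in particular `α = 1` if `y` is not
a vertex. -/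
structure IsNaturalChart (S : PolyhedralRiemannSurface Y) (y : Y) (r α : ℝ) (ψ : Y → ℂ) :
    Prop where
  r_pos : 0 < r
  α_pos : 0 < α
  sector : ∀ i, ∀ x ∈ (S.poly i).carrier, S.glue i x = y →
    ∃ θ₀ θ₁ β : ℝ, θ₀ < θ₁ ∧ θ₁ ≤ θ₀ + 2 * Real.pi ∧
      (S.poly i).carrier ∩ Metric.ball x r =
        {z | ∃ s ∈ Ico 0 r, ∃ θ ∈ Icc θ₀ θ₁, z = x + s * Complex.exp (θ * Complex.I)} ∧
      ∀ s ∈ Ico 0 r, ∀ θ ∈ Icc θ₀ θ₁,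
        ψ (S.glue i (x + s * Complex.exp (θ * Complex.I))) =
          (s ^ α : ℝ) * Complex.exp ((α * θ + β : ℝ) * Complex.I)
  isOpen_star : IsOpen (S.star y r)
  isEmbedding : IsEmbedding ((S.star y r).domRestrict ψ)
  image_eq : ψ '' S.star y r = Metric.ball 0 (r ^ α) ∨
    ψ '' S.star y r = Metric.ball 0 (r ^ α) ∩ {z | 0 ≤ z.im}

/-- `h` is conformal along a local parametrization `e : D → Ω`, `D ⊆ ℂ`, of the Riemann surface `Ω`
(the inverse of a conformal chart): at each point of `D`, the expression of `h` in local coordinates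
has a conformal extension to a neighbourhood of that point in `ℂ`. -/
def IsConformalAlong (S : PolyhedralRiemannSurface Y) {Ω : Type*} (D : Set ℂ) (e : ℂ → Ω)
    (h : Ω → Y) : Prop :=
  ∀ w ∈ D, ∃ (r α : ℝ) (ψ : Y → ℂ), S.IsNaturalChart (h (e w)) r α ψ ∧
    ∃ F : ℂ → ℂ, AnalyticAt ℂ F w ∧ deriv F w ≠ 0 ∧ ∀ᶠ z in 𝓝[D] w, ψ (h (e z)) = F z

end PolyhedralRiemannSurface

/-! ### The Riemann sphere and the closed unit disk -/

/-- The Riemann sphere `ℂ ∪ {∞}`, to be equipped with the spherical metric. -/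
def RiemannSphere : Type := OnePoint ℂ

namespace RiemannSphere

/-- The affine coordinate of the sphere. -/
def ofComplex (z : ℂ) : RiemannSphere := OnePoint.some z

/-- The coordinate `w = 1 / z` near infinity. -/
def ofComplexInv (w : ℂ) : RiemannSphere :=
  if w = 0 then (OnePoint.infty : OnePoint ℂ) else ofComplex w⁻¹

/-- (Inverse) stereographic projection onto the unit sphere of `ℝ³`. -/
def toR3 : RiemannSphere → EuclideanSpace ℝ (Fin 3)
  | none => !₂[0, 0, 1]
  | some z => !₂[2 * z.re / (1 + ‖z‖ ^ 2), 2 * z.im / (1 + ‖z‖ ^ 2), (‖z‖ ^ 2 - 1) / (1 + ‖z‖ ^ 2)]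

theorem norm_toR3 (p : RiemannSphere) : ‖toR3 p‖ = 1 := by
  have h : ‖toR3 p‖ ^ 2 = 1 := by
    rw [EuclideanSpace.norm_sq_eq]
    rcases p with _ | z
    · simp [toR3, Fin.sum_univ_three]
    · have hz : ‖z‖ ^ 2 = z.re ^ 2 + z.im ^ 2 := by
        rw [Complex.sq_norm, Complex.normSq_apply]; ring
      have hpos : (1 + (z.re ^ 2 + z.im ^ 2)) ≠ 0 := by positivity
      simp only [toR3, Fin.sum_univ_three, hz, Real.norm_eq_abs, sq_abs]
      simp
      field_simp
      ring
  have h0 := norm_nonneg (toR3 p)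
  nlinarith

theorem toR3_injective : Function.Injective toR3 := by
  intro p q h
  have h0 := congrArg (fun v : EuclideanSpace ℝ (Fin 3) => v 0) h
  have h1 := congrArg (fun v : EuclideanSpace ℝ (Fin 3) => v 1) h
  have h2 := congrArg (fun v : EuclideanSpace ℝ (Fin 3) => v 2) h
  rcases p with _ | z <;> rcases q with _ | w
  · rfl
  · exfalso
    have hpos : (0 : ℝ) < 1 + ‖w‖ ^ 2 := by positivity
    simp [toR3] at h2
    rw [eq_div_iff hpos.ne'] at h2
    linarith
  · exfalso
    have hpos : (0 : ℝ) < 1 + ‖z‖ ^ 2 := by positivity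
    simp [toR3] at h2
    rw [div_eq_iff hpos.ne'] at h2
    linarith
  · have hz : (0 : ℝ) < 1 + ‖z‖ ^ 2 := by positivity
    have hw : (0 : ℝ) < 1 + ‖w‖ ^ 2 := by positivity
    simp [toR3] at h0 h1 h2
    rw [div_eq_div_iff hz.ne' hw.ne'] at h0 h1 h2
    have hn : ‖z‖ ^ 2 = ‖w‖ ^ 2 := by linarith
    rw [hn] at h0 h1
    have hre : z.re = w.re := by
      have := mul_right_cancel₀ hw.ne' h0
      linarith
    have him : z.im = w.im := by
      have := mul_right_cancel₀ hw.ne' h1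
      linarith
    exact congrArg some (Complex.ext hre him)

/-- The spherical metric, with length element `2 |dz| / (1 + |z|²)`: the distance of two points is
the angle between the corresponding points of the unit sphere. -/
instance : MetricSpace RiemannSphere where
  dist p q := InnerProductGeometry.angle (toR3 p) (toR3 q)
  dist_self p := InnerProductGeometry.angle_self (by
    intro h; have := norm_toR3 p; simp [h] at this)
  dist_comm p q := InnerProductGeometry.angle_comm _ _
  dist_triangle p q s := InnerProductGeometry.angle_le_angle_add_angle _ _ _
  eq_of_dist_eq_zero := by
    intro p q h
    obtain ⟨-, r, hr, hrq⟩ := InnerProductGeometry.angle_eq_zero_iff.1 h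
    have hn := congrArg norm hrq
    rw [norm_smul, norm_toR3, norm_toR3, mul_one, Real.norm_of_nonneg hr.le] at hn
    rw [← hn, one_smul] at hrq
    exact (toR3_injective hrq).symm

end RiemannSphere

/-- The two model surfaces: the Riemann sphere and the closed unit disk. -/
inductive ModelSurface
  | sphere
  | disk

namespace ModelSurface

/-- The points of a model surface. -/
def Carrier : ModelSurface → Type
  | sphere => RiemannSphere
  | disk => Metric.closedBall (0 : ℂ) 1

/-- The sphere carries the spherical metric, the disk the Euclidean metric. -/
instance : (Ω : ModelSurface) → MetricSpace Ω.Carrier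
  | sphere => inferInstanceAs (MetricSpace RiemannSphere)
  | disk => inferInstanceAs (MetricSpace (Metric.closedBall (0 : ℂ) 1))

instance (Ω : ModelSurface) : MeasurableSpace Ω.Carrier := borel _

instance (Ω : ModelSurface) : BorelSpace Ω.Carrier := ⟨rfl⟩

open Classical in
/-- The coordinate of the closed unit disk (with an irrelevant value outside the disk). -/
def diskOfComplex (z : ℂ) : Metric.closedBall (0 : ℂ) 1 :=
  if hz : z ∈ Metric.closedBall (0 : ℂ) 1 then ⟨z, hz⟩ else ⟨0, by simp⟩

/-- Conformal homeomorphisms from a model surface onto a polyhedral Riemann surface. On the sphere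
we use the coordinates `z` and `1 / z`, on the disk the coordinate of the plane. -/
def IsConformal {Y : Type*} [MetricSpace Y] (S : PolyhedralRiemannSurface Y) :
    (Ω : ModelSurface) → (Ω.Carrier ≃ₜ Y) → Prop
  | sphere, h =>
      S.IsConformalAlong (Ω := RiemannSphere) univ RiemannSphere.ofComplex h ∧
      S.IsConformalAlong (Ω := RiemannSphere) univ RiemannSphere.ofComplexInv h
  | disk, h =>
      S.IsConformalAlong (Ω := Metric.closedBall (0 : ℂ) 1) (Metric.closedBall 0 1)
        diskOfComplex h

end ModelSurface

end

/-! Away from the finitely many points over vertices, a conformal map `h n` multiplies infinitesimal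
distances by a factor `g n`. This factor is an upper gradient of `h n`, and the integral of its
square over a set is at most the area of the image. Apart from topology, these two consequences of
`IsMetricConformal` are all that the limit argument needs from conformality. The area hypothesis for
the whole of `X` bounds the energies uniformly for large `n`.

Compactness. By the length-area method (`IsPolarChart.ofReal_log_mul_le`), bounded energy yields
around each point, for every `n`, a circle of controlled small radius whose image under `h n` has
small diameter. This image separates `Y n`. The spaces `Y n` are almost geodesic and converge to
`X`, which has no cut points, being homeomorphic to a sphere or a disk. Therefore a set of small
diameter cannot split `Y n` into two large pieces (`exists_forall_separates`). So either the image
of the disk or the image of its complement is small, and the normalization rules out the latter. The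
resulting asymptotic equicontinuity is enough for an Arzelà–Ascoli argument, although the maps `f n`
may be discontinuous.

Topology of the limit `H`. Its range is compact and dense. If a fibre split into two closed parts,
almost geodesic connected sets joining the images of points of the two parts would pull back to
connected sets that leave neighbourhoods of both parts, yet whose images are close to a point in the
limit; this is impossible by compactness.

Analysis of the limit. Convex combinations `G k` of tails of the bounded sequence `g n` converge
rapidly in `L²` to some `v`. Both properties of `g n` are stable under convex combinations. By
Fuglede's argument `|v|` is an upper gradient of `H` along all curves on which one fixed `L²`
function has finite integral. Since `h n` maps `H ⁻¹' s` into the preimage under `f n` of a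
thickening of `s`, the energy of `v` on `H ⁻¹' s` is at most `K` times the area of `s`. If `ρ` is
admissible for the image family, then `(ρ ∘ H) * |v|` is admissible for the original one up to
negligible corrections, and its energy is at most `K` times that of `ρ`. This gives the modulus
inequality and the Sobolev property (`modulus_le_and_memSobolev`).

Polyhedral geometry enters in two places: the surfaces are almost geodesic because their metric is
defined by chains of paths, and off the vertices natural charts are isometries near their centres.
The latter rests on the fact that the exponent of such a chart must be one
(`IsNaturalChart.power_eq_one`). -/

noncomputable section



/-! ### Maps that are infinitesimally similarities -/

/-- Along the filter `l`, the map `f` multiplies distances asymptotically by the factor `g`. -/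
def HasMetricDeriv {A B : Type*} [MetricSpace A] [MetricSpace B] (f : A → B) (g : ℝ)
    (l : Filter A) : Prop :=
  ∀ ε > 0, ∀ᶠ p in l ×ˢ l, |dist (f p.1) (f p.2) - g * dist p.1 p.2| ≤ ε * dist p.1 p.2

/-- The quotient rule for asymptotic factors: if `e` scales by `lam` and `f ∘ e` by `μ`, then `f`
scales by their quotient. The inclusion `m ≤ map e l` replaces an inverse of `e`: every pair near
the target comes from a pair in the parameter domain. -/
theorem HasMetricDeriv.of_comp {A B C : Type*} [MetricSpace A] [MetricSpace B] [MetricSpace C]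
    {f : A → B} {e : C → A} {lam μ : ℝ} {l : Filter C} {m : Filter A}
    (he : HasMetricDeriv e lam l) (hfe : HasMetricDeriv (f ∘ e) μ l) (hlam : 0 < lam)
    (hm : m ≤ map e l) : HasMetricDeriv f (μ / lam) m := by
  intro ε hε
  have hmm : m ×ˢ m ≤ map (Prod.map e e) (l ×ˢ l) := by
    rw [← prod_map_map_eq']
    exact Filter.prod_mono hm hm
  refine hmm ?_
  rw [mem_map]
  -- The tolerance `lam / 2` makes `e` expand by at least `lam / 2`. The other one keeps the error
  -- of `e`, multiplied by `|μ| / lam`, below `ε * lam / 4`; the summand `1` covers `μ = 0`.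
  have h1 : 0 < min (lam / 2) (ε * lam ^ 2 / (4 * (|μ| + 1))) := by positivity
  have h2 : 0 < ε * lam / 4 := by positivity
  filter_upwards [he _ h1, hfe _ h2] with ⟨z, w⟩ hz hw
  simp only [Function.comp, Prod.map, mem_preimage, mem_ofPred_eq] at *
  set d := dist z w with hd
  set D := dist (e z) (e w) with hD
  set F := dist (f (e z)) (f (e w))
  have hd0 : 0 ≤ d := dist_nonneg
  have hz1 : |D - lam * d| ≤ lam / 2 * d :=
    hz.trans (mul_le_mul_of_nonneg_right (min_le_left _ _) hd0)
  have hz2 : |D - lam * d| ≤ ε * lam ^ 2 / (4 * (|μ| + 1)) * d :=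
    hz.trans (mul_le_mul_of_nonneg_right (min_le_right _ _) hd0)
  have hdD : d ≤ 2 / lam * D := by
    have := (abs_le.1 hz1).1
    rw [div_mul_eq_mul_div, le_div_iff₀ hlam]
    linarith
  have key : |F - μ / lam * D| ≤
      ε * lam / 4 * d + |μ| / lam * (ε * lam ^ 2 / (4 * (|μ| + 1)) * d) := by
    have : F - μ / lam * D = (F - μ * d) - μ / lam * (D - lam * d) := by
      field_simp
      ring
    rw [this]
    refine (abs_sub _ _).trans (add_le_add hw ?_)
    rw [abs_mul, abs_div, abs_of_pos hlam]
    gcongr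
  refine key.trans ?_
  have h3 : |μ| / lam * (ε * lam ^ 2 / (4 * (|μ| + 1)) * d) ≤ ε * lam / 4 * d := by
    have : |μ| / lam * (ε * lam ^ 2 / (4 * (|μ| + 1)) * d)
        = (|μ| / (|μ| + 1)) * (ε * lam / 4 * d) := by
      field_simp
    rw [this]
    apply mul_le_of_le_one_left (by positivity)
    rw [div_le_one (by positivity)]
    linarith
  calc _ ≤ ε * lam / 4 * d + ε * lam / 4 * d := by linarith
    _ = ε * lam / 2 * d := by ring
    _ ≤ ε * lam / 2 * (2 / lam * D) := by gcongr
    _ = ε * D := by field_simp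

/-- A homeomorphic or merely continuous map `f` that is infinitesimally a similarity, with factor
`g`, away from a finite set `P`. -/
structure IsMetricConformal {A B : Type*} [MetricSpace A] [MetricSpace B] (f : A → B)
    (g : A → ℝ≥0) (P : Finset A) : Prop where
  continuous : Continuous f
  deriv : ∀ x ∉ P, HasMetricDeriv f (g x) (𝓝 x)
  zero : ∀ x ∈ P, g x = 0

namespace IsMetricConformal

variable {A B : Type*} [MetricSpace A] [MetricSpace B] {f : A → B} {g : A → ℝ≥0} {P : Finset A}

theorem exists_isOpen (hf : IsMetricConformal f g P) {x : A} (hx : x ∉ P) {ε : ℝ} (hε : 0 < ε) :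
    ∃ U : Set A, IsOpen U ∧ x ∈ U ∧ (∀ p ∈ U, p ∉ P) ∧
      ∀ p ∈ U, ∀ q ∈ U, |dist (f p) (f q) - g x * dist p q| ≤ ε * dist p q := by
  have h1 := hf.deriv x hx ε hε
  rw [← nhds_prod_eq] at h1
  obtain ⟨V, hV, hxV, h2⟩ := (mem_nhds_prod_iff'.1 h1)
  obtain ⟨h2, h3, h4, h5⟩ := h2
  refine ⟨V ∩ hV ∩ (P : Set A)ᶜ, (hxV.inter h3).inter P.finite_toSet.isClosed.isOpen_compl,
    ⟨⟨h2, h4⟩, by simpa using hx⟩, fun p hp => by simpa using hp.2, fun p hp q hq => ?_⟩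
  exact h5 (mk_mem_prod hp.1.1 hq.1.2)

/-- Near `y` the distances of `f` are governed by `g x` and by `g y` at once. Comparing the two on
one pair of distinct points, which exists because `y` is not isolated, shows that `g y` is close to
`g x`. -/
theorem exists_isOpen_abs_sub_le [∀ x : A, (𝓝[≠] x).NeBot] (hf : IsMetricConformal f g P)
    {x : A} (hx : x ∉ P) {ε : ℝ} (hε : 0 < ε) :
    ∃ U : Set A, IsOpen U ∧ x ∈ U ∧ (∀ p ∈ U, p ∉ P) ∧ (∀ p ∈ U, |(g p : ℝ) - g x| ≤ ε) ∧
      ∀ p ∈ U, ∀ q ∈ U, |dist (f p) (f q) - g x * dist p q| ≤ ε * dist p q := by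
  obtain ⟨U, hU, hxU, hUP, h⟩ := hf.exists_isOpen hx (half_pos hε)
  refine ⟨U, hU, hxU, hUP, fun y hy => ?_, fun p hp q hq => (h p hp q hq).trans ?_⟩
  · obtain ⟨V, hV, hyV, -, h'⟩ := hf.exists_isOpen (hUP y hy) (half_pos hε)
    obtain ⟨z, hz, hzy⟩ := (inferInstance : (𝓝[≠] y).NeBot).nonempty_of_mem
      (inter_mem (mem_nhdsWithin_of_mem_nhds ((hU.inter hV).mem_nhds ⟨hy, hyV⟩))
        self_mem_nhdsWithin)
    have hpos : 0 < dist z y := dist_pos.2 hzy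
    have a1 := abs_le.1 (h z hz.1 y hy)
    have a2 := abs_le.1 (h' z hz.2 y hyV)
    rw [abs_le]
    constructor <;> nlinarith
  · have := @dist_nonneg _ _ p q
    nlinarith

theorem continuousAt [∀ x : A, (𝓝[≠] x).NeBot] (hf : IsMetricConformal f g P)
    {x : A} (hx : x ∉ P) : ContinuousAt g x := by
  rw [Metric.continuousAt_iff']
  intro ε hε
  obtain ⟨U, hU, hxU, -, h, -⟩ := hf.exists_isOpen_abs_sub_le hx (half_pos hε)
  filter_upwards [hU.mem_nhds hxU] with y hy
  rw [NNReal.dist_eq]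
  have := h y hy
  linarith

theorem measurable [∀ x : A, (𝓝[≠] x).NeBot] [MeasurableSpace A] [BorelSpace A]
    (hf : IsMetricConformal f g P) : Measurable g := by
  classical
  have h1 : Measurable (fun x : ((P : Set A)ᶜ : Set A) => g x) := by
    apply Continuous.measurable
    refine continuousOn_iff_continuous_domRestrict.1 ?_
    exact fun x hx => (hf.continuousAt (by simpa using hx)).continuousWithinAt
  have h2 : Measurable (fun x : (P : Set A) => g x) := by
    have : (fun x : (P : Set A) => g x) = fun _ => 0 := by
      ext x
      simp [hf.zero x x.2]
    rw [this]
    exact measurable_const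
  exact measurable_of_measurable_union_cover (P : Set A) (P : Set A)ᶜ
    P.finite_toSet.measurableSet P.finite_toSet.measurableSet.compl (by simp) h2 h1

end IsMetricConformal

/-- A transitive relation that holds locally on a compact interval holds between its end points. -/
theorem rel_Icc_of_locally {R : ℝ → ℝ → Prop} {a b : ℝ} (hab : a ≤ b)
    (hrefl : R a a)
    (htrans : ∀ s t, a ≤ s → s ≤ t → t ≤ b → R a s → R s t → R a t)
    (hloc : ∀ u ∈ Icc a b, ∃ δ > 0, ∀ t ∈ Icc a b, (u - δ < t → t ≤ u → R t u) ∧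
      (t < u + δ → u ≤ t → R u t)) : R a b := by
  set S := {t ∈ Icc a b | R a t} with hS
  have haS : a ∈ S := ⟨⟨le_rfl, hab⟩, hrefl⟩
  have hbdd : BddAbove S := ⟨b, fun t ht => ht.1.2⟩
  set u := sSup S
  have hu : u ∈ Icc a b := ⟨le_csSup hbdd haS, csSup_le ⟨a, haS⟩ fun t ht => ht.1.2⟩
  obtain ⟨δ, hδ, h⟩ := hloc u hu
  obtain ⟨s, hs, hus⟩ := exists_lt_of_lt_csSup ⟨a, haS⟩ (show u - δ < sSup S by
    change u - δ < u
    linarith)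
  have hsu : s ≤ u := le_csSup hbdd hs
  have hRu : R a u := htrans s u hs.1.1 hsu hu.2 hs.2 ((h s hs.1).1 hus hsu)
  have key : ∀ t ∈ Icc a b, u ≤ t → t < u + δ → R a t := fun t ht hut htu =>
    htrans u t hu.1 hut ht.2 hRu ((h t ht).2 htu hut)
  rcases lt_or_ge b (u + δ) with hb | hb
  · exact key b ⟨hab, le_rfl⟩ hu.2 hb
  · exfalso
    have h1 : u + δ / 2 ∈ Icc a b := ⟨by linarith [hu.1], by linarith⟩
    have := le_csSup hbdd (show u + δ / 2 ∈ S from ⟨h1, key _ h1 (by linarith) (by linarith)⟩)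
    change u + δ / 2 ≤ u at this
    linarith

theorem lintegral_Icc_add_lintegral_Icc (φ : ℝ → ℝ≥0∞) {a b c : ℝ} (hab : a ≤ b) (hbc : b ≤ c) :
    (∫⁻ t in Icc a b, φ t) + ∫⁻ t in Icc b c, φ t = ∫⁻ t in Icc a c, φ t := by
  have h1 : ∫⁻ t in Icc b c, φ t = ∫⁻ t in Ioc b c, φ t :=
    setLIntegral_congr Ioc_ae_eq_Icc.symm
  rw [h1, ← lintegral_union measurableSet_Ioc, Icc_union_Ioc_eq_Icc hab hbc]
  rw [Set.disjoint_left]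
  intro x hx hx'
  exact absurd hx.2 (not_le.2 hx'.1)

/-! ### The scaling factor is an upper gradient. -/

namespace IsMetricConformal

variable {A B : Type*} [MetricSpace A] [MetricSpace B] {f : A → B} {g : A → ℝ≥0} {P : Finset A}

/-- Both sides behave well under concatenation, so short intervals suffice. There `g` is almost
constant and `f` almost a similarity; each of the two errors takes one half of `ε`. -/
theorem edist_le_lintegral_add [∀ x : A, (𝓝[≠] x).NeBot] (hf : IsMetricConformal f g P)
    {L : ℝ≥0} {c : ℝ → A} {a b : ℝ} (hab : a ≤ b) (hc : LipschitzOnWith L c (Icc a b))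
    (hP : ∀ t ∈ Icc a b, c t ∉ P) {ε : ℝ≥0} (hε : 0 < ε) :
    edist (f (c a)) (f (c b)) ≤ L * ∫⁻ t in Icc a b, (g (c t) + ε : ℝ≥0∞) := by
  refine rel_Icc_of_locally
    (R := fun s t => edist (f (c s)) (f (c t)) ≤ L * ∫⁻ t in Icc s t, (g (c t) + ε : ℝ≥0∞)) hab
    (by simp) ?_ ?_
  · intro s t has hst htb h1 h2
    rw [← lintegral_Icc_add_lintegral_Icc _ has hst, mul_add]
    exact (edist_triangle _ _ _).trans (add_le_add h1 h2)
  · intro u hu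
    have hε' : (0 : ℝ) < ε / 2 := by positivity
    obtain ⟨U, hU, huU, -, hg, hd⟩ := hf.exists_isOpen_abs_sub_le (hP u hu) hε'
    have hcu : c ⁻¹' U ∈ 𝓝[Icc a b] u := hc.continuousOn u hu (hU.mem_nhds huU)
    obtain ⟨δ, hδ, hball⟩ := Metric.mem_nhdsWithin_iff.1 hcu
    suffices h : ∀ s ∈ Icc a b, ∀ t ∈ Icc a b, u - δ < s → s ≤ t → t < u + δ →
        edist (f (c s)) (f (c t)) ≤ L * ∫⁻ t in Icc s t, (g (c t) + ε : ℝ≥0∞) from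
      ⟨δ, hδ, fun t ht => ⟨fun h1 h2 => h t ht u hu h1 h2 (by linarith),
        fun h1 h2 => h u hu t ht (by linarith) h2 h1⟩⟩
    intro s hs t ht h1 hst h2
    have hmem : ∀ r ∈ Icc s t, c r ∈ U := fun r hr => hball
      ⟨by rw [Metric.mem_ball, Real.dist_eq, abs_lt]; constructor <;> linarith [hr.1, hr.2],
        ⟨hs.1.trans hr.1, hr.2.trans ht.2⟩⟩
    have hsU := hmem s ⟨le_rfl, hst⟩
    have htU := hmem t ⟨hst, le_rfl⟩
    have e1 : edist (f (c s)) (f (c t)) ≤ ENNReal.ofReal ((g (c u) + ε / 2) * (L * (t - s))) := by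
      rw [edist_dist]
      apply ENNReal.ofReal_le_ofReal
      have := (abs_le.1 (hd _ hsU _ htU)).2
      have hl := hc.dist_le_mul s hs t ht
      rw [Real.dist_eq, abs_sub_comm, abs_of_nonneg (by linarith)] at hl
      calc dist (f (c s)) (f (c t)) ≤ (g (c u) + ε / 2) * dist (c s) (c t) := by linarith
        _ ≤ _ := by gcongr
    have e2 : ENNReal.ofReal (g (c u) + ε / 2) * ENNReal.ofReal (t - s) ≤
        ∫⁻ r in Icc s t, (g (c r) + ε : ℝ≥0∞) := by
      rw [← Real.volume_Icc, ← setLIntegral_const]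
      refine setLIntegral_mono' measurableSet_Icc fun r hr => ?_
      have := (abs_le.1 (hg _ (hmem r hr))).1
      rw [← ENNReal.coe_add, ← ENNReal.ofReal_coe_nnreal]
      apply ENNReal.ofReal_le_ofReal
      push_cast
      linarith
    refine e1.trans ?_
    rw [ENNReal.ofReal_mul (by positivity), ENNReal.ofReal_mul (by positivity),
      ENNReal.ofReal_coe_nnreal, mul_left_comm]
    gcongr

theorem edist_le_lintegral_of_notMem [∀ x : A, (𝓝[≠] x).NeBot] (hf : IsMetricConformal f g P)
    {L : ℝ≥0} {c : ℝ → A} {a b : ℝ} (hab : a ≤ b) (hc : LipschitzOnWith L c (Icc a b))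
    (hP : ∀ t ∈ Icc a b, c t ∉ P) :
    edist (f (c a)) (f (c b)) ≤ L * ∫⁻ t in Icc a b, (g (c t) : ℝ≥0∞) := by
  have hlim : Tendsto (fun n : ℕ => (L : ℝ≥0∞) * (∫⁻ t in Icc a b, (g (c t) : ℝ≥0∞))
      + L * (((1 / ((n : ℝ≥0) + 1) : ℝ≥0) : ℝ≥0∞) * ENNReal.ofReal (b - a))) atTop
      (𝓝 ((L : ℝ≥0∞) * (∫⁻ t in Icc a b, (g (c t) : ℝ≥0∞)) + L * (((0 : ℝ≥0) : ℝ≥0∞)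
        * ENNReal.ofReal (b - a)))) := by
    refine tendsto_const_nhds.add (ENNReal.Tendsto.const_mul (ENNReal.Tendsto.mul_const ?_ 
      (Or.inr ENNReal.ofReal_ne_top)) (Or.inr ENNReal.coe_ne_top))
    rw [ENNReal.tendsto_coe]
    exact tendsto_one_div_add_atTop_nhds_zero_nat
  simp only [ENNReal.coe_zero, zero_mul, mul_zero, add_zero] at hlim
  refine ge_of_tendsto' hlim fun n => ?_
  have := hf.edist_le_lintegral_add hab hc hP (ε := 1 / ((n : ℝ≥0) + 1)) (by positivity)
  rw [lintegral_add_right _ measurable_const, lintegral_const, Measure.restrict_apply_univ,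
    Real.volume_Icc, mul_add] at this
  exact this

/-- Induction on a finite set containing the exceptional points on the curve. For a new point `p`,
the loop between the first and the last visit to `p` is discarded; the remaining pieces avoid `p`
except at one end, which is reached by continuity of `f`. -/
theorem edist_le_lintegral_aux [∀ x : A, (𝓝[≠] x).NeBot] (hf : IsMetricConformal f g P)
    {L : ℝ≥0} {c : ℝ → A} (Q : Finset A) : ∀ {a b : ℝ}, a ≤ b → LipschitzOnWith L c (Icc a b) →
    (∀ t ∈ Icc a b, c t ∈ P → c t ∈ Q) →
    edist (f (c a)) (f (c b)) ≤ L * ∫⁻ t in Icc a b, (g (c t) : ℝ≥0∞) := by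
  classical
  induction Q using Finset.induction_on with
  | empty =>
    intro a b hab hc hP
    exact hf.edist_le_lintegral_of_notMem hab hc fun t ht h => by simpa using hP t ht h
  | insert p Q _ ih =>
    intro a b hab hc hP
    set T := Icc a b ∩ c ⁻¹' {p} with hT
    have hTc : IsClosed T := hc.continuousOn.preimage_isClosed_of_isClosed isClosed_Icc
      isClosed_singleton
    have hTK : IsCompact T := isCompact_Icc.of_isClosed_subset hTc inter_subset_left
    rcases T.eq_empty_or_nonempty with hemp | hne
    · refine ih hab hc fun t ht h => ?_
      rcases Finset.mem_insert.1 (hP t ht h) with h' | h'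
      · exact absurd (show t ∈ T from ⟨ht, h'⟩) (by simp [hemp])
      · exact h'
    obtain ⟨t0, ht0, h0⟩ := hTK.exists_isLeast hne
    obtain ⟨t1, ht1, h1⟩ := hTK.exists_isGreatest hne
    have h01 : t0 ≤ t1 := h0 ht1
    have hfc : ContinuousOn (fun t => f (c t)) (Icc a b) :=
      hf.continuous.comp_continuousOn hc.continuousOn
    have left : edist (f (c a)) (f p) ≤ L * ∫⁻ t in Icc a t0, (g (c t) : ℝ≥0∞) := by
      rcases ht0.1.1.eq_or_lt with h | h
      · rw [h, ht0.2]; simp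
      have hmem : ∀ᶠ t in 𝓝[<] t0, t ∈ Ioo a t0 := Ioo_mem_nhdsLT h
      have : Tendsto (fun t => edist (f (c a)) (f (c t))) (𝓝[<] t0)
          (𝓝 (edist (f (c a)) (f (c t0)))) := by
        refine tendsto_const_nhds.edist ((hfc t0 ht0.1).mono_left ?_)
        exact nhdsWithin_le_iff.2 (hmem.mono fun t ht => ⟨ht.1.le, ht.2.le.trans ht0.1.2⟩)
      rw [show c t0 = p from ht0.2] at this
      refine le_of_tendsto this (hmem.mono fun t ht => ?_)
      have hsub : Icc a t ⊆ Icc a b := Icc_subset_Icc_right (ht.2.le.trans ht0.1.2)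
      refine (ih ht.1.le (hc.mono hsub) fun s hs h => ?_).trans
        (mul_le_mul_right (lintegral_mono_set (Icc_subset_Icc_right ht.2.le)) _)
      rcases Finset.mem_insert.1 (hP s (hsub hs) h) with h' | h'
      · exact absurd (h0 ⟨hsub hs, h'⟩) (not_le.2 (hs.2.trans_lt ht.2))
      · exact h'
    have right : edist (f p) (f (c b)) ≤ L * ∫⁻ t in Icc t1 b, (g (c t) : ℝ≥0∞) := by
      rcases ht1.1.2.eq_or_lt with h | h
      · rw [← h, ht1.2]; simp
      have hmem : ∀ᶠ t in 𝓝[>] t1, t ∈ Ioo t1 b := Ioo_mem_nhdsGT h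
      have : Tendsto (fun t => edist (f (c t)) (f (c b))) (𝓝[>] t1)
          (𝓝 (edist (f (c t1)) (f (c b)))) := by
        refine Tendsto.edist ((hfc t1 ht1.1).mono_left ?_) tendsto_const_nhds
        exact nhdsWithin_le_iff.2 (hmem.mono fun t ht => ⟨ht1.1.1.trans ht.1.le, ht.2.le⟩)
      rw [show c t1 = p from ht1.2] at this
      refine le_of_tendsto this (hmem.mono fun t ht => ?_)
      have hsub : Icc t b ⊆ Icc a b := Icc_subset_Icc_left (ht1.1.1.trans ht.1.le)
      refine (ih ht.2.le (hc.mono hsub) fun s hs h => ?_).trans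
        (mul_le_mul_right (lintegral_mono_set (Icc_subset_Icc_left ht.1.le)) _)
      rcases Finset.mem_insert.1 (hP s (hsub hs) h) with h' | h'
      · exact absurd (h1 ⟨hsub hs, h'⟩) (not_le.2 (ht.1.trans_le hs.1))
      · exact h'
    -- The interval from `t1` to `b` is enlarged so that it abuts the first one at `t0`.
    calc edist (f (c a)) (f (c b)) ≤ edist (f (c a)) (f p) + edist (f p) (f (c b)) :=
          edist_triangle _ _ _
      _ ≤ L * (∫⁻ t in Icc a t0, (g (c t) : ℝ≥0∞)) + L * ∫⁻ t in Icc t1 b, (g (c t) : ℝ≥0∞) :=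
          add_le_add left right
      _ ≤ L * (∫⁻ t in Icc a t0, (g (c t) : ℝ≥0∞)) + L * ∫⁻ t in Icc t0 b, (g (c t) : ℝ≥0∞) := by
          gcongr
      _ = _ := by
          rw [← mul_add, lintegral_Icc_add_lintegral_Icc _ ht0.1.1 ht0.1.2]

/-- The factor `g` is an upper gradient. -/
theorem edist_le_lintegral [∀ x : A, (𝓝[≠] x).NeBot] (hf : IsMetricConformal f g P)
    {L : ℝ≥0} {c : ℝ → A} {a b : ℝ} (hab : a ≤ b) (hc : LipschitzOnWith L c (Icc a b)) :
    edist (f (c a)) (f (c b)) ≤ L * ∫⁻ t in Icc a b, (g (c t) : ℝ≥0∞) :=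
  hf.edist_le_lintegral_aux P hab hc fun _ _ h => h

end IsMetricConformal

/-! ### The change of variables inequality. -/

/-- A countable open cover suffices to compare two measures. -/
theorem measure_le_of_locally {A : Type*} [TopologicalSpace A] [SecondCountableTopology A]
    [MeasurableSpace A] [BorelSpace A] {μ ν : Measure A} (P : Set A) (hP : μ P = 0)
    (h : ∀ x ∉ P, ∃ U, IsOpen U ∧ x ∈ U ∧ ∀ s ⊆ U, MeasurableSet s → μ s ≤ ν s) : μ ≤ ν := by
  choose! U hU hxU hle using h
  obtain ⟨T, hT, hTU⟩ := TopologicalSpace.isOpen_iUnion_countable (fun x : (Pᶜ : Set A) => U x)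
    fun x => hU x x.2
  refine Measure.le_iff.2 fun s hs => ?_
  have key : μ (s ∩ ⋃ x ∈ T, U (x : A)) ≤ ν (s ∩ ⋃ x ∈ T, U (x : A)) := by
    rcases T.eq_empty_or_nonempty with hemp | hne
    · simp [hemp]
    obtain ⟨u, hu⟩ := hT.exists_eq_range hne
    have e : ⋃ x ∈ T, U (x : A) = ⋃ n, disjointed (fun n => U (u n : A)) n := by
      rw [iUnion_disjointed, hu, biUnion_range]
    have hm : ∀ n, MeasurableSet (disjointed (fun n => U (u n : A)) n) :=
      MeasurableSet.disjointed fun n => (hU _ (u n).2).measurableSet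
    rw [e, inter_iUnion, measure_iUnion _ fun n => hs.inter (hm n),
      measure_iUnion _ fun n => hs.inter (hm n)]
    · refine ENNReal.tsum_le_tsum fun n => hle (u n) (u n).2 _ ?_ (hs.inter (hm n))
      exact inter_subset_right.trans (disjointed_subset _ n)
    all_goals
      intro i j hij
      exact ((disjoint_disjointed _ hij).mono inter_subset_right inter_subset_right)
  calc μ s ≤ μ ((s ∩ ⋃ x ∈ T, U (x : A)) ∪ P) := by
        refine measure_mono fun x hx => ?_
        by_cases hxP : x ∈ P
        · exact Or.inr hxP
        · refine Or.inl ⟨hx, ?_⟩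
          rw [hTU]
          exact mem_iUnion.2 ⟨⟨x, hxP⟩, hxU x hxP⟩
    _ ≤ μ (s ∩ ⋃ x ∈ T, U (x : A)) + μ P := measure_union_le _ _
    _ ≤ ν s := by
        rw [hP, add_zero]
        exact key.trans (measure_mono inter_subset_left)

theorem hausdorffTwo_finset {A : Type*} [MetricSpace A] [MeasurableSpace A] [BorelSpace A]
    (P : Finset A) : hausdorffTwo A P = 0 := by
  simp only [hausdorffTwo, Measure.smul_apply, smul_eq_mul]
  have := Measure.nullSingletonClass_hausdorff A (d := 2) (by norm_num)
  rw [Set.Countable.measure_zero P.countable_toSet, mul_zero]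

theorem hausdorffTwo_image_le {A B : Type*} [MetricSpace A] [MeasurableSpace A] [BorelSpace A]
    [MetricSpace B] [MeasurableSpace B] [BorelSpace B] {f : A → B} {s : Set A} {L : ℝ≥0}
    (hf : LipschitzOnWith L f s) : hausdorffTwo B (f '' s) ≤ (L : ℝ≥0∞) ^ 2 * hausdorffTwo A s := by
  simp only [hausdorffTwo, Measure.smul_apply, smul_eq_mul]
  rw [mul_left_comm]
  gcongr
  simpa using hf.hausdorffMeasure_image_le (d := 2) (by norm_num)

namespace IsMetricConformal

/-- The change of variables inequality for homeomorphisms that are infinitesimally similarities. -/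
theorem setLIntegral_sq_le {A B : Type*} [MetricSpace A] [MeasurableSpace A]
    [BorelSpace A] [SecondCountableTopology A] [∀ x : A, (𝓝[≠] x).NeBot] [MetricSpace B]
    [MeasurableSpace B] [BorelSpace B]
    {f : A ≃ₜ B} {g : A → ℝ≥0} {P : Finset A} (hf : IsMetricConformal f g P)
    {s : Set A} (hs : MeasurableSet s) :
    ∫⁻ x in s, (g x : ℝ≥0∞) ^ 2 ∂(hausdorffTwo A) ≤ hausdorffTwo B (f '' s) := by
  have hg : Measurable g := hf.measurable
  set ν : Measure A := (hausdorffTwo B).map f.symm with hν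
  have hνs : ∀ t, MeasurableSet t → ν t = hausdorffTwo B (f '' t) := by
    intro t ht
    rw [hν, Measure.map_apply f.symm.continuous.measurable ht, ← Homeomorph.image_eq_preimage_symm]
  -- Lowering `g` by `2 * ε` leaves one `ε` for the oscillation of `g` near `x` and one for the
  -- deviation of `f` from a similarity. Monotone convergence then removes the loss.
  have key : ∀ n : ℕ, (hausdorffTwo A).withDensity
      (fun x => ((g x - 2 / ((n : ℝ≥0) + 1) : ℝ≥0) : ℝ≥0∞) ^ 2) ≤ ν := by
    intro n
    set ε : ℝ≥0 := 1 / ((n : ℝ≥0) + 1) with hε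
    have hε0 : 0 < ε := by positivity
    have h2 : 2 / ((n : ℝ≥0) + 1) = 2 * ε := by rw [hε]; ring
    rw [h2]
    refine measure_le_of_locally P (withDensity_absolutelyContinuous _ _ (hausdorffTwo_finset P)) ?_
    intro x hx
    obtain ⟨U, hU, hxU, -, h1, h2⟩ := hf.exists_isOpen_abs_sub_le (x := x) (by simpa using hx)
      (ε := ε) (by positivity)
    refine ⟨U, hU, hxU, fun t htU ht => ?_⟩
    rw [withDensity_apply _ ht, hνs t ht]
    have e1 : ∫⁻ y in t, ((g y - 2 * ε : ℝ≥0) : ℝ≥0∞) ^ 2 ∂(hausdorffTwo A)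
        ≤ ((g x - ε : ℝ≥0) : ℝ≥0∞) ^ 2 * hausdorffTwo A t := by
      rw [← setLIntegral_const]
      refine setLIntegral_mono' ht fun y hy => ?_
      refine pow_le_pow_left' (ENNReal.coe_le_coe.2 ?_) 2
      have := (abs_le.1 (h1 y (htU hy))).2
      have h3 : g y ≤ g x + ε := by
        rw [← NNReal.coe_le_coe]; push_cast; linarith
      rw [tsub_le_iff_left]
      refine h3.trans ?_
      calc g x + ε ≤ ((g x - ε) + ε) + ε := by gcongr; exact le_tsub_add
        _ = _ := by ring
    refine e1.trans ?_
    rcases le_or_gt (g x) ε with hle | hlt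
    · simp [tsub_eq_zero_of_le hle]
    set κ : ℝ≥0 := g x - ε with hκ
    have hκ0 : 0 < κ := tsub_pos_of_lt hlt
    -- Near `x` the map `f` expands distances at least by `κ`, so a lower bound for the area of the
    -- image follows from the Lipschitz bound for the inverse.
    have hL : LipschitzOnWith κ⁻¹ f.symm (f '' t) := by
      rintro _ ⟨p, hp, rfl⟩ _ ⟨q, hq, rfl⟩
      rw [f.symm_apply_apply, f.symm_apply_apply, edist_nndist, edist_nndist, ← ENNReal.coe_mul,
        ENNReal.coe_le_coe, inv_mul_eq_div, le_div_iff₀ hκ0, ← NNReal.coe_le_coe]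
      push_cast
      have := (abs_le.1 (h2 p (htU hp) q (htU hq))).1
      have hκr : (κ : ℝ) = g x - ε := by rw [hκ, NNReal.coe_sub hlt.le]
      rw [hκr]
      linarith
    have e2 := hausdorffTwo_image_le hL
    rw [← image_comp] at e2
    simp only [Function.comp_def, f.symm_apply_apply, image_id'] at e2
    calc (κ : ℝ≥0∞) ^ 2 * hausdorffTwo A t
        ≤ (κ : ℝ≥0∞) ^ 2 * (((κ⁻¹ : ℝ≥0) : ℝ≥0∞) ^ 2 * hausdorffTwo B (f '' t)) := by gcongr
      _ = hausdorffTwo B (f '' t) := by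
          rw [← mul_assoc, ← mul_pow, ← ENNReal.coe_mul, mul_inv_cancel₀ hκ0.ne']
          simp
  have hlim : ∀ x, Tendsto (fun n : ℕ => ((g x - 2 / ((n : ℝ≥0) + 1) : ℝ≥0) : ℝ≥0∞) ^ 2) atTop
      (𝓝 ((g x : ℝ≥0∞) ^ 2)) := by
    intro x
    have h0 : Tendsto (fun n : ℕ => (2 / ((n : ℝ≥0) + 1) : ℝ≥0)) atTop (𝓝 0) := by
      have := (tendsto_one_div_add_atTop_nhds_zero_nat (𝕜 := ℝ≥0)).const_mul 2
      simpa only [mul_one_div, mul_zero] using this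
    have h1 : Tendsto (fun n : ℕ => (g x - 2 / ((n : ℝ≥0) + 1) : ℝ≥0)) atTop (𝓝 (g x - 0)) :=
      tendsto_const_nhds.sub h0
    rw [tsub_zero] at h1
    exact ((ENNReal.continuous_pow 2).tendsto _).comp (ENNReal.tendsto_coe.2 h1)
  have hmono : ∀ x, Monotone (fun n : ℕ => ((g x - 2 / ((n : ℝ≥0) + 1) : ℝ≥0) : ℝ≥0∞) ^ 2) := by
    intro x m n hmn
    dsimp only
    gcongr
  have ht := lintegral_tendsto_of_tendsto_of_monotone (μ := (hausdorffTwo A).restrict s)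
    (f := fun (n : ℕ) x => ((g x - 2 / ((n : ℝ≥0) + 1) : ℝ≥0) : ℝ≥0∞) ^ 2)
    (F := fun x => (g x : ℝ≥0∞) ^ 2)
    (fun n => by fun_prop)
    (ae_of_all _ hmono) (ae_of_all _ hlim)
  rw [← hνs s hs]
  refine le_of_tendsto' ht fun n => ?_
  have := Measure.le_iff.1 (key n) s hs
  rwa [withDensity_apply _ hs] at this

end IsMetricConformal




/-! ### Arc length parametrization -/

/-- The difference of the distribution functions is increasing and right continuous, hence defines a
Stieltjes measure, and `ν` is `μ` plus that measure. -/
theorem measure_le_of_Ioc_le {μ ν : Measure ℝ} [IsFiniteMeasure μ] [IsFiniteMeasure ν]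
    (h : ∀ a b, a < b → μ (Ioc a b) ≤ ν (Ioc a b)) : μ ≤ ν := by
  have hrc : ∀ (m : Measure ℝ) [IsFiniteMeasure m] (x : ℝ),
      ContinuousWithinAt (fun x => m.real (Iic x)) (Ici x) x := by
    intro m _ x
    rw [← continuousWithinAt_Ioi_iff_Ici]
    have := tendsto_measure_biInter_gt (μ := m) (s := Iic) (a := x)
      (fun r _ => measurableSet_Iic.nullMeasurableSet) (fun i j _ hij => Iic_subset_Iic.2 hij)
      ⟨x + 1, by simp, measure_ne_top _ _⟩
    have hI : ⋂ r, ⋂ (_ : r > x), Iic r = Iic x := by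
      ext y
      simp only [mem_iInter, mem_Iic]
      exact ⟨fun hy => le_of_forall_gt_imp_ge_of_dense hy, fun hy r hr => hy.trans hr.le⟩
    rw [hI] at this
    exact (ENNReal.tendsto_toReal (measure_ne_top _ _)).comp this
  have hdiff : ∀ (m : Measure ℝ) [IsFiniteMeasure m] (a b : ℝ), a ≤ b →
      m.real (Ioc a b) = m.real (Iic b) - m.real (Iic a) := by
    intro m _ a b hab
    rw [← Iic_sdiff_Iic, measureReal_sdiff (Iic_subset_Iic.2 hab) measurableSet_Iic]
  let F : StieltjesFunction ℝ :=
    { toFun := fun x => ν.real (Iic x) - μ.real (Iic x)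
      mono' := by
        intro a b hab
        rcases hab.eq_or_lt with rfl | hlt
        · exact le_rfl
        have h1 := hdiff μ a b hab
        have h2 := hdiff ν a b hab
        have h3 : μ.real (Ioc a b) ≤ ν.real (Ioc a b) :=
          ENNReal.toReal_mono (measure_ne_top _ _) (h a b hlt)
        dsimp only
        linarith
      right_continuous' := fun x => (hrc ν x).sub (hrc μ x) }
  have hν : ν = μ + F.measure := by
    refine Measure.ext_of_Ioc _ _ fun a b hab => ?_
    have h1 := hdiff μ a b hab.le
    have h2 := hdiff ν a b hab.le
    have h3 : μ.real (Ioc a b) ≤ ν.real (Ioc a b) :=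
      ENNReal.toReal_mono (measure_ne_top _ _) (h a b hab)
    rw [Measure.add_apply, F.measure_Ioc]
    have h4 : F b - F a = ν.real (Ioc a b) - μ.real (Ioc a b) := by
      change (ν.real (Iic b) - μ.real (Iic b)) - (ν.real (Iic a) - μ.real (Iic a)) = _
      linarith
    rw [h4, ENNReal.ofReal_sub _ measureReal_nonneg, ofReal_measureReal, ofReal_measureReal,
      add_tsub_cancel_of_le (h a b hab)]
  rw [hν]
  exact Measure.le_add_right le_rfl

theorem Icc_zero_one_eq_univ : (Icc 0 1 : Set I) = univ :=
  eq_univ_of_forall fun _ => ⟨unitInterval.nonneg', unitInterval.le_one'⟩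

section ArcLength

variable {Z : Type*} [MetricSpace Z] (γ : C(I, Z))

/-- The arc length of `γ` between the parameters `0` and `t`. -/
def arcLength (t : I) : ℝ := variationOnFromTo γ univ 0 t

/-- The arc length parametrization of `γ`. -/
def arcParam : ℝ → Z := naturalParameterization γ univ 0

variable {γ} (hγ : pathLength γ ≠ ∞)

include hγ

theorem locallyBoundedVariationOn_of_pathLength : LocallyBoundedVariationOn γ univ :=
  BoundedVariationOn.locallyBoundedVariationOn hγ

omit hγ in
theorem arcLength_zero : arcLength γ 0 = 0 := variationOnFromTo.self _ _ _

omit hγ in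
theorem arcLength_one : arcLength γ 1 = (pathLength γ).toReal := by
  rw [arcLength, variationOnFromTo.eq_of_le _ _ (zero_le_one)]
  rw [univ_inter, Icc_zero_one_eq_univ]
  rfl

theorem monotone_arcLength : Monotone (arcLength γ) := fun _ _ h =>
  variationOnFromTo.monotoneOn (locallyBoundedVariationOn_of_pathLength hγ) (mem_univ _)
    (mem_univ _) (mem_univ _) h

theorem ofReal_arcLength_sub {s t : I} (hst : s ≤ t) :
    ENNReal.ofReal (arcLength γ t - arcLength γ s) = eVariationOn γ (Icc s t) := by
  rw [arcLength, arcLength, variationOnFromTo.sub_right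
    (locallyBoundedVariationOn_of_pathLength hγ) (mem_univ _) (mem_univ _) (mem_univ _),
    variationOnFromTo.eq_of_le _ _ hst, univ_inter, ENNReal.ofReal_toReal]
  exact ne_top_of_le_ne_top hγ (eVariationOn.mono _ (subset_univ _))

theorem arcLength_mem (t : I) : arcLength γ t ∈ Icc 0 (pathLength γ).toReal := by
  rw [← arcLength_one, ← arcLength_zero (γ := γ)]
  exact ⟨monotone_arcLength hγ t.2.1, monotone_arcLength hγ t.2.2⟩

/-- The variation of a continuous function of bounded variation over an interval shrinking to a
point tends to zero. -/
theorem continuous_arcLength : Continuous (arcLength γ) := by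
  rw [continuous_iff_continuousAt]
  intro x
  have h1 := BoundedVariationOn.tendsto_eVariationOn_Icc_zero_left (f := γ) (s := univ) hγ
    (x := x) γ.continuous.continuousWithinAt
  have h2 := BoundedVariationOn.tendsto_eVariationOn_Icc_zero_right (f := γ) (s := univ) hγ
    x γ.continuous.continuousWithinAt
  simp only [univ_inter, nhdsWithin_univ] at h1 h2
  rw [ContinuousAt, EMetric.tendsto_nhds]
  intro ε hε
  filter_upwards [h1.eventually (gt_mem_nhds hε), h2.eventually (gt_mem_nhds hε)] with y hy1 hy2
  rcases le_total y x with h | h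
  · rw [edist_dist, Real.dist_eq, abs_sub_comm,
      abs_of_nonneg (sub_nonneg.2 (monotone_arcLength hγ h)), ofReal_arcLength_sub hγ h]
    exact hy1
  · rw [edist_dist, Real.dist_eq,
      abs_of_nonneg (sub_nonneg.2 (monotone_arcLength hγ h)), ofReal_arcLength_sub hγ h]
    exact hy2

theorem exists_arcLength_eq {s : ℝ} (hs : s ∈ Icc 0 (pathLength γ).toReal) :
    ∃ t, arcLength γ t = s := by
  rw [← arcLength_one, ← arcLength_zero (γ := γ)] at hs
  exact mem_range_of_exists_le_of_exists_ge (continuous_arcLength hγ) ⟨0, hs.1⟩ ⟨1, hs.2⟩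

theorem arcParam_arcLength (t : I) : arcParam γ (arcLength γ t) = γ t :=
  edist_eq_zero.1 (edist_naturalParameterization_eq_zero
    (locallyBoundedVariationOn_of_pathLength hγ) (mem_univ _) (mem_univ _))

theorem lipschitzOnWith_arcParam :
    LipschitzOnWith 1 (arcParam γ) (Icc 0 (pathLength γ).toReal) := by
  have key : ∀ s t : I, s ≤ t → edist (γ s) (γ t) ≤ edist (arcLength γ s) (arcLength γ t) := by
    intro s t hst
    rw [edist_comm (arcLength γ s), edist_dist (arcLength γ t), Real.dist_eq,
      abs_of_nonneg (sub_nonneg.2 (monotone_arcLength hγ hst)), ofReal_arcLength_sub hγ hst]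
    exact eVariationOn.edist_le _ (left_mem_Icc.2 hst) (right_mem_Icc.2 hst)
  intro x hx y hy
  obtain ⟨s, rfl⟩ := exists_arcLength_eq hγ hx
  obtain ⟨t, rfl⟩ := exists_arcLength_eq hγ hy
  rw [arcParam_arcLength hγ, arcParam_arcLength hγ, ENNReal.coe_one, one_mul]
  rcases le_total s t with h | h
  · exact key s t h
  · rw [edist_comm, edist_comm (arcLength γ s)]
    exact key t s h

theorem arcParam_zero : arcParam γ 0 = γ 0 := by
  rw [← arcParam_arcLength hγ 0, arcLength_zero]

theorem arcParam_length : arcParam γ (pathLength γ).toReal = γ 1 := by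
  rw [← arcParam_arcLength hγ 1, arcLength_one]

end ArcLength

theorem eVariationOn_le_lintegral {Y : Type*} [MetricSpace Y] {c : ℝ → Y} {w : ℝ → ℝ≥0∞}
    {a b : ℝ} (h : ∀ s t, a ≤ s → s ≤ t → t ≤ b → edist (c s) (c t) ≤ ∫⁻ u in Icc s t, w u) :
    eVariationOn c (Icc a b) ≤ ∫⁻ u in Icc a b, w u := by
  refine iSup_le fun p => ?_
  obtain ⟨n, u, hu, hmem⟩ := p
  dsimp only
  have key : ∀ m, ∑ i ∈ Finset.range m, edist (c (u (i + 1))) (c (u i)) ≤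
      ∫⁻ s in Icc (u 0) (u m), w s := by
    intro m
    induction m with
    | zero => simp
    | succ m ih =>
      rw [Finset.sum_range_succ, ← lintegral_Icc_add_lintegral_Icc w (hu (Nat.zero_le m))
        (hu (Nat.le_succ m))]
      refine add_le_add ih ?_
      rw [edist_comm]
      exact h _ _ (hmem m).1 (hu (Nat.le_succ m)) (hmem (m + 1)).2
  exact (key n).trans (lintegral_mono_set (Icc_subset_Icc (hmem 0).1 (hmem n).2))

/-- If `w` controls the oscillation of `h` along the arc length parametrization of `γ`, then it
controls the length element of `h ∘ γ`. -/
theorem lineIntegral_comp_le {Z Y : Type*} [MetricSpace Z] [MetricSpace Y] {h : Z → Y}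
    {γ : C(I, Z)} {η : C(I, Y)} (hη : ∀ t, η t = h (γ t)) (hγ : pathLength γ ≠ ∞)
    {w : ℝ → ℝ≥0∞} (hw : Measurable w)
    (hwf : ∫⁻ s in Icc 0 (pathLength γ).toReal, w s ≠ ∞)
    (hle : ∀ s t, 0 ≤ s → s ≤ t → t ≤ (pathLength γ).toReal →
      edist (h (arcParam γ s)) (h (arcParam γ t)) ≤ ∫⁻ u in Icc s t, w u) :
    pathLength η ≠ ∞ ∧ ∀ ρ : Y → ℝ≥0∞, lineIntegral ρ η ≤
      ∫⁻ s in Icc 0 (pathLength γ).toReal, w s * ρ (h (arcParam γ s)) := by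
  set ℓ := (pathLength γ).toReal with hℓ
  have hℓ0 : 0 ≤ ℓ := ENNReal.toReal_nonneg
  have hvar : ∀ s t : I, s ≤ t → eVariationOn η (Icc s t) ≤
      ∫⁻ u in Icc (arcLength γ s) (arcLength γ t), w u := by
    intro s t hst
    have e : EqOn η ((h ∘ arcParam γ) ∘ arcLength γ) (Icc s t) := fun r _ => by
      simp [hη, arcParam_arcLength hγ]
    rw [eVariationOn.congr e]
    refine (eVariationOn.comp_le_of_monotoneOn (t := Icc s t)
      (s := Icc (arcLength γ s) (arcLength γ t)) _ _
      ((monotone_arcLength hγ).monotoneOn _) ?_).trans ?_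
    · exact fun r hr => ⟨monotone_arcLength hγ hr.1, monotone_arcLength hγ hr.2⟩
    · exact eVariationOn_le_lintegral fun a b ha hab hb =>
        hle a b ((arcLength_mem hγ s).1.trans ha) hab (hb.trans (arcLength_mem hγ t).2)
  have hηf : pathLength η ≠ ∞ := by
    have h01 := hvar 0 1 zero_le_one
    rw [arcLength_zero, arcLength_one] at h01
    rw [Icc_zero_one_eq_univ] at h01
    exact ne_top_of_le_ne_top hwf h01
  refine ⟨hηf, fun ρ => ?_⟩
  set ℓ' := (pathLength η).toReal with hℓ'
  have hℓ'0 : 0 ≤ ℓ' := ENNReal.toReal_nonneg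
  -- A right inverse of the arc length of `γ`, clamped so that it is defined on the whole line. It
  -- need not be monotone where `γ` rests. The function `k` below then converts arc length of `γ`
  -- into arc length of `η`.
  have hτ : ∀ s : ℝ, ∃ t : I, arcLength γ t = max 0 (min s ℓ) := fun s =>
    exists_arcLength_eq hγ ⟨le_max_left _ _, max_le hℓ0 (min_le_right _ _)⟩
  choose τ hτ using hτ
  have hclamp : ∀ s ∈ Icc 0 ℓ, max 0 (min s ℓ) = s := fun s hs => by
    rw [min_eq_left hs.2, max_eq_right hs.1]
  have hτm : ∀ s s', s ≤ s' → arcLength γ (τ s) ≤ arcLength γ (τ s') := fun s s' hss => by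
    rw [hτ, hτ]
    exact max_le_max le_rfl (min_le_min hss le_rfl)
  set k : ℝ → ℝ := fun s => arcLength η (τ s) with hk
  have hkdiff : ∀ s s', s ≤ s' → k s ≤ k s' ∧ ENNReal.ofReal (k s' - k s) ≤
      ∫⁻ u in Icc (arcLength γ (τ s)) (arcLength γ (τ s')), w u := by
    intro s s' hss
    rcases le_total (τ s) (τ s') with hle | hle
    · refine ⟨monotone_arcLength hηf hle, ?_⟩
      rw [hk, ofReal_arcLength_sub hηf hle]
      exact hvar _ _ hle
    -- The order is reversed only while `γ` stands still; then `η` stands still too, and `k` does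
    -- not change.
    · have heq : arcLength γ (τ s) = arcLength γ (τ s') :=
        le_antisymm (hτm s s' hss) (monotone_arcLength hγ hle)
      have h0 := hvar _ _ hle
      rw [heq, Icc_self, Measure.restrict_singleton, Real.volume_singleton, zero_smul,
        lintegral_zero_measure, ← ofReal_arcLength_sub hηf hle, nonpos_iff_eq_zero,
        ENNReal.ofReal_eq_zero] at h0
      have h1 := monotone_arcLength hηf hle
      have h2 : k s = k s' := by
        change arcLength η (τ s) = arcLength η (τ s')
        linarith
      rw [h2]
      simp
  have hkmono : Monotone k := fun s s' hss => (hkdiff s s' hss).1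
  have hkη : ∀ s ∈ Icc 0 ℓ, arcParam η (k s) = h (arcParam γ s) := fun s hs => by
    rw [hk, arcParam_arcLength hηf, hη, ← arcParam_arcLength hγ, hτ, hclamp s hs]
  have hkend : ∀ t : I, ∀ s ∈ Icc 0 ℓ, arcLength γ t = s → k s = arcLength η t := by
    intro t s hs hts
    have heq : arcLength γ (τ s) = arcLength γ t := by rw [hτ, hclamp s hs, hts]
    have aux : ∀ a b : I, a ≤ b → arcLength γ a = arcLength γ b →
        arcLength η a = arcLength η b := by
      intro a b hab hab'
      have h0 := hvar _ _ hab
      rw [hab', Icc_self, Measure.restrict_singleton, Real.volume_singleton, zero_smul,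
        lintegral_zero_measure, ← ofReal_arcLength_sub hηf hab, nonpos_iff_eq_zero,
        ENNReal.ofReal_eq_zero] at h0
      have h1 := monotone_arcLength hηf hab
      linarith
    rcases le_total (τ s) t with h1 | h1
    · exact aux _ _ h1 heq
    · exact (aux _ _ h1 heq.symm).symm
  set m : Measure ℝ := (volume.restrict (Icc 0 ℓ)).withDensity w with hm
  have hmfin : IsFiniteMeasure m := isFiniteMeasure_withDensity hwf
  have hksurj : ∀ u ∈ Icc 0 ℓ', ∃ s ∈ Icc 0 ℓ, k s = u := by
    intro u hu
    obtain ⟨t, ht⟩ := exists_arcLength_eq hηf hu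
    exact ⟨arcLength γ t, arcLength_mem hγ t, by rw [hkend t _ (arcLength_mem hγ t) rfl, ht]⟩
  -- The length element of `η` is dominated by the image under `k` of `w` times the length element
  -- of `γ`; half-open intervals suffice to test this.
  have hmap : volume.restrict (Icc 0 ℓ') ≤ m.map k := by
    refine measure_le_of_Ioc_le fun a b hab => ?_
    rw [Measure.map_apply hkmono.measurable measurableSet_Ioc,
      Measure.restrict_apply measurableSet_Ioc]
    set a' := max a 0 with ha'
    set b' := min b ℓ' with hb'
    rcases le_or_gt b' a' with hba | hba
    · have : volume (Ioc a b ∩ Icc 0 ℓ') ≤ volume (Icc a' b') :=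
        measure_mono fun x hx => ⟨max_le hx.1.1.le hx.2.1, le_min hx.1.2 hx.2.2⟩
      rw [Real.volume_Icc, ENNReal.ofReal_of_nonpos (by linarith)] at this
      exact this.trans bot_le
    obtain ⟨s, hs, hks⟩ := hksurj a' ⟨le_max_right _ _, hba.le.trans (min_le_right _ _)⟩
    obtain ⟨t, ht, hkt⟩ := hksurj b' ⟨(le_max_right _ _).trans hba.le, min_le_right _ _⟩
    have hst : s ≤ t := by
      by_contra! hlt
      have := hkmono hlt.le
      rw [hks, hkt] at this
      exact absurd hba (not_lt.2 this)
    -- the last parameter at which `k ≤ a'`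
    set S := {r ∈ Icc 0 ℓ | k r ≤ a'} with hS
    have hsS : s ∈ S := ⟨hs, hks.le⟩
    have hbdd : BddAbove S := ⟨ℓ, fun r hr => hr.1.2⟩
    set q := sSup S
    have hq : q ∈ Icc 0 ℓ := ⟨hs.1.trans (le_csSup hbdd hsS), csSup_le ⟨s, hsS⟩ fun r hr => hr.1.2⟩
    have hqt : q ≤ t := by
      refine csSup_le ⟨s, hsS⟩ fun r hr => ?_
      by_contra! hlt
      have := hkmono hlt.le
      rw [hkt] at this
      exact absurd hba (not_lt.2 (this.trans hr.2))
    have hsub : Ioc q t ⊆ k ⁻¹' Ioc a b := by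
      intro r hr
      refine ⟨?_, (hkmono hr.2).trans (hkt.le.trans (min_le_left _ _))⟩
      by_contra! hle
      have : r ∈ S := ⟨⟨hq.1.trans hr.1.le, hr.2.trans ht.2⟩, hle.trans (le_max_left _ _)⟩
      exact absurd (le_csSup hbdd this) (not_le.2 hr.1)
    have hmI : ∀ x ∈ Icc 0 ℓ, ∀ y ∈ Icc 0 ℓ, m (Ioc x y) = ∫⁻ u in Icc x y, w u := by
      intro x hx y hy
      rw [hm, withDensity_apply _ measurableSet_Ioc, Measure.restrict_restrict measurableSet_Ioc,
        inter_eq_left.2 (show Ioc x y ⊆ Icc 0 ℓ from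
          fun z hz => ⟨hx.1.trans hz.1.le, hz.2.trans hy.2⟩)]
      exact setLIntegral_congr Ioc_ae_eq_Icc
    have hkint : ∀ x ∈ Icc 0 ℓ, ∀ y ∈ Icc 0 ℓ, x ≤ y → ENNReal.ofReal (k y - k x) ≤
        m (Ioc x y) := by
      intro x hx y hy hxy
      rw [hmI x hx y hy]
      have := (hkdiff x y hxy).2
      rwa [hτ, hτ, hclamp x hx, hclamp y hy] at this
    -- by continuity, `k q = a'`
    have hkq : k q ≤ a' := by
      refine le_of_forall_pos_le_add fun ε hε => ?_
      have hlim : Tendsto (fun r => m (Ioc r q)) (𝓝[<] q) (𝓝 0) := by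
        have h1 := tendsto_measure_biInter_gt (μ := m) (ι := ℝᵒᵈ)
          (s := fun r => Ioc (OrderDual.ofDual r) q)
          (a := OrderDual.toDual q) (fun r _ => measurableSet_Ioc.nullMeasurableSet)
          (fun i j _ hij => Ioc_subset_Ioc_left hij)
          ⟨OrderDual.toDual (q - 1), OrderDual.toDual_lt_toDual.2 (by linarith),
            measure_ne_top _ _⟩
        have h2 : ⋂ r, ⋂ (_ : r > OrderDual.toDual q), Ioc (OrderDual.ofDual r) q = {q} := by
          ext y
          simp only [mem_iInter, mem_singleton_iff]
          constructor
          · intro hy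
            have h3 : ∀ r < q, r < y ∧ y ≤ q := fun r hr => hy (OrderDual.toDual r) hr
            exact le_antisymm (h3 (q - 1) (by linarith)).2
              (le_of_forall_lt_imp_le_of_dense fun r hr => (h3 r hr).1.le)
          · rintro rfl r hr
            exact ⟨hr, le_rfl⟩
        rw [h2] at h1
        have h3 : m {q} = 0 :=
          withDensity_absolutelyContinuous _ _ (by simp)
        rw [h3] at h1
        exact h1
      have hev := hlim.eventually (gt_mem_nhds (ENNReal.ofReal_pos.2 hε))
      obtain ⟨δ, hδ, hball⟩ := Metric.mem_nhdsWithin_iff.1 hev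
      obtain ⟨r, hr, hr2⟩ := exists_lt_of_lt_csSup ⟨s, hsS⟩ (show q - δ < sSup S by
        change q - δ < q; linarith)
      rcases (le_csSup hbdd hr).eq_or_lt with h | h
      · change r = q at h
        rw [← h]; linarith [hr.2]
      change r < q at h
      have h1 : m (Ioc r q) < ENNReal.ofReal ε := hball
        ⟨by rw [Metric.mem_ball, Real.dist_eq, abs_lt]; constructor <;> linarith, h⟩
      have h2 := (hkint r hr.1 q hq h.le).trans_lt h1
      rw [ENNReal.ofReal_lt_ofReal_iff hε] at h2
      linarith [hr.2]
    calc volume (Ioc a b ∩ Icc 0 ℓ') ≤ volume (Icc a' b') :=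
          measure_mono fun x hx => ⟨max_le hx.1.1.le hx.2.1, le_min hx.1.2 hx.2.2⟩
      _ = ENNReal.ofReal (b' - a') := Real.volume_Icc
      _ ≤ ENNReal.ofReal (k t - k q) := ENNReal.ofReal_le_ofReal (by linarith)
      _ ≤ m (Ioc q t) := hkint q hq t ht hqt
      _ ≤ m (k ⁻¹' Ioc a b) := measure_mono hsub
  calc lineIntegral ρ η = ∫⁻ u in Icc 0 ℓ', ρ (arcParam η u) := rfl
    _ ≤ ∫⁻ u, ρ (arcParam η u) ∂(m.map k) := lintegral_mono' hmap le_rfl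
    _ ≤ ∫⁻ s, ρ (arcParam η (k s)) ∂m := lintegral_map_le _ _
    _ ≤ ∫⁻ s in Icc 0 ℓ, (w * fun s => ρ (arcParam η (k s))) s :=
        lintegral_withDensity_le_lintegral_mul _ hw _
    _ = _ := setLIntegral_congr_fun measurableSet_Icc fun s hs => by
        simp only [Pi.mul_apply, hkη s hs]




/-! ### Limits of convex combinations -/

/-- In a Hilbert space, the closed convex hulls of the tails of a bounded sequence have a common
point. -/
theorem exists_mem_closure_convexHull_tail {E : Type*} [NormedAddCommGroup E]
    [InnerProductSpace ℝ E] [CompleteSpace E] (u : ℕ → E) {M : ℝ} (hu : ∀ n, ‖u n‖ ≤ M) :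
    ∃ v, ∀ k, v ∈ closure (convexHull ℝ (u '' Ici k)) := by
  set C : ℕ → Set E := fun k => closure (convexHull ℝ (u '' Ici k)) with hC
  have hCc : ∀ k, Convex ℝ (C k) := fun k => (convex_convexHull ℝ _).closure
  have huC : ∀ k, u k ∈ C k := fun k =>
    subset_closure (subset_convexHull ℝ _ ⟨k, self_mem_Ici, rfl⟩)
  have hanti : ∀ j k, k ≤ j → C j ⊆ C k := fun j k hkj =>
    closure_mono (convexHull_mono (image_mono (Ici_subset_Ici.2 hkj)))
  have hex : ∀ k, ∃ x ∈ C k, ∀ y ∈ C k, ‖x‖ ≤ ‖y‖ := by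
    intro k
    obtain ⟨x, hx, hmin⟩ := exists_norm_eq_iInf_of_complete_convex ⟨u k, huC k⟩
      isClosed_closure.isComplete (hCc k) 0
    refine ⟨x, hx, fun y hy => ?_⟩
    simp only [zero_sub, norm_neg] at hmin
    rw [hmin]
    exact ciInf_le ⟨0, by rintro _ ⟨z, rfl⟩; exact norm_nonneg _⟩ (⟨y, hy⟩ : C k)
  choose x hx hmin using hex
  have hmono : Monotone fun k => ‖x k‖ := fun k j hkj => hmin k _ (hanti j k hkj (hx j))
  have hbdd : BddAbove (range fun k => ‖x k‖) :=
    ⟨M, by rintro _ ⟨k, rfl⟩; exact (hmin k _ (huC k)).trans (hu k)⟩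
  have hlim := tendsto_atTop_ciSup hmono hbdd
  set s := ⨆ k, ‖x k‖ with hs
  have hle : ∀ k, ‖x k‖ ≤ s := fun k => le_ciSup hbdd k
  -- The midpoint of `x n` and `x m` lies in `C k`, so its norm is at least that of `x k`. The
  -- parallelogram law then bounds the distance, and the points of least norm form a Cauchy
  -- sequence.
  have hdist : ∀ n m k, k ≤ n → k ≤ m → dist (x n) (x m) ≤ √(4 * (s ^ 2 - ‖x k‖ ^ 2)) := by
    intro n m k hn hm
    have hmid : (1 / 2 : ℝ) • x n + (1 / 2 : ℝ) • x m ∈ C k :=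
      hCc k (hanti n k hn (hx n)) (hanti m k hm (hx m)) (by norm_num) (by norm_num) (by norm_num)
    have h1 := hmin k _ hmid
    rw [← smul_add, norm_smul, Real.norm_of_nonneg (by norm_num)] at h1
    have h2 := parallelogram_law_with_norm ℝ (x n) (x m)
    have h3 := hle n
    have h4 := hle m
    have := norm_nonneg (x k)
    have := norm_nonneg (x n)
    have := norm_nonneg (x m)
    rw [dist_eq_norm]
    apply Real.le_sqrt_of_sq_le
    nlinarith [norm_nonneg (x n + x m)]
  have hcau : CauchySeq x := by
    refine cauchySeq_of_le_tendsto_0 (fun k => √(4 * (s ^ 2 - ‖x k‖ ^ 2))) hdist ?_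
    have : Tendsto (fun k => √(4 * (s ^ 2 - ‖x k‖ ^ 2))) atTop (𝓝 (√(4 * (s ^ 2 - s ^ 2)))) :=
      (tendsto_const_nhds.mul (tendsto_const_nhds.sub (hlim.pow 2))).sqrt
    simpa using this
  obtain ⟨v, hv⟩ := cauchySeq_tendsto_of_complete hcau
  exact ⟨v, fun k => isClosed_closure.mem_of_tendsto hv
    (eventually_atTop.2 ⟨k, fun j hj => hanti j k hj (hx j)⟩)⟩

theorem eLpNorm_two_sq {α : Type*} [MeasurableSpace α] (f : α → ℝ) (μ : Measure α) :
    eLpNorm f 2 μ ^ 2 = ∫⁻ x, ‖f x‖ₑ ^ 2 ∂μ := by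
  have := eLpNorm_nnreal_pow_eq_lintegral (f := f) (μ := μ) (p := 2) (by norm_num)
  simpa using this

/-- A bounded sequence in `L²` has rapidly convergent forward convex combinations. -/
theorem exists_convexHull_lintegral_sub_le {α : Type*} [MeasurableSpace α] {μ : Measure α}
    {u : ℕ → α → ℝ} (hu : ∀ n, Measurable (u n)) {M : ℝ≥0∞} (hM : M ≠ ∞)
    (huM : ∀ n, ∫⁻ x, ‖u n x‖ₑ ^ 2 ∂μ ≤ M) {ε : ℕ → ℝ≥0∞} (hε : ∀ k, 0 < ε k) :
    ∃ v : α → ℝ, Measurable v ∧ ∫⁻ x, ‖v x‖ₑ ^ 2 ∂μ < ∞ ∧ ∃ G : ℕ → α → ℝ,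
      ∀ k, G k ∈ convexHull ℝ (u '' Ici k) ∧ Measurable (G k) ∧
        ∫⁻ x, ‖G k x - v x‖ₑ ^ 2 ∂μ ≤ ε k := by
  have hlt : ∀ n, eLpNorm (u n) 2 μ ^ 2 ≤ M := fun n => by rw [eLpNorm_two_sq]; exact huM n
  have hfin : ∀ n, eLpNorm (u n) 2 μ < ∞ := fun n => by
    rw [lt_top_iff_ne_top]
    intro h
    have := hlt n
    rw [h] at this
    exact hM (top_le_iff.1 (by simpa using this))
  have hmem : ∀ n, MemLp (u n) 2 μ := fun n => ⟨(hu n).aestronglyMeasurable, hfin n⟩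
  set U : ℕ → Lp ℝ 2 μ := fun n => (hmem n).toLp
  have hUM : ∀ n, ‖U n‖ ≤ √M.toReal := by
    intro n
    apply Real.le_sqrt_of_sq_le
    rw [Lp.norm_toLp, ← ENNReal.toReal_pow]
    exact ENNReal.toReal_mono hM (hlt n)
  obtain ⟨V, hV⟩ := exists_mem_closure_convexHull_tail U hUM
  -- Convex combinations of classes are represented by the same combinations of functions. Genuine
  -- functions are needed because inequalities along single curves are not visible almost
  -- everywhere.
  have hrep : ∀ k, convexHull ℝ (U '' Ici k) ⊆
      {w | ∃ G ∈ convexHull ℝ (u '' Ici k), Measurable G ∧ (w : α → ℝ) =ᵐ[μ] G} := by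
    intro k
    refine convexHull_min ?_ ?_
    · rintro _ ⟨n, hn, rfl⟩
      exact ⟨u n, subset_convexHull ℝ _ ⟨n, hn, rfl⟩, hu n, (hmem n).coeFn_toLp⟩
    · rintro w ⟨G, hG, hGm, hwG⟩ w' ⟨G', hG', hGm', hwG'⟩ a b ha hb hab
      refine ⟨a • G + b • G', convex_convexHull ℝ _ hG hG' ha hb hab,
        (hGm.const_smul a).add (hGm'.const_smul b), ?_⟩
      filter_upwards [Lp.coeFn_add (a • w) (b • w'), Lp.coeFn_smul a w, Lp.coeFn_smul b w', hwG,
        hwG'] with x h1 h2 h3 h4 h5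
      rw [h1, Pi.add_apply, h2, h3]
      simp [h4, h5]
  have hVsm := (Lp.stronglyMeasurable V).measurable
  refine ⟨V, hVsm, ?_, ?_⟩
  · rw [← eLpNorm_two_sq]
    exact ENNReal.pow_lt_top (Lp.eLpNorm_lt_top V)
  have hsq : ∀ k, ∃ η : ℝ, 0 < η ∧ ENNReal.ofReal η ^ 2 ≤ ε k := by
    intro k
    have hcont : Tendsto (fun η : ℝ => ENNReal.ofReal η ^ 2) (𝓝[>] 0) (𝓝 0) := by
      have : Tendsto (fun η : ℝ => ENNReal.ofReal η ^ 2) (𝓝 0) (𝓝 (ENNReal.ofReal 0 ^ 2)) :=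
        ((ENNReal.continuous_pow 2).comp ENNReal.continuous_ofReal).tendsto 0
      simp only [ENNReal.ofReal_zero, ne_eq, OfNat.ofNat_ne_zero, not_false_eq_true, zero_pow]
        at this
      exact this.mono_left nhdsWithin_le_nhds
    obtain ⟨η, h1, h2⟩ := ((hcont.eventually (gt_mem_nhds (hε k))).and
      self_mem_nhdsWithin).exists
    exact ⟨η, h2, h1.le⟩
  choose η hη hηε using hsq
  have hG : ∀ k, ∃ G : α → ℝ, G ∈ convexHull ℝ (u '' Ici k) ∧ Measurable G ∧
        ∫⁻ x, ‖G x - V x‖ₑ ^ 2 ∂μ ≤ ε k := by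
    intro k
    obtain ⟨w, hw, hd⟩ := Metric.mem_closure_iff.1 (hV k) (η k) (hη k)
    obtain ⟨G, hG, hGm, hwG⟩ := hrep k hw
    refine ⟨G, hG, hGm, le_trans ?_ (hηε k)⟩
    have h1 : edist w V ≤ ENNReal.ofReal (η k) := by
      rw [edist_comm, edist_dist]
      exact ENNReal.ofReal_le_ofReal hd.le
    rw [Lp.edist_def] at h1
    have h2 : ∫⁻ x, ‖G x - V x‖ₑ ^ 2 ∂μ = eLpNorm ((w : α → ℝ) - (V : α → ℝ)) 2 μ ^ 2 := by
      rw [eLpNorm_two_sq]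
      refine lintegral_congr_ae ?_
      filter_upwards [hwG] with x hx
      simp [hx]
    rw [h2]
    gcongr
  choose G hG using hG
  exact ⟨G, hG⟩

/-- For nonnegative functions the absolute value is additive, and the lower integral is
superadditive; no measurability along `c` is required. -/
theorem le_lintegral_of_mem_convexHull {α β : Type*} [MeasurableSpace β] {μ : Measure β}
    {s : Set (α → ℝ)} {c : β → α} {m : ℝ≥0∞} (hs : ∀ f ∈ s, 0 ≤ f)
    (hm : ∀ f ∈ s, m ≤ ∫⁻ t, ‖f (c t)‖ₑ ∂μ) :
    ∀ f ∈ convexHull ℝ s, m ≤ ∫⁻ t, ‖f (c t)‖ₑ ∂μ := by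
  have key : convexHull ℝ s ⊆ {f | 0 ≤ f ∧ m ≤ ∫⁻ t, ‖f (c t)‖ₑ ∂μ} := by
    refine convexHull_min (fun f hf => ⟨hs f hf, hm f hf⟩) ?_
    rintro f ⟨hf0, hf⟩ f' ⟨hf0', hf'⟩ a b ha hb hab
    refine ⟨add_nonneg (smul_nonneg ha hf0) (smul_nonneg hb hf0'), ?_⟩
    have hpt : ∀ t, ‖(a • f + b • f') (c t)‖ₑ =
        ENNReal.ofReal a * ‖f (c t)‖ₑ + ENNReal.ofReal b * ‖f' (c t)‖ₑ := by
      intro t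
      have h1 := hf0 (c t)
      have h2 := hf0' (c t)
      simp only [Pi.zero_apply] at h1 h2
      rw [Pi.add_apply, Pi.smul_apply, Pi.smul_apply, smul_eq_mul, smul_eq_mul,
        Real.enorm_of_nonneg (by positivity), Real.enorm_of_nonneg h1, Real.enorm_of_nonneg h2,
        ENNReal.ofReal_add (by positivity) (by positivity), ENNReal.ofReal_mul ha,
        ENNReal.ofReal_mul hb]
    simp only [hpt]
    calc m = ENNReal.ofReal a * m + ENNReal.ofReal b * m := by
          rw [← add_mul, ← ENNReal.ofReal_add ha hb, hab, ENNReal.ofReal_one, one_mul]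
      _ ≤ ENNReal.ofReal a * (∫⁻ t, ‖f (c t)‖ₑ ∂μ) +
          ENNReal.ofReal b * ∫⁻ t, ‖f' (c t)‖ₑ ∂μ := by gcongr
      _ ≤ _ := (add_le_add (lintegral_const_mul_le _ _) (lintegral_const_mul_le _ _)).trans
          (le_lintegral_add _ _)
  exact fun f hf => (key hf).2

theorem eLpNorm_le_of_mem_convexHull {α : Type*} [MeasurableSpace α] {μ : Measure α}
    {s : Set (α → ℝ)} {m : ℝ≥0∞} (hs : ∀ f ∈ s, Measurable f)
    (hm : ∀ f ∈ s, eLpNorm f 2 μ ≤ m) : ∀ f ∈ convexHull ℝ s, eLpNorm f 2 μ ≤ m := by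
  have key : convexHull ℝ s ⊆ {f | Measurable f ∧ eLpNorm f 2 μ ≤ m} := by
    refine convexHull_min (fun f hf => ⟨hs f hf, hm f hf⟩) ?_
    rintro f ⟨hf0, hf⟩ f' ⟨hf0', hf'⟩ a b ha hb hab
    refine ⟨(hf0.const_smul a).add (hf0'.const_smul b), ?_⟩
    refine (eLpNorm_add_le (hf0.const_smul a).aestronglyMeasurable
      (hf0'.const_smul b).aestronglyMeasurable (by norm_num)).trans ?_
    rw [eLpNorm_const_smul, eLpNorm_const_smul, Real.enorm_of_nonneg ha, Real.enorm_of_nonneg hb]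
    calc _ ≤ ENNReal.ofReal a * m + ENNReal.ofReal b * m := by gcongr
      _ = m := by rw [← add_mul, ← ENNReal.ofReal_add ha hb, hab, ENNReal.ofReal_one, one_mul]
  exact fun f hf => (key hf).2

/-! ### The limit of conformal maps to approximating spaces -/

theorem IsEpsIsometry.edist_le {A B : Type*} [MetricSpace A] [MetricSpace B] {ε : ℝ} {f : A → B}
    (hf : IsEpsIsometry ε f) (x y : A) : dist (f x) (f y) ≤ dist x y + ε := by
  linarith [(abs_lt.1 (hf.2 x y)).1]

theorem IsEpsIsometry.edist_ge {A B : Type*} [MetricSpace A] [MetricSpace B] {ε : ℝ} {f : A → B}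
    (hf : IsEpsIsometry ε f) (x y : A) : dist x y ≤ dist (f x) (f y) + ε := by
  linarith [(abs_lt.1 (hf.2 x y)).2]

section Limit

variable {A X : Type*} [MetricSpace A] [MeasurableSpace A] [BorelSpace A]
  [MetricSpace X] [MeasurableSpace X] [BorelSpace X]
  {Y : ℕ → Type*} [∀ n, MetricSpace (Y n)] [∀ n, MeasurableSpace (Y n)] [∀ n, BorelSpace (Y n)]
  {f : ∀ n, Y n → X} {h : ∀ n, A ≃ₜ Y n} {g : ℕ → A → ℝ≥0} {P : ℕ → Finset A} {H : A → X}

omit [MeasurableSpace A] [BorelSpace A] [MeasurableSpace X] [BorelSpace X]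
  [∀ n, MeasurableSpace (Y n)] [∀ n, BorelSpace (Y n)] in
theorem tendsto_dist_of_tendsto (hf : IsApproxIsometricSeq f)
    (hlim : ∀ x, Tendsto (fun n => f n (h n x)) atTop (𝓝 (H x))) (x y : A) :
    Tendsto (fun n => dist (h n x) (h n y)) atTop (𝓝 (dist (H x) (H y))) := by
  obtain ⟨ε, -, hε, hfε⟩ := hf
  have h1 : Tendsto (fun n => dist (f n (h n x)) (f n (h n y))) atTop (𝓝 (dist (H x) (H y))) :=
    (hlim x).dist (hlim y)
  have h2 := h1.sub hε
  have h3 := h1.add hε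
  rw [sub_zero] at h2
  rw [add_zero] at h3
  refine tendsto_of_tendsto_of_tendsto_of_le_of_le h2 h3 (fun n => ?_) (fun n => ?_)
  · have := (hfε n).edist_le (h n x) (h n y)
    simp only
    linarith
  · exact (hfε n).edist_ge (h n x) (h n y)

variable [∀ x : A, (𝓝[≠] x).NeBot]

omit [MeasurableSpace X] [BorelSpace X] [∀ n, MeasurableSpace (Y n)]
  [∀ n, BorelSpace (Y n)] in
/-- The upper gradient inequality in the limit. -/
theorem edist_le_lintegral_of_limit (hf : IsApproxIsometricSeq f)
    (hlim : ∀ x, Tendsto (fun n => f n (h n x)) atTop (𝓝 (H x)))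
    (hconf : ∀ n, IsMetricConformal (h n) (g n) (P n))
    {v : A → ℝ} (hv : Measurable v) {G : ℕ → A → ℝ}
    (hG : ∀ k, G k ∈ convexHull ℝ ((fun n x => (g n x : ℝ)) '' Ici k)) {ρ : A → ℝ≥0∞}
    (hρ : ∀ k x, 2 ^ k * ‖G k x - v x‖ₑ ≤ ρ x) {c : ℝ → A} {s t : ℝ} (hst : s ≤ t)
    (hc : LipschitzOnWith 1 c (Icc s t)) (hfin : ∫⁻ r in Icc s t, ρ (c r) ≠ ∞) :
    edist (H (c s)) (H (c t)) ≤ ∫⁻ r in Icc s t, ‖v (c r)‖ₑ := by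
  refine le_of_forall_lt fun m hm => ?_
  obtain ⟨m', hmm', hm'⟩ := exists_between hm
  refine hmm'.trans_le ?_
  have h1 : Tendsto (fun n => edist (h n (c s)) (h n (c t))) atTop
      (𝓝 (edist (H (c s)) (H (c t)))) := by
    simp only [edist_dist]
    exact (ENNReal.continuous_ofReal.tendsto _).comp (tendsto_dist_of_tendsto hf hlim _ _)
  obtain ⟨k₀, hk₀⟩ := eventually_atTop.1 (h1.eventually (lt_mem_nhds hm'))
  have hpos : ∀ k, ∀ w ∈ (fun n x => (g n x : ℝ)) '' Ici k, (0 : A → ℝ) ≤ w := by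
    rintro k _ ⟨n, -, rfl⟩ x
    exact (g n x).2
  have h2 : ∀ k ≥ k₀, m' ≤ ∫⁻ r in Icc s t, ‖G k (c r)‖ₑ := by
    intro k hk
    refine le_lintegral_of_mem_convexHull (hpos k) ?_ _ (hG k)
    rintro _ ⟨n, hn, rfl⟩
    refine (hk₀ n (le_trans hk hn)).le.trans ?_
    have := (hconf n).edist_le_lintegral hst hc
    simpa using this
  have hvc : AEMeasurable (fun r => ‖v (c r)‖ₑ) (volume.restrict (Icc s t)) :=
    (hv.comp_aemeasurable (hc.continuousOn.aemeasurable measurableSet_Icc)).enorm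
  -- Fuglede's argument: along the curve `G k` differs from `v` by at most `2 ^ (-k)` times `ρ`, and
  -- the integral of `ρ` is finite.
  have h3 : ∀ k ≥ k₀, m' ≤ (∫⁻ r in Icc s t, ‖v (c r)‖ₑ) +
      (1 / 2) ^ k * ∫⁻ r in Icc s t, ρ (c r) := by
    intro k hk
    refine (h2 k hk).trans ?_
    have hpow : ((1 / 2 : ℝ≥0∞)) ^ k ≠ ∞ := ENNReal.pow_ne_top (by simp)
    rw [← lintegral_const_mul' _ _ hpow, ← lintegral_add_left' hvc]
    refine lintegral_mono fun r => ?_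
    have e1 : ‖G k (c r)‖ₑ ≤ ‖v (c r)‖ₑ + ‖G k (c r) - v (c r)‖ₑ := by
      have := enorm_add_le (v (c r)) (G k (c r) - v (c r))
      simpa using this
    refine e1.trans (add_le_add_right ?_ _)
    calc ‖G k (c r) - v (c r)‖ₑ = (1 / 2) ^ k * (2 ^ k * ‖G k (c r) - v (c r)‖ₑ) := by
          rw [← mul_assoc, ← mul_pow, one_div, ENNReal.inv_mul_cancel (by simp) (by simp), one_pow,
            one_mul]
      _ ≤ _ := by gcongr; exact hρ k (c r)
  have h4 : Tendsto (fun k : ℕ => (∫⁻ r in Icc s t, ‖v (c r)‖ₑ) +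
      (1 / 2) ^ k * ∫⁻ r in Icc s t, ρ (c r)) atTop
      (𝓝 ((∫⁻ r in Icc s t, ‖v (c r)‖ₑ) + 0 * ∫⁻ r in Icc s t, ρ (c r))) := by
    refine tendsto_const_nhds.add (ENNReal.Tendsto.mul_const ?_ (Or.inr hfin))
    exact ENNReal.tendsto_pow_atTop_nhds_zero_of_lt_one (by
      rw [one_div]; exact ENNReal.inv_lt_one.2 (by norm_num))
  rw [zero_mul, add_zero] at h4
  exact ge_of_tendsto h4 (eventually_atTop.2 ⟨k₀, h3⟩)

/-- The area inequality in the limit. -/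
theorem setLIntegral_sq_le_of_limit [SecondCountableTopology A] [CompactSpace X]
    (hX : hausdorffTwo X univ ≠ ∞) {K : ℝ}
    (hlim : TendstoUniformly (fun n x => f n (h n x)) H atTop) (hH : Continuous H)
    (hconf : ∀ n, IsMetricConformal (h n) (g n) (P n))
    (harea : ∀ s : Set X, IsCompact s →
      limsup (fun n => hausdorffTwo (Y n) (f n ⁻¹' s)) atTop ≤ ENNReal.ofReal K * hausdorffTwo X s)
    {v : A → ℝ} (hv : Measurable v) {G : ℕ → A → ℝ}
    (hG : ∀ k, G k ∈ convexHull ℝ ((fun n x => (g n x : ℝ)) '' Ici k))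
    (hGm : ∀ k, Measurable (G k))
    (hGv : Tendsto (fun k => ∫⁻ x, ‖G k x - v x‖ₑ ^ 2 ∂(hausdorffTwo A)) atTop (𝓝 0))
    {s : Set X} (hs : IsCompact s) :
    ∫⁻ x in H ⁻¹' s, ‖v x‖ₑ ^ 2 ∂(hausdorffTwo A) ≤ ENNReal.ofReal K * hausdorffTwo X s := by
  have hfinX : IsFiniteMeasure (hausdorffTwo X) := ⟨lt_top_iff_ne_top.2 hX⟩
  set μ := (hausdorffTwo A).restrict (H ⁻¹' s) with hμ
  have hB : MeasurableSet (H ⁻¹' s) := hH.measurable hs.isClosed.measurableSet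
  -- For large `n`, uniform convergence puts `h n '' (H ⁻¹' s)` into the preimage of the
  -- `δ`-thickening of `s`, whose area is controlled. The bound on the `L²` norm of `g n` passes to
  -- convex combinations and to their limit. Letting `δ` tend to zero uses compactness of `s` and
  -- finiteness of the area of `X`.
  have step : ∀ δ > 0, ∫⁻ x, ‖v x‖ₑ ^ 2 ∂μ ≤
      ENNReal.ofReal K * hausdorffTwo X (Metric.cthickening δ s) := by
    intro δ hδ
    refine le_of_forall_gt_imp_ge_of_dense fun m hm => ?_
    have h1 := eventually_lt_of_limsup_lt
      ((harea _ (hs.cthickening (r := δ))).trans_lt hm)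
    have h2 := Metric.tendstoUniformly_iff.1 hlim δ hδ
    obtain ⟨k₀, hk₀⟩ := eventually_atTop.1 (h1.and h2)
    have h3 : ∀ n ≥ k₀, eLpNorm (fun x => (g n x : ℝ)) 2 μ ≤ m ^ (1 / 2 : ℝ) := by
      intro n hn
      obtain ⟨ha, hb⟩ := hk₀ n hn
      rw [one_div, ENNReal.le_rpow_inv_iff (by norm_num)]
      have : eLpNorm (fun x => (g n x : ℝ)) 2 μ ^ (2 : ℝ) =
          eLpNorm (fun x => (g n x : ℝ)) 2 μ ^ 2 := by norm_cast
      rw [this, eLpNorm_two_sq]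
      simp only [Real.enorm_of_nonneg (NNReal.coe_nonneg _),
        ENNReal.ofReal_coe_nnreal]
      refine ((hconf n).setLIntegral_sq_le hB).trans (le_trans (measure_mono ?_) ha.le)
      rintro _ ⟨x, hx, rfl⟩
      refine Metric.mem_cthickening_of_dist_le _ (H x) _ _ hx ?_
      rw [dist_comm]
      exact (hb x).le
    have h4 : ∀ k ≥ k₀, eLpNorm (G k) 2 μ ≤ m ^ (1 / 2 : ℝ) := by
      intro k hk
      refine eLpNorm_le_of_mem_convexHull ?_ ?_ _ (hG k)
      · rintro _ ⟨n, -, rfl⟩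
        exact (hconf n).measurable.coe_nnreal_real
      · rintro _ ⟨n, hn, rfl⟩
        exact h3 n (le_trans hk hn)
    have h5 : Tendsto (fun k => eLpNorm (fun x => G k x - v x) 2 μ) atTop (𝓝 0) := by
      have h6 : ∀ k, eLpNorm (fun x => G k x - v x) 2 μ ≤
          (∫⁻ x, ‖G k x - v x‖ₑ ^ 2 ∂(hausdorffTwo A)) ^ (1 / 2 : ℝ) := by
        intro k
        rw [one_div, ENNReal.le_rpow_inv_iff (by norm_num)]
        have : eLpNorm (fun x => G k x - v x) 2 μ ^ (2 : ℝ) =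
          eLpNorm (fun x => G k x - v x) 2 μ ^ 2 := by norm_cast
        rw [this, eLpNorm_two_sq]
        exact lintegral_mono' Measure.restrict_le_self le_rfl
      have h7 := hGv.ennrpow_const (1 / 2 : ℝ)
      rw [ENNReal.zero_rpow_of_pos (by norm_num)] at h7
      exact tendsto_of_tendsto_of_tendsto_of_le_of_le tendsto_const_nhds h7 (fun _ => bot_le) h6
    have h8 : eLpNorm v 2 μ ≤ m ^ (1 / 2 : ℝ) := by
      have h9 : ∀ k ≥ k₀, eLpNorm v 2 μ ≤ m ^ (1 / 2 : ℝ) +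
          eLpNorm (fun x => G k x - v x) 2 μ := by
        intro k hk
        have e : v = G k - fun x => G k x - v x := by ext x; simp
        calc eLpNorm v 2 μ = eLpNorm (G k - fun x => G k x - v x) 2 μ := by rw [← e]
          _ ≤ eLpNorm (G k) 2 μ + eLpNorm (fun x => G k x - v x) 2 μ :=
            eLpNorm_sub_le (hGm k).aestronglyMeasurable
              ((hGm k).sub hv).aestronglyMeasurable (by norm_num)
          _ ≤ _ := by gcongr; exact h4 k hk
      have h10 := (tendsto_const_nhds (x := m ^ (1 / 2 : ℝ))).add h5
      rw [add_zero] at h10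
      exact ge_of_tendsto h10 (eventually_atTop.2 ⟨k₀, h9⟩)
    rw [one_div, ENNReal.le_rpow_inv_iff (by norm_num)] at h8
    rw [← eLpNorm_two_sq]
    exact_mod_cast h8
  have hlimδ := (tendsto_measure_cthickening_of_isCompact (μ := hausdorffTwo X) hs)
  have h11 : Tendsto (fun δ => ENNReal.ofReal K * hausdorffTwo X (Metric.cthickening δ s))
      (𝓝[>] 0) (𝓝 (ENNReal.ofReal K * hausdorffTwo X s)) :=
    ENNReal.Tendsto.const_mul (hlimδ.mono_left nhdsWithin_le_nhds) (Or.inr ENNReal.ofReal_ne_top)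
  exact ge_of_tendsto h11 (eventually_nhdsWithin_of_forall step)

end Limit

/-! ### From the area inequality to the modulus inequality. -/

/-- A finite measure that is dominated on compact sets is dominated. -/
theorem measure_le_of_isCompact_le {X : Type*} [MetricSpace X] [CompactSpace X]
    [MeasurableSpace X] [BorelSpace X] {μ ν : Measure X} [IsFiniteMeasure μ]
    (h : ∀ s, IsCompact s → μ s ≤ ν s) : μ ≤ ν := by
  refine Measure.le_iff.2 fun s hs => ?_
  rw [hs.measure_eq_iSup_isCompact_of_ne_top (measure_ne_top _ _)]
  exact iSup_le fun c => iSup_le fun hcs => iSup_le fun hc => (h c hc).trans (measure_mono hcs)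

/-- The conclusions on the modulus and on the Sobolev class, from an upper gradient `w` that
satisfies the area inequality. -/
theorem modulus_le_and_memSobolev {A X : Type*} [MetricSpace A] [MeasurableSpace A] [BorelSpace A]
    [CompactSpace A] [Nonempty A]
    [MetricSpace X] [CompactSpace X] [MeasurableSpace X] [BorelSpace X]
    (hA : hausdorffTwo A univ ≠ ∞) {K : ℝ} (hK : 0 < K) {H : A → X} (hH : Continuous H)
    {w ρ₀ : A → ℝ≥0∞}
    (hw : Measurable w) (hw2 : ∫⁻ x, w x ^ 2 ∂(hausdorffTwo A) < ∞)
    (hρ₀ : Measurable ρ₀) (hρ2 : ∫⁻ x, ρ₀ x ^ 2 ∂(hausdorffTwo A) < ∞)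
    (harea : ∀ s : Set X, IsCompact s →
      ∫⁻ x in H ⁻¹' s, w x ^ 2 ∂(hausdorffTwo A) ≤ ENNReal.ofReal K * hausdorffTwo X s)
    (hug : ∀ (c : ℝ → A) (s t : ℝ), s ≤ t → LipschitzOnWith 1 c (Icc s t) →
      ∫⁻ r in Icc s t, ρ₀ (c r) ≠ ∞ → edist (H (c s)) (H (c t)) ≤ ∫⁻ r in Icc s t, w (c r)) :
    (∀ Γ : Set C(I, A), modulus Γ ≤ ENNReal.ofReal K * modulus (imageFamily H Γ)) ∧
      MemSobolevN12 H := by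
  set μ := hausdorffTwo A with hμ
  have hAfin : IsFiniteMeasure μ := ⟨lt_top_iff_ne_top.2 hA⟩
  -- The area inequality for compact sets becomes a domination of measures by inner regularity;
  -- integrating `ρ ^ 2` against it gives the energy bound for `(ρ ∘ H) * w`.
  have hdom : (μ.withDensity fun x => w x ^ 2).map H ≤ ENNReal.ofReal K • hausdorffTwo X := by
    have : IsFiniteMeasure (μ.withDensity fun x => w x ^ 2) := isFiniteMeasure_withDensity hw2.ne
    refine measure_le_of_isCompact_le fun s hs => ?_
    have hm := hs.isClosed.measurableSet
    rw [Measure.map_apply hH.measurable hm, withDensity_apply _ (hH.measurable hm)]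
    exact harea s hs
  have hint : ∀ ρ : X → ℝ≥0∞, Measurable ρ → ∫⁻ x, (ρ (H x) * w x) ^ 2 ∂μ ≤
      ENNReal.ofReal K * ∫⁻ y, ρ y ^ 2 ∂(hausdorffTwo X) := by
    intro ρ hρ
    rw [← smul_eq_mul, ← lintegral_smul_measure]
    refine le_trans (le_of_eq ?_) (lintegral_mono' hdom le_rfl)
    have hm : Measurable fun x => ρ (H x) ^ 2 := (hρ.comp hH.measurable).pow_const 2
    rw [lintegral_map (hρ.pow_const 2) hH.measurable, lintegral_withDensity_eq_lintegral_mul _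
      (hw.pow_const 2) hm]
    refine lintegral_congr fun x => ?_
    simp only [Pi.mul_apply]
    rw [mul_pow, mul_comm]
  have hsub : ∀ γ : C(I, A), pathLength γ ≠ ∞ → lineIntegral ρ₀ γ ≠ ∞ →
      ∀ s t, 0 ≤ s → s ≤ t → t ≤ (pathLength γ).toReal →
      edist (H (arcParam γ s)) (H (arcParam γ t)) ≤ ∫⁻ u in Icc s t, w (arcParam γ u) := by
    intro γ hγ hfin s t hs hst ht
    have hss : Icc s t ⊆ Icc 0 (pathLength γ).toReal := Icc_subset_Icc hs ht
    refine hug _ s t hst ((lipschitzOnWith_arcParam hγ).mono hss) ?_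
    exact ne_top_of_le_ne_top hfin (lintegral_mono_set hss)
  have hscale : ∀ {ρ : A → ℝ≥0∞} (ε : ℝ≥0∞), ∫⁻ x, (ε * ρ x) ^ 2 ∂μ =
      ε ^ 2 * ∫⁻ x, ρ x ^ 2 ∂μ ∨ ε = ∞ := by
    intro ρ ε
    by_cases hε : ε = ∞
    · exact Or.inr hε
    · left
      simp only [mul_pow]
      exact lintegral_const_mul' _ _ (ENNReal.pow_ne_top hε)
  have htend : ∀ a b : ℝ≥0∞, b ≠ ∞ → (∀ ε : ℝ≥0∞, 0 < ε → ε ≠ ∞ → a ≤ ε ^ 2 * b) → a = 0 := by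
    intro a b hb hab
    have h1 : Tendsto (fun k : ℕ => ((1 / 2 : ℝ≥0∞) ^ k) ^ 2 * b) atTop (𝓝 (0 ^ 2 * b)) := by
      refine ENNReal.Tendsto.mul_const ?_ (Or.inr hb)
      refine ((ENNReal.continuous_pow 2).tendsto _).comp
        (ENNReal.tendsto_pow_atTop_nhds_zero_of_lt_one (by
        rw [one_div]; exact ENNReal.inv_lt_one.2 (by norm_num)))
    simp only [ne_eq, OfNat.ofNat_ne_zero, not_false_eq_true, zero_pow, zero_mul] at h1
    refine le_antisymm (ge_of_tendsto' h1 fun k => hab _ ?_ ?_) bot_le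
    · exact ENNReal.pow_pos (by simp) k
    · exact ENNReal.pow_ne_top (by simp)
  have hlinscale : ∀ (γ : C(I, A)) (ρ : A → ℝ≥0∞) (ε : ℝ≥0∞), 0 < ε → lineIntegral ρ γ = ∞ →
      lineIntegral (fun x => ε * ρ x) γ = ∞ := by
    intro γ ρ ε hε h
    refine top_le_iff.1 (le_trans (le_of_eq ?_) (lintegral_const_mul_le ε _))
    change ∞ = ε * lineIntegral ρ γ
    rw [h, ENNReal.mul_top hε.ne']
  refine ⟨fun Γ => ?_, hH.measurable, ⟨w, ⟨hw, {γ | lineIntegral ρ₀ γ = ∞}, ?_, ?_⟩, hw2⟩, ?_⟩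
  · -- the modulus inequality
    unfold modulus
    have hK0 : ENNReal.ofReal K ≠ 0 := (ENNReal.ofReal_pos.2 hK).ne'
    have hKtop : ENNReal.ofReal K ≠ ∞ := ENNReal.ofReal_ne_top
    refine le_of_forall_gt_imp_ge_of_dense fun m hm => ?_
    simp only [ENNReal.mul_iInf_of_ne hK0 hKtop, iInf_lt_iff] at hm
    obtain ⟨ρ, ⟨hρm, hρ⟩, hρlt⟩ := hm
    have hρle := hρlt.le
    set b := ∫⁻ x, w x ^ 2 ∂μ + ∫⁻ x, ρ₀ x ^ 2 ∂μ with hb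
    have hbf : b ≠ ∞ := (ENNReal.add_lt_top.2 ⟨hw2, hρ2⟩).ne
    -- If `w` or `ρ₀` has infinite integral along `γ`, so has its multiple by `ε`, at arbitrarily
    -- small cost. Along all other rectifiable curves the upper gradient inequality holds on every
    -- subcurve, and the first entry of the maximum does the work.
    have hadm : ∀ ε : ℝ≥0∞, 0 < ε → IsAdmissible Γ
        (fun x => max (ρ (H x) * w x) (max (ε * w x) (ε * ρ₀ x))) := by
      intro ε hε
      refine ⟨((hρm.comp hH.measurable).mul hw).max
        ((hw.const_mul ε).max (hρ₀.const_mul ε)), fun γ hγΓ hγ => ?_⟩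
      by_cases h1 : lineIntegral ρ₀ γ = ∞
      · refine le_trans ?_ (lintegral_mono (f := fun s => ε * ρ₀ (arcParam γ s)) fun s =>
          (le_max_right _ _).trans (le_max_right _ _))
        exact le_of_le_of_eq le_top (hlinscale γ ρ₀ ε hε h1).symm
      by_cases h2 : lineIntegral w γ = ∞
      · refine le_trans ?_ (lintegral_mono (f := fun s => ε * w (arcParam γ s)) fun s =>
          (le_max_left _ _).trans (le_max_right _ _))
        exact le_of_le_of_eq le_top (hlinscale γ w ε hε h2).symm
      set η : C(I, X) := ⟨fun t => H (γ t), hH.comp γ.continuous⟩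
      have hℓ : (0 : ℝ) ≤ (pathLength γ).toReal := ENNReal.toReal_nonneg
      -- The natural parametrization is controlled only on the interval of arc length; projecting to
      -- it makes the density measurable on the whole line.
      set w' : ℝ → ℝ≥0∞ := fun s => w (arcParam γ (projIcc 0 (pathLength γ).toReal hℓ s))
      have hwc : Measurable w' := by
        refine hw.comp (Continuous.measurable ?_)
        exact (continuousOn_iff_continuous_domRestrict.1
          (lipschitzOnWith_arcParam hγ).continuousOn).comp continuous_projIcc
      have hw' : ∀ u ∈ Icc 0 (pathLength γ).toReal, w' u = w (arcParam γ u) := fun u hu => by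
        simp only [w', projIcc_of_mem hℓ hu]
      have hsame : ∀ s t, 0 ≤ s → t ≤ (pathLength γ).toReal →
          ∫⁻ u in Icc s t, w' u = ∫⁻ u in Icc s t, w (arcParam γ u) := fun s t hs ht =>
        setLIntegral_congr_fun measurableSet_Icc fun u hu =>
          hw' u ⟨hs.trans hu.1, hu.2.trans ht⟩
      obtain ⟨hηf, hηρ⟩ := lineIntegral_comp_le (h := H) (γ := γ) (η := η) (fun t => rfl) hγ hwc
        (by rw [hsame _ _ le_rfl le_rfl]; exact h2)
        (fun s t hs hst ht => by rw [hsame s t hs ht]; exact hsub γ hγ h1 s t hs hst ht)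
      refine (hρ η ⟨γ, hγΓ, fun t => rfl⟩ hηf).trans ((hηρ ρ).trans ?_)
      refine setLIntegral_mono' measurableSet_Icc fun s hs => ?_
      rw [hw' s hs, mul_comm]
      exact le_max_left _ _
    have hbound : ∀ ε : ℝ≥0∞, 0 < ε → ε ≠ ∞ →
        ⨅ (ρ : A → ℝ≥0∞) (_ : IsAdmissible Γ ρ), ∫⁻ x, ρ x ^ 2 ∂μ ≤ m + ε ^ 2 * b := by
      intro ε hε hεt
      refine (iInf₂_le _ (hadm ε hε)).trans ?_
      calc ∫⁻ x, (max (ρ (H x) * w x) (max (ε * w x) (ε * ρ₀ x))) ^ 2 ∂μ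
          ≤ ∫⁻ x, ((ρ (H x) * w x) ^ 2 + ((ε * w x) ^ 2 + (ε * ρ₀ x) ^ 2)) ∂μ := by
            refine lintegral_mono fun x => ?_
            rcases max_cases (ρ (H x) * w x) (max (ε * w x) (ε * ρ₀ x)) with h | h
            · dsimp only; rw [h.1]; exact le_self_add
            · dsimp only
              rw [h.1]
              refine le_trans ?_ le_add_self
              rcases max_cases (ε * w x) (ε * ρ₀ x) with h' | h'
              · rw [h'.1]; exact le_self_add
              · rw [h'.1]; exact le_add_self
        _ = ∫⁻ x, (ρ (H x) * w x) ^ 2 ∂μ + (∫⁻ x, (ε * w x) ^ 2 ∂μ +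
            ∫⁻ x, (ε * ρ₀ x) ^ 2 ∂μ) := by
            have hm1 : Measurable fun x => (ρ (H x) * w x) ^ 2 :=
              ((hρm.comp hH.measurable).mul hw).pow_const 2
            rw [lintegral_add_left hm1, lintegral_add_left ((hw.const_mul ε).pow_const 2)]
        _ ≤ m + ε ^ 2 * b := by
            rw [(hscale ε).resolve_right hεt, (hscale ε).resolve_right hεt, ← mul_add]
            gcongr
            exact (hint ρ hρm).trans hρle
    have h1 : Tendsto (fun k : ℕ => m + ((1 / 2 : ℝ≥0∞) ^ k) ^ 2 * b) atTop
        (𝓝 (m + 0 ^ 2 * b)) := by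
      refine tendsto_const_nhds.add (ENNReal.Tendsto.mul_const ?_ (Or.inr hbf))
      refine ((ENNReal.continuous_pow 2).tendsto _).comp
        (ENNReal.tendsto_pow_atTop_nhds_zero_of_lt_one (by
        rw [one_div]; exact ENNReal.inv_lt_one.2 (by norm_num)))
    simp only [ne_eq, OfNat.ofNat_ne_zero, not_false_eq_true, zero_pow, zero_mul,
      add_zero] at h1
    refine ge_of_tendsto' h1 fun k => hbound _ ?_ ?_
    · exact ENNReal.pow_pos (by simp) k
    · exact ENNReal.pow_ne_top (by simp)
  · -- the exceptional family
    refine htend _ _ hρ2.ne fun ε hε hεt => ?_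
    rw [← (hscale ε).resolve_right hεt]
    refine iInf₂_le _ ⟨hρ₀.const_mul ε, fun γ hγ _ => ?_⟩
    rw [hlinscale γ ρ₀ ε hε hγ]
    exact le_top
  · intro γ hγ hγf
    have := hsub γ hγf hγ 0 _ le_rfl ENNReal.toReal_nonneg le_rfl
    rwa [arcParam_zero hγf, arcParam_length hγf] at this
  · obtain ⟨x₀⟩ := ‹Nonempty A›
    refine ⟨H x₀, ?_⟩
    obtain ⟨C, hC⟩ := (isCompact_univ (X := X)).isBounded.subset_closedBall (H x₀) |>.imp
      fun C hC => fun y => hC (mem_univ y)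
    refine MemLp.of_bound (by fun_prop) C (ae_of_all _ fun x => ?_)
    rw [Real.norm_of_nonneg dist_nonneg, dist_comm]
    exact hC (H x)

/-- The limit of a uniformly convergent sequence `f n ∘ h n`, where `f n` is approximately isometric
and `h n` conformal, satisfies the modulus inequality and belongs to the Sobolev class. -/
theorem modulus_le_and_memSobolev_of_limit {A X : Type*} [MetricSpace A] [MeasurableSpace A]
    [BorelSpace A] [CompactSpace A] [Nonempty A] [∀ x : A, (𝓝[≠] x).NeBot]
    [MetricSpace X] [CompactSpace X] [MeasurableSpace X] [BorelSpace X]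
    {Y : ℕ → Type*} [∀ n, MetricSpace (Y n)] [∀ n, MeasurableSpace (Y n)] [∀ n, BorelSpace (Y n)]
    {f : ∀ n, Y n → X} {h : ∀ n, A ≃ₜ Y n} {g : ℕ → A → ℝ≥0} {P : ℕ → Finset A} {H : A → X}
    (hA : hausdorffTwo A univ ≠ ∞) (hX : hausdorffTwo X univ ≠ ∞) {K : ℝ} (hK : 0 < K)
    (hf : IsApproxIsometricSeq f)
    (hlim : TendstoUniformly (fun n x => f n (h n x)) H atTop) (hH : Continuous H)
    (hconf : ∀ n, IsMetricConformal (h n) (g n) (P n))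
    (harea : ∀ s : Set X, IsCompact s →
      limsup (fun n => hausdorffTwo (Y n) (f n ⁻¹' s)) atTop ≤ ENNReal.ofReal K * hausdorffTwo X s)
    {M : ℝ≥0∞} (hM : M ≠ ∞) (hYM : ∀ n, hausdorffTwo (Y n) univ ≤ M) :
    (∀ Γ : Set C(I, A), modulus Γ ≤ ENNReal.ofReal K * modulus (imageFamily H Γ)) ∧
      MemSobolevN12 H := by
  have hgm : ∀ n, Measurable fun x => (g n x : ℝ) := fun n => (hconf n).measurable.coe_nnreal_real
  have hgM : ∀ n, ∫⁻ x, ‖(g n x : ℝ)‖ₑ ^ 2 ∂(hausdorffTwo A) ≤ M := by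
    intro n
    have h1 := (hconf n).setLIntegral_sq_le MeasurableSet.univ
    rw [Measure.restrict_univ] at h1
    simp only [Real.enorm_of_nonneg (NNReal.coe_nonneg _), ENNReal.ofReal_coe_nnreal]
    exact h1.trans ((measure_mono (subset_univ _)).trans (hYM n))
  -- With squared errors at most `8 ^ (-k)`, the functions `2 ^ k * |G k - v|` have energies at most
  -- `4 ^ k * 8 ^ (-k) = 2 ^ (-k)`, so their supremum `ρ₀` is in `L²`.
  obtain ⟨v, hv, hv2, G, hG⟩ := exists_convexHull_lintegral_sub_le (ε := fun k => (1 / 8) ^ k) hgm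
    hM hgM (fun k => ENNReal.pow_pos (by simp) k)
  set ρ₀ : A → ℝ≥0∞ := fun x => ⨆ k : ℕ, 2 ^ k * ‖G k x - v x‖ₑ with hρ₀
  have hmeas : ∀ k : ℕ, Measurable fun x => (2 : ℝ≥0∞) ^ k * ‖G k x - v x‖ₑ := fun k =>
    ((hG k).2.1.sub hv).enorm.const_mul _
  have hρ2 : ∫⁻ x, ρ₀ x ^ 2 ∂(hausdorffTwo A) < ∞ := by
    calc ∫⁻ x, ρ₀ x ^ 2 ∂(hausdorffTwo A)
        ≤ ∫⁻ x, ∑' k : ℕ, (2 ^ k * ‖G k x - v x‖ₑ) ^ 2 ∂(hausdorffTwo A) := by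
          refine lintegral_mono fun x => ?_
          have : ρ₀ x ^ 2 = ⨆ k : ℕ, (2 ^ k * ‖G k x - v x‖ₑ) ^ 2 :=
            (show Monotone fun a : ℝ≥0∞ => a ^ 2 from fun _ _ hab =>
              pow_le_pow_left' hab 2).map_iSup_of_continuousAt
              (ENNReal.continuous_pow 2).continuousAt (by simp)
          dsimp only
          rw [this]
          exact iSup_le fun k => ENNReal.le_tsum k
      _ = ∑' k : ℕ, ∫⁻ x, (2 ^ k * ‖G k x - v x‖ₑ) ^ 2 ∂(hausdorffTwo A) :=
          lintegral_tsum fun k => ((hmeas k).pow_const 2).aemeasurable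
      _ ≤ ∑' k : ℕ, (1 / 2 : ℝ≥0∞) ^ k := by
          refine ENNReal.tsum_le_tsum fun k => ?_
          simp only [mul_pow]
          rw [lintegral_const_mul' _ _ (ENNReal.pow_ne_top (ENNReal.pow_ne_top (by simp)))]
          refine (mul_le_mul_right (hG k).2.2 _).trans (le_of_eq ?_)
          rw [← pow_mul, mul_comm k 2, pow_mul, ← mul_pow]
          congr 1
          rw [show (2 : ℝ≥0∞) ^ 2 = ENNReal.ofReal 4 by norm_num,
            show (1 / 8 : ℝ≥0∞) = ENNReal.ofReal (1 / 8) by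
              rw [ENNReal.ofReal_div_of_pos (by norm_num)]; norm_num,
            show (1 / 2 : ℝ≥0∞) = ENNReal.ofReal (1 / 2) by
              rw [ENNReal.ofReal_div_of_pos (by norm_num)]; norm_num,
            ← ENNReal.ofReal_mul (by norm_num)]
          norm_num
      _ < ∞ := by
          rw [ENNReal.tsum_geometric]
          refine ENNReal.inv_lt_top.2 (tsub_pos_of_lt ?_)
          rw [one_div]
          exact ENNReal.inv_lt_one.2 (by norm_num)
  have hGv : Tendsto (fun k => ∫⁻ x, ‖G k x - v x‖ₑ ^ 2 ∂(hausdorffTwo A)) atTop (𝓝 0) := by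
    refine tendsto_of_tendsto_of_tendsto_of_le_of_le tendsto_const_nhds
      (ENNReal.tendsto_pow_atTop_nhds_zero_of_lt_one (r := 1 / 8) ?_) (fun _ => bot_le)
      (fun k => (hG k).2.2)
    rw [one_div]
    exact ENNReal.inv_lt_one.2 (by norm_num)
  refine modulus_le_and_memSobolev (w := fun x => ‖v x‖ₑ) (ρ₀ := ρ₀) hA hK hH hv.enorm hv2
    (Measurable.iSup hmeas) hρ2 (fun s hs => ?_) (fun c s t hst hc hfin => ?_)
  · exact setLIntegral_sq_le_of_limit hX hlim hH hconf harea hv (fun k => (hG k).1)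
      (fun k => (hG k).2.1) hGv hs
  · exact edist_le_lintegral_of_limit hf (fun x => hlim.tendsto_at x) hconf hv
      (fun k => (hG k).1) (fun k x => le_iSup (fun k : ℕ => 2 ^ k * ‖G k x - v x‖ₑ) k) hst hc hfin




/-! ### Approximately geodesic spaces and Gromov–Hausdorff limits -/

/-- Any two points lie in a connected set all of whose points are almost between them. -/
def IsApproxGeodesic (Y : Type*) [MetricSpace Y] : Prop :=
  ∀ p q : Y, ∀ ε > 0, ∃ C : Set Y, IsPreconnected C ∧ p ∈ C ∧ q ∈ C ∧
    ∀ z ∈ C, dist p z + dist z q ≤ dist p q + ε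

/-- `S` separates `U` from its complement. -/
def Separates {Y : Type*} [TopologicalSpace Y] (S U : Set Y) : Prop :=
  ∀ C : Set Y, IsPreconnected C → (C ∩ U).Nonempty → (C ∩ Uᶜ).Nonempty → (C ∩ S).Nonempty

theorem Separates.compl {Y : Type*} [TopologicalSpace Y] {S U : Set Y} (h : Separates S U) :
    Separates S Uᶜ := fun C hC h1 h2 => h C hC (by rwa [compl_compl] at h2) h1

theorem IsApproxIsometricSeq.comp {X : Type*} [MetricSpace X] {Y : ℕ → Type*}
    [∀ n, MetricSpace (Y n)] {f : ∀ n, Y n → X} (hf : IsApproxIsometricSeq f) {φ : ℕ → ℕ}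
    (hφ : Tendsto φ atTop atTop) : IsApproxIsometricSeq (fun n => f (φ n)) := by
  obtain ⟨ε, h0, h1, h2⟩ := hf
  exact ⟨fun n => ε (φ n), fun n => h0 _, h1.comp hφ, fun n => h2 _⟩

section Separation

variable {X : Type*} [MetricSpace X] [CompactSpace X] {Y : ℕ → Type*} [∀ n, MetricSpace (Y n)]
  {f : ∀ n, Y n → X}

omit [CompactSpace X] in
theorem tendsto_dist_of_isApproxIsometricSeq (hf : IsApproxIsometricSeq f) {l : Filter ℕ}
    (hl : l ≤ atTop) {y z : ∀ n, Y n} {x w : X} (hy : Tendsto (fun n => f n (y n)) l (𝓝 x))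
    (hz : Tendsto (fun n => f n (z n)) l (𝓝 w)) :
    Tendsto (fun n => dist (y n) (z n)) l (𝓝 (dist x w)) := by
  obtain ⟨ε, -, hε, hfε⟩ := hf
  have h1 := hy.dist hz
  have h2 := h1.sub (hε.mono_left hl)
  have h3 := h1.add (hε.mono_left hl)
  rw [sub_zero] at h2
  rw [add_zero] at h3
  refine tendsto_of_tendsto_of_tendsto_of_le_of_le h2 h3 (fun n => ?_) (fun n => ?_)
  · have := (hfε n).edist_le (y n) (z n)
    simp only
    linarith
  · exact (hfε n).edist_ge (y n) (z n)

omit [CompactSpace X] in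
-- An almost geodesic set from `y n` to `z n` has to cross `S n`, which shrinks to the point `s n`.
-- In the limit `p` lies between `x` and `w`.
theorem dist_add_dist_le_of_separates (hf : IsApproxIsometricSeq f)
    (hY : ∀ n, IsApproxGeodesic (Y n)) {l : Filter ℕ} [l.NeBot] (hl : l ≤ atTop)
    {S U : ∀ n, Set (Y n)} (hSU : ∀ n, Separates (S n) (U n)) {s : ∀ n, Y n} {η : ℕ → ℝ}
    (hη : Tendsto η l (𝓝 0)) (hS : ∀ n, ∀ t ∈ S n, dist (s n) t ≤ η n)
    {y z : ∀ n, Y n} (hyU : ∀ᶠ n in l, y n ∈ U n) (hzU : ∀ᶠ n in l, z n ∉ U n) {x w p : X}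
    (hy : Tendsto (fun n => f n (y n)) l (𝓝 x)) (hz : Tendsto (fun n => f n (z n)) l (𝓝 w))
    (hs : Tendsto (fun n => f n (s n)) l (𝓝 p)) :
    dist x p + dist p w ≤ dist x w := by
  have h1 := (tendsto_dist_of_isApproxIsometricSeq hf hl hy hs).add
    (tendsto_dist_of_isApproxIsometricSeq hf hl hs hz)
  have h2 := ((tendsto_dist_of_isApproxIsometricSeq hf hl hy hz).add
    ((tendsto_one_div_add_atTop_nhds_zero_nat (𝕜 := ℝ)).mono_left hl)).add (hη.const_mul 2)
  simp only [add_zero, mul_zero] at h2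
  refine le_of_tendsto_of_tendsto h1 h2 ?_
  filter_upwards [hyU, hzU] with n hyn hzn
  obtain ⟨C, hC, hyC, hzC, hCd⟩ := hY n (y n) (z n) (1 / ((n : ℝ) + 1)) (by positivity)
  obtain ⟨t, htC, htS⟩ := hSU n C hC ⟨_, hyC, hyn⟩ ⟨_, hzC, hzn⟩
  have e1 := hCd t htC
  have e2 := hS n t htS
  have e3 := dist_triangle (y n) t (s n)
  have e4 := dist_triangle (s n) t (z n)
  rw [dist_comm t (s n)] at e3
  linarith

/-- If the limit space has no cut points, then small sets cannot separate the approximating spaces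
into two large parts: version along an ultrafilter. -/
theorem eventually_dist_le_or_of_separates (hX : ∀ p : X, IsPreconnected ({p}ᶜ : Set X))
    (hf : IsApproxIsometricSeq f) (hY : ∀ n, IsApproxGeodesic (Y n)) {l : Ultrafilter ℕ}
    (hl : (l : Filter ℕ) ≤ atTop) {S U : ∀ n, Set (Y n)} (hSU : ∀ n, Separates (S n) (U n))
    {s : ∀ n, Y n} {η : ℕ → ℝ} (hη : Tendsto η l (𝓝 0))
    (hS : ∀ n, ∀ t ∈ S n, dist (s n) t ≤ η n) {ε : ℝ} (hε : 0 < ε) :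
    (∀ᶠ n in (l : Filter ℕ), ∀ y ∈ U n, ∀ z ∈ U n, dist y z ≤ ε) ∨
      ∀ᶠ n in (l : Filter ℕ), ∀ y ∉ U n, ∀ z ∉ U n, dist y z ≤ ε := by
  obtain ⟨e, he0, he, hfe⟩ := id hf
  have hlim : ∀ y : ∀ n, Y n, ∃ x, Tendsto (fun n => f n (y n)) l (𝓝 x) := by
    intro y
    obtain ⟨x, -, hx⟩ := (isCompact_univ (X := X)).ultrafilter_le_nhds
      (l.map fun n => f n (y n)) (by simp)
    exact ⟨x, hx⟩
  have happ : ∀ x : X, ∀ n, ∃ y : Y n, dist x (f n y) < e n := fun x n => (hfe n).1 x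
  choose a ha using happ
  have halim : ∀ x, Tendsto (fun n => f n (a x n)) l (𝓝 x) := by
    intro x
    rw [tendsto_iff_dist_tendsto_zero]
    refine squeeze_zero (fun n => dist_nonneg) (fun n => ?_) (he.mono_left hl)
    rw [dist_comm]
    exact (ha x n).le
  obtain ⟨p, hp⟩ := hlim s
  -- Points of `X` are sorted by the side on which their approximants lie; the ultrafilter decides
  -- for every point.
  set A : Set X := {x | ∀ᶠ n in (l : Filter ℕ), a x n ∈ U n} with hA
  have hAc : ∀ x ∉ A, ∀ᶠ n in (l : Filter ℕ), a x n ∉ U n := fun x hx =>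
    Ultrafilter.eventually_not.2 hx
  have hd : ∀ x ∈ A, ∀ w ∉ A, dist x p + dist p w ≤ dist x w := fun x hx w hw =>
    dist_add_dist_le_of_separates hf hY hl hSU hη hS hx (hAc w hw) (halim x) (halim w) hp
  -- Two sequences with the same limit `x` on different sides would force `p` to lie between `x` and
  -- itself, so only `p` can be approached from both sides.
  have hAin : ∀ y : ∀ n, Y n, (∀ᶠ n in (l : Filter ℕ), y n ∈ U n) → ∀ x,
      Tendsto (fun n => f n (y n)) l (𝓝 x) → x ≠ p → x ∈ A := by
    intro y hy x hx hxp
    by_contra hxA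
    have := dist_add_dist_le_of_separates hf hY hl hSU hη hS hy (hAc x hxA) hx (halim x) hp
    rw [dist_self, dist_comm p x] at this
    have := dist_pos.2 hxp
    linarith
  have hAout : ∀ y : ∀ n, Y n, (∀ᶠ n in (l : Filter ℕ), y n ∉ U n) → ∀ x,
      Tendsto (fun n => f n (y n)) l (𝓝 x) → x ≠ p → x ∉ A := by
    intro y hy x hx hxp hxA
    have := dist_add_dist_le_of_separates hf hY hl hSU hη hS hxA hy (halim x) hx hp
    rw [dist_self, dist_comm p x] at this
    have := dist_pos.2 hxp
    linarith
  -- If sequences in `V n` can accumulate only at `p`, the diameters of `V n` become small: a pair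
  -- of points staying `ε` apart would have distinct limits.
  have hsmall : ∀ V : ∀ n, Set (Y n), (∀ y : ∀ n, Y n, (∀ᶠ n in (l : Filter ℕ), y n ∈ V n) → ∀ x,
      Tendsto (fun n => f n (y n)) l (𝓝 x) → x = p) →
      ∀ᶠ n in (l : Filter ℕ), ∀ y ∈ V n, ∀ z ∈ V n, dist y z ≤ ε := by
    intro V hV
    by_contra hcon
    rw [← Ultrafilter.eventually_not] at hcon
    have hch : ∀ n, ∃ y z : Y n, (¬ ∀ y ∈ V n, ∀ z ∈ V n, dist y z ≤ ε) →
        y ∈ V n ∧ z ∈ V n ∧ ε < dist y z := by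
      intro n
      by_cases h : ∀ y ∈ V n, ∀ z ∈ V n, dist y z ≤ ε
      · exact ⟨s n, s n, fun h' => absurd h h'⟩
      · push Not at h
        obtain ⟨y, hy, z, hz, hyz⟩ := h
        exact ⟨y, z, fun _ => ⟨hy, hz, hyz⟩⟩
    choose y z hyz using hch
    obtain ⟨x, hx⟩ := hlim y
    obtain ⟨w, hw⟩ := hlim z
    have e1 := hV y (hcon.mono fun n hn => (hyz n hn).1) x hx
    have e2 := hV z (hcon.mono fun n hn => (hyz n hn).2.1) w hw
    have e3 := tendsto_dist_of_isApproxIsometricSeq hf hl hx hw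
    rw [e1, e2, dist_self] at e3
    obtain ⟨n, hn1, hn2⟩ := ((e3.eventually (gt_mem_nhds hε)).and hcon).exists
    exact absurd hn1 (not_lt.2 (hyz n hn2).2.2.le)
  -- Since `p` lies between any point of `A` and any point outside, the ball of radius `dist x p`
  -- around a point on one side contains no point of the other side. Unless one side is contained in
  -- `{p}`, these balls disconnect the complement of `p`.
  have hAp : (∀ x ∈ A, x = p) ∨ ∀ x ∉ A, x = p := by
    by_contra! hcon
    obtain ⟨⟨x, hxA, hxp⟩, w, hwA, hwp⟩ := hcon
    set O₁ := ⋃ x ∈ A, Metric.ball x (dist x p)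
    set O₂ := ⋃ x ∈ Aᶜ, Metric.ball x (dist x p)
    obtain ⟨z, hzp, hz1, hz2⟩ := hX p O₁ O₂
      (isOpen_biUnion fun _ _ => Metric.isOpen_ball) (isOpen_biUnion fun _ _ => Metric.isOpen_ball)
      (fun z hz => by
        by_cases hzA : z ∈ A
        · exact Or.inl (mem_biUnion hzA (Metric.mem_ball_self (dist_pos.2 hz)))
        · exact Or.inr (mem_biUnion hzA (Metric.mem_ball_self (dist_pos.2 hz))))
      ⟨x, hxp, mem_biUnion hxA (Metric.mem_ball_self (dist_pos.2 hxp))⟩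
      ⟨w, hwp, mem_biUnion hwA (Metric.mem_ball_self (dist_pos.2 hwp))⟩
    obtain ⟨x', hx', hzx⟩ := mem_iUnion₂.1 hz1
    obtain ⟨w', hw', hzw⟩ := mem_iUnion₂.1 hz2
    rw [Metric.mem_ball] at hzx hzw
    have hzp' : 0 ≤ dist z p := dist_nonneg
    by_cases hzA : z ∈ A
    · have := hd z hzA w' hw'
      rw [dist_comm p w'] at this
      linarith
    · have := hd x' hx' z hzA
      rw [dist_comm p z, dist_comm x' z] at this
      linarith
  rcases hAp with h | h
  · refine Or.inl (hsmall U fun y hy x hx => ?_)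
    by_contra hxp
    exact hxp (h x (hAin y hy x hx hxp))
  · refine Or.inr (hsmall (fun n => (U n)ᶜ) fun y hy x hx => ?_)
    by_contra hxp
    exact hxp (h x (hAout y hy x hx hxp))

/-- If the limit space has no cut points, then small sets cannot separate the approximating spaces
into two large parts. -/
theorem exists_forall_separates (hX : ∀ p : X, IsPreconnected ({p}ᶜ : Set X))
    (hf : IsApproxIsometricSeq f) (hY : ∀ n, IsApproxGeodesic (Y n)) {ε : ℝ} (hε : 0 < ε) :
    ∃ η > 0, ∃ N, ∀ n ≥ N, ∀ S U : Set (Y n), Separates S U → S.Nonempty →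
      (∀ y ∈ S, ∀ z ∈ S, dist y z ≤ η) →
      (∀ y ∈ U, ∀ z ∈ U, dist y z ≤ ε) ∨ ∀ y ∉ U, ∀ z ∉ U, dist y z ≤ ε := by
  by_contra! hcon
  have hcon' : ∀ k : ℕ, ∃ n ≥ k, ∃ (S U : Set (Y n)) (s : Y n), Separates S U ∧
      (∀ z ∈ S, dist s z ≤ 1 / ((k : ℝ) + 1)) ∧ (∃ y ∈ U, ∃ z ∈ U, ε < dist y z) ∧
      ∃ y ∉ U, ∃ z ∉ U, ε < dist y z := by
    intro k
    obtain ⟨n, hn, S, U, hSU, ⟨s, hs⟩, hS, h1, h2⟩ := hcon (1 / ((k : ℝ) + 1)) (by positivity) k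
    exact ⟨n, hn, S, U, s, hSU, hS s hs, h1, h2⟩
  choose φ hφ S U s hSU hS h1 h2 using hcon'
  have hφt : Tendsto φ atTop atTop := tendsto_atTop_mono hφ tendsto_id
  have hl : (hyperfilter ℕ : Filter ℕ) ≤ atTop := Nat.hyperfilter_le_atTop
  rcases eventually_dist_le_or_of_separates (Y := fun k => Y (φ k)) hX (hf.comp hφt)
    (fun k => hY (φ k)) hl hSU ((tendsto_one_div_add_atTop_nhds_zero_nat (𝕜 := ℝ)).mono_left hl)
    hS hε with h | h
  · obtain ⟨k, hk⟩ := h.exists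
    obtain ⟨y, hy, z, hz, hyz⟩ := h1 k
    exact absurd (hk y hy z hz) (not_le.2 hyz)
  · obtain ⟨k, hk⟩ := h.exists
    obtain ⟨y, hy, z, hz, hyz⟩ := h2 k
    exact absurd (hk y hy z hz) (not_le.2 hyz)

end Separation

/-- A version of the Arzelà–Ascoli theorem for maps that need not be continuous. -/
theorem exists_tendstoUniformly_subseq {A X : Type*} [MetricSpace A] [CompactSpace A]
    [Nonempty A] [MetricSpace X] [CompactSpace X] {F : ℕ → A → X}
    (hF : ∀ x, ∀ ε > 0, ∃ V ∈ 𝓝 x, ∃ N, ∀ n ≥ N, ∀ y ∈ V, dist (F n y) (F n x) ≤ ε) :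
    ∃ φ : ℕ → ℕ, StrictMono φ ∧ ∃ H : A → X, Continuous H ∧
      TendstoUniformly (fun n => F (φ n)) H atTop := by
  set d := TopologicalSpace.denseSeq A
  obtain ⟨L, φ, hφ, hL⟩ := CompactSpace.tendsto_subseq (fun n => fun i : ℕ => F n (d i))
  have hLi : ∀ i, Tendsto (fun n => F (φ n) (d i)) atTop (𝓝 (L i)) := fun i =>
    (tendsto_pi_nhds.1 hL) i
  have hcau : ∀ ε > 0, ∃ N, ∀ m ≥ N, ∀ n ≥ N, ∀ x, dist (F (φ m) x) (F (φ n) x) < ε := by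
    intro ε hε
    have hε6 : 0 < ε / 6 := by positivity
    choose V hV N hN using fun x => hF x (ε / 6) hε6
    obtain ⟨T, -, hT⟩ := isCompact_univ.elim_nhds_subcover V fun x _ => hV x
    have hi : ∀ x, ∃ i, d i ∈ V x := fun x => by
      obtain ⟨y, hy, hy'⟩ := (TopologicalSpace.denseRange_denseSeq A).inter_open_nonempty _
        isOpen_interior ⟨x, mem_interior_iff_mem_nhds.2 (hV x)⟩
      obtain ⟨i, rfl⟩ := hy'
      exact ⟨i, interior_subset hy⟩
    choose i hi using hi
    have hN' : ∀ x, ∃ N', ∀ m ≥ N', dist (F (φ m) (d (i x))) (L (i x)) < ε / 6 := fun x =>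
      eventually_atTop.1 ((tendsto_iff_dist_tendsto_zero.1 (hLi (i x))).eventually
        (gt_mem_nhds hε6))
    choose N' hN' using hN'
    refine ⟨T.sup (fun x => max (N x) (N' x)), ?_⟩
    have key : ∀ m ≥ T.sup (fun x => max (N x) (N' x)), ∀ x ∈ T, ∀ y ∈ V x,
        dist (F (φ m) y) (L (i x)) < ε / 2 := by
      intro m hm x hx y hy
      have hm' : max (N x) (N' x) ≤ m :=
        (Finset.le_sup (f := fun x => max (N x) (N' x)) hx).trans hm
      have hm1 : N x ≤ φ m := ((le_max_left _ _).trans hm').trans hφ.le_apply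
      have e1 := hN x (φ m) hm1 y hy
      have e2 := hN x (φ m) hm1 _ (hi x)
      have e3 := hN' x m ((le_max_right _ _).trans hm')
      have e4 := dist_triangle4 (F (φ m) y) (F (φ m) x) (F (φ m) (d (i x))) (L (i x))
      rw [dist_comm (F (φ m) x)] at e4
      linarith
    intro m hm n hn y
    obtain ⟨x, hx, hy⟩ := mem_iUnion₂.1 (hT (mem_univ y))
    have e1 := key m hm x hx y hy
    have e2 := key n hn x hx y hy
    have e3 := dist_triangle_right (F (φ m) y) (F (φ n) y) (L (i x))
    linarith
  have hlim : ∀ x, ∃ z, Tendsto (fun n => F (φ n) x) atTop (𝓝 z) := fun x => by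
    refine cauchySeq_tendsto_of_complete (Metric.cauchySeq_iff.2 fun ε hε => ?_)
    obtain ⟨N, hN⟩ := hcau ε hε
    exact ⟨N, fun m hm n hn => hN m hm n hn x⟩
  choose H hH using hlim
  have hU : TendstoUniformly (fun n => F (φ n)) H atTop := by
    rw [← tendstoUniformlyOn_univ]
    refine UniformCauchySeqOn.tendstoUniformlyOn_of_tendsto ?_ fun x _ => hH x
    rw [Metric.uniformCauchySeqOn_iff]
    intro ε hε
    obtain ⟨N, hN⟩ := hcau ε hε
    exact ⟨N, fun m hm n hn x _ => hN m hm n hn x⟩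
  refine ⟨φ, hφ, H, ?_, hU⟩
  rw [continuous_iff_continuousAt]
  intro x
  rw [Metric.continuousAt_iff']
  intro ε hε
  obtain ⟨V, hV, N, hN⟩ := hF x (ε / 2) (half_pos hε)
  filter_upwards [hV] with y hy
  have : dist (H y) (H x) ≤ ε / 2 := by
    refine le_of_tendsto ((hH y).dist (hH x)) (eventually_atTop.2 ⟨N, fun n hn => ?_⟩)
    exact hN (φ n) (hn.trans hφ.le_apply) y hy
  linarith

/-! ### Surjectivity and monotonicity of the limit map. -/

section LimitMap

variable {A X : Type*} [MetricSpace A] [CompactSpace A] [MetricSpace X] {Y : ℕ → Type*}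
  [∀ n, MetricSpace (Y n)] {f : ∀ n, Y n → X} {h : ∀ n, A ≃ₜ Y n} {H : A → X}

theorem surjective_of_limit (hf : IsApproxIsometricSeq f)
    (hlim : TendstoUniformly (fun n x => f n (h n x)) H atTop) (hH : Continuous H) :
    Function.Surjective H := by
  obtain ⟨ε, -, hε, hfε⟩ := hf
  intro y
  have hcl : IsClosed (range H) := (isCompact_range hH).isClosed
  suffices y ∈ closure (range H) by rwa [hcl.closure_eq] at this
  rw [Metric.mem_closure_iff]
  intro δ hδ
  obtain ⟨n, h1, h2⟩ := ((Metric.tendstoUniformly_iff.1 hlim (δ / 2) (half_pos hδ)).and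
    (hε.eventually (gt_mem_nhds (half_pos hδ)))).exists
  obtain ⟨z, hz⟩ := (hfε n).1 y
  refine ⟨_, mem_range_self ((h n).symm z), ?_⟩
  have e1 := h1 ((h n).symm z)
  rw [(h n).apply_symm_apply] at e1
  have e2 := dist_triangle_right y (H ((h n).symm z)) (f n z)
  linarith

/-- Suppose that the fibre splits, with `a` and `b` in different parts. Then `h n a` and `h n b`
become close, so an almost geodesic set joining them is small. Its preimage is connected and must
contain a point outside neighbourhoods `U`, `V` of the two parts. Such points stay in a compact set
that misses the fibre, while their images approach `y`. -/
theorem isConnected_preimage_of_limit (hf : IsApproxIsometricSeq f)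
    (hY : ∀ n, IsApproxGeodesic (Y n))
    (hlim : TendstoUniformly (fun n x => f n (h n x)) H atTop) (hH : Continuous H) (y : X) :
    IsConnected (H ⁻¹' {y}) := by
  refine ⟨surjective_of_limit hf hlim hH y, ?_⟩
  have hcl : IsClosed (H ⁻¹' {y}) := isClosed_singleton.preimage hH
  rw [isPreconnected_iff_subset_of_fully_disjoint_closed hcl]
  intro u v hu hv huv hdisj
  by_contra! hcon
  obtain ⟨hnu, hnv⟩ := hcon
  obtain ⟨a, ha, hau⟩ := not_subset.1 hnu
  obtain ⟨b, hb, hbv⟩ := not_subset.1 hnv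
  have hav : a ∈ v := (huv ha).resolve_left hau
  have hbu : b ∈ u := (huv hb).resolve_right hbv
  obtain ⟨U, V, hU, hV, huU, hvV, hUV⟩ := normal_separation hu hv hdisj
  set Z : Set A := (U ∪ V)ᶜ with hZ
  have hZc : IsCompact Z := (hU.union hV).isClosed_compl.isCompact
  have hab := tendsto_dist_of_tendsto hf (fun x => hlim.tendsto_at x) a b
  rw [show H a = y from ha, show H b = y from hb, dist_self] at hab
  have hz : ∀ n, ∃ z ∈ Z, dist (h n a) (h n z) ≤ dist (h n a) (h n b) + 1 / ((n : ℝ) + 1) := by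
    intro n
    obtain ⟨C, hC, haC, hbC, hCd⟩ := hY n (h n a) (h n b) (1 / ((n : ℝ) + 1)) (by positivity)
    have hC' : IsPreconnected (h n ⁻¹' C) := by
      rw [← (h n).image_symm]
      exact hC.image _ (h n).symm.continuous.continuousOn
    by_contra! hno
    have hsub : h n ⁻¹' C ⊆ U ∪ V := by
      intro z hz
      by_contra hzUV
      have e1 := hno z hzUV
      have e2 := hCd _ hz
      have e3 : 0 ≤ dist (h n z) (h n b) := dist_nonneg
      linarith
    obtain ⟨z, -, hzU, hzV⟩ := hC' U V hU hV hsub ⟨b, hbC, huU hbu⟩ ⟨a, haC, hvV hav⟩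
    exact hUV.ne_of_mem hzU hzV rfl
  choose z hzZ hzd using hz
  obtain ⟨x, hxZ, hmin⟩ := hZc.exists_isMinOn ⟨z 0, hzZ 0⟩
    (f := fun x => dist y (H x)) (continuous_const.dist hH).continuousOn
  have hpos : 0 < dist y (H x) := by
    refine dist_pos.2 fun hxy => ?_
    have : x ∈ H ⁻¹' {y} := hxy.symm
    rcases huv this with h' | h'
    · exact hxZ (Or.inl (huU h'))
    · exact hxZ (Or.inr (hvV h'))
  set δ := dist y (H x) with hδ
  obtain ⟨ε, -, hε, hfε⟩ := hf
  -- Five errors occur: uniform convergence at `a` and at `z n`, the distortion of `f n`, the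
  -- distance of `h n a` and `h n b`, and the defect of the almost geodesic set.
  have hδ5 : 0 < δ / 5 := by positivity
  obtain ⟨n, h1, h2, h3, h4⟩ := ((Metric.tendstoUniformly_iff.1 hlim (δ / 5) hδ5).and
    ((hε.eventually (gt_mem_nhds hδ5)).and ((hab.eventually (gt_mem_nhds hδ5)).and
      ((tendsto_one_div_add_atTop_nhds_zero_nat (𝕜 := ℝ)).eventually (gt_mem_nhds hδ5))))).exists
  have e1 := h1 a
  have e2 := h1 (z n)
  have e3 := (hfε n).edist_le (h n a) (h n (z n))
  have e4 := hzd n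
  have e5 : δ ≤ dist y (H (z n)) := hmin (hzZ n)
  have e6 := dist_triangle4 (H a) (f n (h n a)) (f n (h n (z n))) (H (z n))
  rw [show H a = y from ha] at e1 e6
  rw [dist_comm (f n (h n (z n))) (H (z n))] at e6
  linarith

end LimitMap




/-! ### The length–area method -/

/-- The identification of the plane with pairs under the maximum norm is 1-Lipschitz, and for that
norm the unnormalized Hausdorff measure is Lebesgue measure. -/
theorem volume_le_hausdorffMeasure_two (s : Set ℂ) : volume s ≤ μH[2] s := by
  set φ := Complex.measurableEquivPi with hφ
  have hmp : MeasurePreserving φ volume volume := Complex.volume_preserving_equiv_pi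
  have h1 : volume s = volume (φ '' s) := by
    rw [← hmp.measure_preimage_equiv (φ '' s), preimage_image_eq _ φ.injective]
  have hlip : LipschitzWith 1 φ := by
    refine LipschitzWith.of_dist_le_mul fun z w => ?_
    rw [NNReal.coe_one, one_mul, dist_pi_le_iff dist_nonneg]
    intro i
    rw [Complex.dist_eq, Real.dist_eq]
    fin_cases i
    · simpa [hφ, Complex.measurableEquivPi] using Complex.abs_re_le_norm (z - w)
    · simpa [hφ, Complex.measurableEquivPi] using Complex.abs_im_le_norm (z - w)
  have h2 : (volume : Measure (Fin 2 → ℝ)) = μH[2] := by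
    rw [← hausdorffMeasure_pi_real]
    simp
  rw [h1, h2]
  have := (hlip.lipschitzOnWith (s := s)).hausdorffMeasure_image_le (d := 2) (by norm_num)
  simpa using this

/-- The inverse identification is 2-Lipschitz, whence the factor `2 ^ 2`. The constant is crude; the
bound serves to show that areas are finite. -/
theorem hausdorffMeasure_two_le_volume (s : Set ℂ) : μH[2] s ≤ 4 * volume s := by
  set φ := Complex.measurableEquivPi with hφ
  have hmp : MeasurePreserving φ volume volume := Complex.volume_preserving_equiv_pi
  have h1 : volume s = volume (φ '' s) := by
    rw [← hmp.measure_preimage_equiv (φ '' s), preimage_image_eq _ φ.injective]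
  have hlip : LipschitzWith 2 φ.symm := by
    refine LipschitzWith.of_dist_le_mul fun z w => ?_
    have e0 := dist_le_pi_dist z w 0
    have e1 := dist_le_pi_dist z w 1
    rw [Real.dist_eq] at e0 e1
    rw [Complex.dist_eq]
    refine (Complex.norm_le_abs_re_add_abs_im _).trans ?_
    simp only [hφ, Complex.measurableEquivPi, NNReal.coe_ofNat]
    simp only [Homeomorph.toMeasurableEquiv_symm_coe, Complex.sub_re, Complex.sub_im]
    simp
    linarith
  have h2 : (volume : Measure (Fin 2 → ℝ)) = μH[2] := by
    rw [← hausdorffMeasure_pi_real]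
    simp
  rw [h1, h2]
  have := (hlip.lipschitzOnWith (s := φ '' s)).hausdorffMeasure_image_le (d := 2) (by norm_num)
  rw [← image_comp] at this
  simp only [Function.comp_def, MeasurableEquiv.symm_apply_apply, image_id'] at this
  refine this.trans (le_of_eq ?_)
  norm_num

/-- A bi-Lipschitz planar chart `e` centred at `e 0`, defined on a set `D` that meets small circles
around `0` in arcs, and that maps small relative disks to open sets. -/
structure IsPolarChart {A : Type*} [MetricSpace A] (e : ℂ → A) (D : Set ℂ) (R : ℝ) (L : ℝ≥0) :
    Prop where
  pos : 0 < R
  isClosed : IsClosed D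
  zero_mem : (0 : ℂ) ∈ D
  ofReal_mem : ∀ r ∈ Ioo 0 R, (r : ℂ) ∈ D
  arc : ∀ r ∈ Ioo 0 R, ∀ s t : ℝ, |t| ≤ |s| → |s| ≤ Real.pi →
    (r : ℂ) * Complex.exp (s * Complex.I) ∈ D → (r : ℂ) * Complex.exp (t * Complex.I) ∈ D
  lipschitz : LipschitzOnWith L e (D ∩ Metric.closedBall 0 R)
  antilipschitz : ∀ z ∈ D ∩ Metric.closedBall 0 R, ∀ w ∈ D ∩ Metric.closedBall 0 R,
    dist z w ≤ L * dist (e z) (e w)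
  isOpen_image : ∀ r ∈ Ioo 0 R, IsOpen (e '' (D ∩ Metric.ball 0 r))

theorem sq_lintegral_le {α : Type*} [MeasurableSpace α] {μ : Measure α} {f : α → ℝ≥0∞}
    (hf : AEMeasurable f μ) : (∫⁻ x, f x ∂μ) ^ 2 ≤ μ univ * ∫⁻ x, f x ^ 2 ∂μ := by
  have h := ENNReal.lintegral_mul_le_Lp_mul_Lq μ Real.HolderConjugate.two_two
    (aemeasurable_const (b := (1 : ℝ≥0∞))) hf
  simp only [Pi.mul_apply, one_mul, ENNReal.one_rpow, lintegral_const] at h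
  calc (∫⁻ x, f x ∂μ) ^ 2
      ≤ ((μ univ) ^ (1 / 2 : ℝ) * (∫⁻ x, f x ^ (2 : ℝ) ∂μ) ^ (1 / 2 : ℝ)) ^ 2 := by
        gcongr
    _ = _ := by
        rw [mul_pow]
        simp only [← ENNReal.rpow_natCast, ← ENNReal.rpow_mul]
        norm_num

namespace IsPolarChart

variable {A : Type*} [MetricSpace A] {e : ℂ → A} {D : Set ℂ} {R : ℝ} {L : ℝ≥0}

theorem isCompact (he : IsPolarChart e D R L) (r : ℝ) :
    IsCompact (D ∩ Metric.closedBall 0 r) :=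
  (isCompact_closedBall 0 r).inter_left he.isClosed

/-- The inverse of the chart is `L`-Lipschitz, so it enlarges Hausdorff measure at most by `L ^ 2`.
Keeping the factor `π / 4` on the left lets the crude comparison of Lebesgue and unnormalized
Hausdorff measure suffice. -/
theorem setLIntegral_comp_le [MeasurableSpace A] [BorelSpace A] (he : IsPolarChart e D R L)
    {φ : A → ℝ≥0∞} (hφ : Measurable φ) :
    ENNReal.ofReal (Real.pi / 4) * ∫⁻ z in D ∩ Metric.closedBall 0 R, φ (e z) ≤
      (L : ℝ≥0∞) ^ 2 * ∫⁻ x, φ x ∂(hausdorffTwo A) := by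
  set B := D ∩ Metric.closedBall 0 R with hB
  have hBm : MeasurableSet B := (he.isCompact R).measurableSet
  have hem : AEMeasurable e (volume.restrict B) := he.lipschitz.continuousOn.aemeasurable hBm
  rw [← lintegral_map' hφ.aemeasurable hem, ← smul_eq_mul, ← lintegral_smul_measure,
    ← smul_eq_mul ((L : ℝ≥0∞) ^ 2), ← lintegral_smul_measure]
  refine lintegral_mono' (Measure.le_iff.2 fun s hs => ?_) le_rfl
  rw [Measure.smul_apply, Measure.smul_apply, Measure.map_apply_of_aemeasurable hem hs,
    Measure.restrict_apply' hBm, smul_eq_mul, smul_eq_mul, hausdorffTwo, Measure.smul_apply,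
    smul_eq_mul, mul_left_comm]
  gcongr
  set T := e ⁻¹' s ∩ B
  refine (volume_le_hausdorffMeasure_two T).trans ?_
  have hinj : InjOn e B := fun z hz w hw hzw => by
    have := he.antilipschitz z hz w hw
    rw [hzw, dist_self, mul_zero] at this
    exact dist_le_zero.1 this
  have hinv : ∀ z ∈ B, Function.invFunOn e B (e z) = z := fun z hz =>
    hinj.leftInvOn_invFunOn hz
  have hlip : LipschitzOnWith L (Function.invFunOn e B) (e '' T) := by
    apply LipschitzOnWith.of_dist_le_mul
    rintro _ ⟨z, hz, rfl⟩ _ ⟨w, hw, rfl⟩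
    rw [hinv z hz.2, hinv w hw.2]
    exact he.antilipschitz z hz.2 w hw.2
  have h1 := hlip.hausdorffMeasure_image_le (d := 2) (by norm_num)
  have h2 : Function.invFunOn e B '' (e '' T) = T := by
    rw [← image_comp]
    conv_rhs => rw [← image_id T]
    exact image_congr fun z hz => hinv z hz.2
  rw [h2] at h1
  refine h1.trans ?_
  norm_cast
  have h3 : e '' T ⊆ s := by
    rintro _ ⟨z, hz, rfl⟩
    exact hz.1
  exact mul_le_mul_right (measure_mono h3) _

/-- The image of the open disk and the complement of the image of the closed disk are open; a
connected set meeting both sides must meet what remains, the image of the circle. -/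
theorem separates {Y : Type*} [MetricSpace Y] (he : IsPolarChart e D R L) (h : A ≃ₜ Y) {r : ℝ}
    (hr : r ∈ Ioo 0 R) : Separates (h '' (e '' (D ∩ Metric.sphere 0 r)))
      (h '' (e '' (D ∩ Metric.ball 0 r))) := by
  rintro C hC ⟨_, hpC, p, hp, rfl⟩ ⟨q, hqC, hq⟩
  set W : Set A := (e '' (D ∩ Metric.closedBall 0 r))ᶜ
  have hW : IsOpen W := by
    refine (IsCompact.isClosed ?_).isOpen_compl
    exact (he.isCompact r).image_of_continuousOn (he.lipschitz.continuousOn.mono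
      (inter_subset_inter_right _ (Metric.closedBall_subset_closedBall hr.2.le)))
  have hC' : IsPreconnected (h ⁻¹' C) := by
    rw [← h.image_symm]
    exact hC.image _ h.symm.continuous.continuousOn
  by_contra hemp
  have hcov : h ⁻¹' C ⊆ e '' (D ∩ Metric.ball 0 r) ∪ W := by
    intro x hx
    by_cases hxW : x ∈ W
    · exact Or.inr hxW
    obtain ⟨z, hz, rfl⟩ := notMem_compl_iff.1 hxW
    left
    refine ⟨z, ⟨hz.1, ?_⟩, rfl⟩
    have hzr : dist z 0 ≤ r := hz.2
    refine lt_of_le_of_ne hzr fun heq => hemp ?_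
    exact ⟨_, hx, _, ⟨z, ⟨hz.1, heq⟩, rfl⟩, rfl⟩
  have hqx : h.symm q ∈ h ⁻¹' C := by simpa using hqC
  have hq' : h.symm q ∉ e '' (D ∩ Metric.ball 0 r) := fun hmem => hq ⟨_, hmem, by simp⟩
  obtain ⟨x, -, ⟨z, hz, rfl⟩, hx⟩ := hC' _ _ (he.isOpen_image r hr) hW hcov ⟨p, hpC, hp⟩
    ⟨_, hqx, (hcov hqx).resolve_left hq'⟩
  exact hx ⟨z, ⟨hz.1, Metric.ball_subset_closedBall hz.2⟩, rfl⟩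

theorem norm_ofReal_mul_exp {r : ℝ} (hr : 0 ≤ r) (t : ℝ) :
    ‖(r : ℂ) * Complex.exp (t * Complex.I)‖ = r := by
  rw [norm_mul, Complex.norm_exp_ofReal_mul_I, mul_one, Complex.norm_real, Real.norm_of_nonneg hr]

/-- The oscillation of a conformal map along a circular arc is controlled by the energy on the
circle. -/
theorem edist_sq_le {Y : Type*} [MetricSpace Y] [MeasurableSpace A] [BorelSpace A]
    [∀ x : A, (𝓝[≠] x).NeBot] (he : IsPolarChart e D R L) {h : A → Y} {g : A → ℝ≥0} {P : Finset A}
    (hh : IsMetricConformal h g P) {r : ℝ} (hr : r ∈ Ioo 0 R) {p q : A}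
    (hp : p ∈ e '' (D ∩ Metric.sphere 0 r)) (hq : q ∈ e '' (D ∩ Metric.sphere 0 r)) :
    edist (h p) (h q) ^ 2 ≤ (L * ENNReal.ofReal r) ^ 2 * (ENNReal.ofReal (2 * Real.pi) *
      ∫⁻ t in Ioo (-Real.pi) Real.pi, (D ∩ Metric.closedBall 0 R).indicator
        (fun z => (g (e z) : ℝ≥0∞) ^ 2) (r * Complex.exp (t * Complex.I))) := by
  set c : ℝ → ℂ := fun t => r * Complex.exp (t * Complex.I) with hc
  have hcn : ∀ t, ‖c t‖ = r := norm_ofReal_mul_exp hr.1.le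
  have hcB : ∀ t, c t ∈ D → c t ∈ D ∩ Metric.closedBall 0 R := fun t ht =>
    ⟨ht, by rw [mem_closedBall_zero_iff, hcn]; exact hr.2.le⟩
  have harg : ∀ z ∈ Metric.sphere (0 : ℂ) r, c z.arg = z := by
    intro z hz
    rw [mem_sphere_zero_iff_norm] at hz
    simp only [hc, ← hz]
    exact Complex.norm_mul_exp_arg_mul_I z
  have hclip : LipschitzWith (Real.toNNReal r) c := by
    refine LipschitzWith.of_dist_le_mul fun s t => ?_
    rw [Real.coe_toNNReal _ hr.1.le, dist_eq_norm, ← mul_sub, norm_mul, Complex.norm_real,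
      Real.norm_of_nonneg hr.1.le]
    have hs : Complex.exp (s * Complex.I) - Complex.exp (t * Complex.I) =
        Complex.exp (t * Complex.I) * (Complex.exp (Complex.I * ((s - t : ℝ) : ℂ)) - 1) := by
      rw [mul_sub, ← Complex.exp_add]
      congr 2
      · push_cast; ring
      · ring
    rw [hs, norm_mul, Complex.norm_exp_ofReal_mul_I, one_mul, Real.dist_eq]
    exact mul_le_mul_of_nonneg_left (Real.norm_exp_I_mul_ofReal_sub_one_le) hr.1.le
  -- it suffices to consider points in the order of their arguments
  have key : ∀ z ∈ D ∩ Metric.sphere 0 r, ∀ w ∈ D ∩ Metric.sphere 0 r, z.arg ≤ w.arg →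
      edist (h (e z)) (h (e w)) ^ 2 ≤ (L * ENNReal.ofReal r) ^ 2 * (ENNReal.ofReal (2 * Real.pi) *
      ∫⁻ t in Ioo (-Real.pi) Real.pi, (D ∩ Metric.closedBall 0 R).indicator
        (fun z => (g (e z) : ℝ≥0∞) ^ 2) (c t)) := by
    intro z hz w hw hzw
    -- An angle between two others is, in absolute value, at most the larger of the two. As `D` cuts
    -- the circle in an arc symmetric about the positive real axis, the whole arc from `z` to `w`
    -- lies in `D`.
    have hD : ∀ t ∈ Icc z.arg w.arg, c t ∈ D := by
      intro t ht
      rcases le_max_iff.1 (abs_le_max_abs_abs ht.1 ht.2) with h1 | h1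
      · refine he.arc r hr z.arg t h1 (Complex.abs_arg_le_pi z) ?_
        have := harg z hz.2
        simp only [hc] at this
        rw [this]
        exact hz.1
      · refine he.arc r hr w.arg t h1 (Complex.abs_arg_le_pi w) ?_
        have := harg w hw.2
        simp only [hc] at this
        rw [this]
        exact hw.1
    have hlip : LipschitzOnWith (L * Real.toNNReal r) (e ∘ c) (Icc z.arg w.arg) :=
      he.lipschitz.comp hclip.lipschitzOnWith fun t ht => hcB t (hD t ht)
    have h1 := hh.edist_le_lintegral hzw hlip
    simp only [Function.comp, harg z hz.2, harg w hw.2] at h1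
    have hgm : AEMeasurable (fun t => (g (e (c t)) : ℝ≥0∞)) (volume.restrict (Icc z.arg w.arg)) :=
      (hh.measurable.comp_aemeasurable
        (hlip.continuousOn.aemeasurable measurableSet_Icc)).coe_nnreal_ennreal
    have h2 := sq_lintegral_le hgm
    have h3 : (volume.restrict (Icc z.arg w.arg)) univ ≤ ENNReal.ofReal (2 * Real.pi) := by
      rw [Measure.restrict_apply_univ, Real.volume_Icc]
      apply ENNReal.ofReal_le_ofReal
      linarith [Complex.arg_le_pi w, Complex.neg_pi_lt_arg z]
    have h4 : ∫⁻ t in Icc z.arg w.arg, (g (e (c t)) : ℝ≥0∞) ^ 2 ≤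
        ∫⁻ t in Ioo (-Real.pi) Real.pi, (D ∩ Metric.closedBall 0 R).indicator
        (fun z => (g (e z) : ℝ≥0∞) ^ 2) (c t) := by
      rw [setLIntegral_congr (Ioo_ae_eq_Icc (a := -Real.pi) (b := Real.pi))]
      refine le_trans (setLIntegral_mono' measurableSet_Icc fun t ht => ?_) (lintegral_mono_set
        (Icc_subset_Icc (Complex.neg_pi_lt_arg z).le (Complex.arg_le_pi w)))
      rw [indicator_of_mem (hcB t (hD t ht))]
    calc edist (h (e z)) (h (e w)) ^ 2
        ≤ (((L * Real.toNNReal r : ℝ≥0) : ℝ≥0∞) *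
          ∫⁻ t in Icc z.arg w.arg, (g (e (c t)) : ℝ≥0∞)) ^ 2 := by gcongr
      _ ≤ _ := by
        rw [mul_pow, ENNReal.coe_mul]
        refine mul_le_mul' (le_of_eq (by rfl)) (h2.trans (mul_le_mul' h3 h4))
  obtain ⟨z, hz, rfl⟩ := hp
  obtain ⟨w, hw, rfl⟩ := hq
  rcases le_total z.arg w.arg with h1 | h1
  · exact key z hz w hw h1
  · rw [edist_comm]
    exact key w hw z hz h1

/-- The Courant–Lebesgue lemma. -/
theorem ofReal_log_mul_le {Y : Type*} [MetricSpace Y] [MeasurableSpace A] [BorelSpace A]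
    [∀ x : A, (𝓝[≠] x).NeBot] (he : IsPolarChart e D R L) {h : A → Y} {g : A → ℝ≥0} {P : Finset A}
    (hh : IsMetricConformal h g P) {ρ r₀ η : ℝ} (hρ : 0 < ρ) (hρr : ρ ≤ r₀) (hr₀ : r₀ ≤ R)
    (hosc : ∀ r ∈ Ioo ρ r₀, ∃ p ∈ e '' (D ∩ Metric.sphere 0 r),
      ∃ q ∈ e '' (D ∩ Metric.sphere 0 r), η ≤ dist (h p) (h q)) (hη : 0 ≤ η) :
    ENNReal.ofReal (Real.pi / 4) * (ENNReal.ofReal (η ^ 2) * ENNReal.ofReal (Real.log (r₀ / ρ))) ≤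
      (L : ℝ≥0∞) ^ 4 * ENNReal.ofReal (2 * Real.pi) *
        ∫⁻ x, (g x : ℝ≥0∞) ^ 2 ∂(hausdorffTwo A) := by
  set B := D ∩ Metric.closedBall (0 : ℂ) R with hB
  have hBm : MeasurableSet B := (he.isCompact R).measurableSet
  set F : ℂ → ℝ≥0∞ := B.indicator (fun z => (g (e z) : ℝ≥0∞) ^ 2) with hF
  have hFm : Measurable F := by
    refine measurable_of_measurable_union_cover B Bᶜ hBm hBm.compl (by simp) ?_ ?_
    · have : (fun a : B => F a) = fun a : B => (g (e a) : ℝ≥0∞) ^ 2 := by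
        ext a
        rw [hF, indicator_of_mem a.2]
      rw [this]
      refine Measurable.pow_const ?_ 2
      exact (hh.measurable.comp (continuousOn_iff_continuous_domRestrict.1
        he.lipschitz.continuousOn).measurable).coe_nnreal_ennreal
    · have : (fun a : (Bᶜ : Set ℂ) => F a) = fun _ => 0 := by
        ext a
        rw [hF, indicator_of_notMem a.2]
      rw [this]
      exact measurable_const
  -- Oscillation `η` on the circle of radius `r` costs energy at least a multiple of `η ^ 2 / r` per
  -- unit of radius, with `r` as the Jacobian of polar coordinates. Integrating `1 / r` produces the
  -- logarithm.
  have hcircle : ∀ r ∈ Ioo ρ r₀, ENNReal.ofReal (η ^ 2) * ENNReal.ofReal r⁻¹ ≤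
      (L : ℝ≥0∞) ^ 2 * ENNReal.ofReal (2 * Real.pi) *
        ∫⁻ t in Ioo (-Real.pi) Real.pi, ENNReal.ofReal r * F (r * Complex.exp (t * Complex.I)) := by
    intro r hr
    have hr' : r ∈ Ioo 0 R := ⟨hρ.trans hr.1, hr.2.trans_le hr₀⟩
    obtain ⟨p, hp, q, hq, hpq⟩ := hosc r hr
    have h1 := he.edist_sq_le hh hr' hp hq
    have h2 : ENNReal.ofReal (η ^ 2) ≤ edist (h p) (h q) ^ 2 := by
      rw [edist_dist, ← ENNReal.ofReal_pow dist_nonneg]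
      apply ENNReal.ofReal_le_ofReal
      gcongr
    have h3 := (mul_le_mul_left (h2.trans h1) (ENNReal.ofReal r⁻¹))
    refine h3.trans (le_of_eq ?_)
    rw [lintegral_const_mul' _ _ ENNReal.ofReal_ne_top]
    have h4 : ENNReal.ofReal r * ENNReal.ofReal r⁻¹ = 1 := by
      rw [← ENNReal.ofReal_mul hr'.1.le, mul_inv_cancel₀ hr'.1.ne', ENNReal.ofReal_one]
    calc _ = (L : ℝ≥0∞) ^ 2 * ENNReal.ofReal (2 * Real.pi) * (ENNReal.ofReal r *
          (ENNReal.ofReal r * ENNReal.ofReal r⁻¹) *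
          ∫⁻ t in Ioo (-Real.pi) Real.pi, F (r * Complex.exp (t * Complex.I))) := by ring
      _ = _ := by rw [h4, mul_one]
  have hlog : ∫⁻ r in Ioo ρ r₀, ENNReal.ofReal r⁻¹ = ENNReal.ofReal (Real.log (r₀ / ρ)) := by
    have hcont : ContinuousOn (fun r : ℝ => r⁻¹) (Icc ρ r₀) :=
      continuousOn_inv₀.mono fun r hr => (hρ.trans_le hr.1).ne'
    rw [setLIntegral_congr Ioo_ae_eq_Icc, ← ofReal_integral_eq_lintegral_ofReal
      hcont.integrableOn_Icc, integral_Icc_eq_integral_Ioc, ← intervalIntegral.integral_of_le hρr,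
      integral_inv_of_pos hρ (hρ.trans_le hρr)]
    refine (ae_restrict_mem measurableSet_Icc).mono fun r hr => ?_
    exact inv_nonneg.2 (hρ.le.trans hr.1)
  have hpolar : ∫⁻ r in Ioo ρ r₀, ∫⁻ t in Ioo (-Real.pi) Real.pi,
      ENNReal.ofReal r * F (r * Complex.exp (t * Complex.I)) ≤ ∫⁻ z, F z := by
    rw [← Complex.lintegral_comp_polarCoord_symm]
    have hm : Measurable fun p : ℝ × ℝ =>
        ENNReal.ofReal p.1 * F (p.1 * Complex.exp (p.2 * Complex.I)) := by
      refine (ENNReal.measurable_ofReal.comp measurable_fst).mul (hFm.comp ?_)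
      exact Continuous.measurable (by fun_prop)
    have ht : polarCoord.target = Ioi (0 : ℝ) ×ˢ Ioo (-Real.pi) Real.pi := rfl
    rw [ht, Measure.volume_eq_prod, ← Measure.prod_restrict]
    have heq : ∀ p : ℝ × ℝ, ENNReal.ofReal p.1 • F (Complex.polarCoord.symm p) =
        ENNReal.ofReal p.1 * F (p.1 * Complex.exp (p.2 * Complex.I)) := by
      intro p
      rw [Complex.polarCoord_symm_apply, smul_eq_mul, Complex.exp_mul_I,
        Complex.ofReal_cos, Complex.ofReal_sin]
    simp only [heq]
    rw [lintegral_prod _ hm.aemeasurable]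
    exact lintegral_mono_set fun r hr => hρ.trans hr.1
  calc _ = ENNReal.ofReal (Real.pi / 4) *
          ∫⁻ r in Ioo ρ r₀, ENNReal.ofReal (η ^ 2) * ENNReal.ofReal r⁻¹ := by
        rw [lintegral_const_mul' _ _ ENNReal.ofReal_ne_top, hlog]
    _ ≤ ENNReal.ofReal (Real.pi / 4) * ∫⁻ r in Ioo ρ r₀, (L : ℝ≥0∞) ^ 2 *
          ENNReal.ofReal (2 * Real.pi) * ∫⁻ t in Ioo (-Real.pi) Real.pi,
            ENNReal.ofReal r * F (r * Complex.exp (t * Complex.I)) := by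
        exact mul_le_mul_right (setLIntegral_mono' measurableSet_Ioo hcircle) _
    _ ≤ ENNReal.ofReal (Real.pi / 4) * ((L : ℝ≥0∞) ^ 2 * ENNReal.ofReal (2 * Real.pi) *
          ∫⁻ z, F z) := by
        rw [lintegral_const_mul' _ _ (ENNReal.mul_ne_top (by simp) ENNReal.ofReal_ne_top)]
        gcongr
    _ = (L : ℝ≥0∞) ^ 2 * ENNReal.ofReal (2 * Real.pi) * (ENNReal.ofReal (Real.pi / 4) *
          ∫⁻ z in B, (g (e z) : ℝ≥0∞) ^ 2) := by
        rw [hF, lintegral_indicator hBm]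
        ring
    _ ≤ (L : ℝ≥0∞) ^ 2 * ENNReal.ofReal (2 * Real.pi) * ((L : ℝ≥0∞) ^ 2 *
          ∫⁻ x, (g x : ℝ≥0∞) ^ 2 ∂(hausdorffTwo A)) := by
        exact mul_le_mul_right
          (he.setLIntegral_comp_le (hh.measurable.coe_nnreal_ennreal.pow_const 2)) _
    _ = _ := by ring

end IsPolarChart

/-- Asymptotic equicontinuity of normalized conformal maps of bounded energy. -/
theorem exists_nhds_dist_le_of_polarChart {A X : Type*} [MetricSpace A] [MeasurableSpace A]
    [BorelSpace A] [∀ x : A, (𝓝[≠] x).NeBot] [MetricSpace X] [CompactSpace X]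
    {Y : ℕ → Type*} [∀ n, MetricSpace (Y n)] {f : ∀ n, Y n → X} {h : ∀ n, A ≃ₜ Y n}
    {g : ℕ → A → ℝ≥0} {P : ℕ → Finset A}
    (hX : ∀ p : X, IsPreconnected ({p}ᶜ : Set X)) (hf : IsApproxIsometricSeq f)
    (hY : ∀ n, IsApproxGeodesic (Y n)) (hconf : ∀ n, IsMetricConformal (h n) (g n) (P n))
    {M : ℝ≥0∞} (hM : M ≠ ∞) (hgM : ∀ n, ∫⁻ x, (g n x : ℝ≥0∞) ^ 2 ∂(hausdorffTwo A) ≤ M)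
    (hnorm : IsNormalizedSeq (fun n => (h n : A → Y n)))
    {e : ℂ → A} {D : Set ℂ} {R : ℝ} {L : ℝ≥0} (he : IsPolarChart e D R L) {ε : ℝ} (hε : 0 < ε) :
    ∃ V ∈ 𝓝 (e 0), ∃ N, ∀ n ≥ N, ∀ y ∈ V, dist (h n y) (h n (e 0)) ≤ ε := by
  obtain ⟨δ, hδ, a, b, c, habc⟩ := hnorm
  obtain ⟨η, hη, N, hN⟩ := exists_forall_separates hX hf hY
    (lt_min hε (half_pos hδ))
  -- The disk of radius `r₀` has an image of diameter less than `δ`, so it contains at most one of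
  -- the three normalizing points.
  obtain ⟨r₀, hr₀, hr₀R, hr₀δ⟩ : ∃ r₀ > 0, r₀ < R ∧ L * (2 * r₀) < δ := by
    refine ⟨min (R / 2) (δ / (4 * (L + 1))), lt_min (half_pos he.pos) (by positivity),
      (min_le_left _ _).trans_lt (half_lt_self he.pos), ?_⟩
    calc (L : ℝ) * (2 * min (R / 2) (δ / (4 * (L + 1)))) ≤ L * (2 * (δ / (4 * (L + 1)))) := by
          gcongr; exact min_le_right _ _
      _ = (L / (L + 1)) * (δ / 2) := by field_simp; ring
      _ ≤ 1 * (δ / 2) := by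
          gcongr
          rw [div_le_one (by positivity)]
          linarith
      _ < δ := by linarith
  set E : ℝ≥0∞ := (L : ℝ≥0∞) ^ 4 * ENNReal.ofReal (2 * Real.pi) * M with hE
  have hEt : E ≠ ∞ := ENNReal.mul_ne_top (ENNReal.mul_ne_top (ENNReal.pow_ne_top
    ENNReal.coe_ne_top) ENNReal.ofReal_ne_top) hM
  -- If the oscillation were at least `η` on all circles of radius between `r₀ * exp (-T)` and `r₀`,
  -- the energy inequality would read `E + 1 ≤ E`. The choice does not depend on `n`.
  set T : ℝ := (E.toReal + 1) / (Real.pi / 4 * η ^ 2) with hT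
  have hT0 : 0 < T := by positivity
  set ρ := r₀ * Real.exp (-T) with hρdef
  have hρ : 0 < ρ := by positivity
  have hρr : ρ < r₀ := by
    rw [hρdef]
    exact mul_lt_of_lt_one_right hr₀ (Real.exp_lt_one_iff.2 (by linarith))
  have hlogT : Real.log (r₀ / ρ) = T := by
    rw [hρdef, div_mul_cancel_left₀ hr₀.ne', ← Real.exp_neg, neg_neg, Real.log_exp]
  refine ⟨e '' (D ∩ Metric.ball 0 ρ), (he.isOpen_image ρ ⟨hρ, hρr.trans hr₀R⟩).mem_nhds
    ⟨0, ⟨he.zero_mem, Metric.mem_ball_self hρ⟩, rfl⟩, N, fun n hn y hy => ?_⟩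
  obtain ⟨r, hr, hrη⟩ : ∃ r ∈ Ioo ρ r₀, ∀ p ∈ e '' (D ∩ Metric.sphere 0 r),
      ∀ q ∈ e '' (D ∩ Metric.sphere 0 r), dist (h n p) (h n q) < η := by
    by_contra! hcon
    have h1 := he.ofReal_log_mul_le (hconf n) hρ hρr.le hr₀R.le hcon hη.le
    rw [hlogT, ← ENNReal.ofReal_mul (by positivity), ← ENNReal.ofReal_mul (by positivity)] at h1
    have h2 : ENNReal.ofReal (Real.pi / 4 * (η ^ 2 * T)) ≤ E :=
      h1.trans (mul_le_mul_right (hgM n) _)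
    have h3 : Real.pi / 4 * (η ^ 2 * T) = E.toReal + 1 := by
      rw [hT]; field_simp
    rw [h3, ENNReal.ofReal_le_iff_le_toReal hEt] at h2
    linarith
  have hrR : r ∈ Ioo 0 R := ⟨hρ.trans hr.1, hr.2.trans hr₀R⟩
  set U := e '' (D ∩ Metric.ball 0 r) with hU
  have hUd : ∀ x ∈ U, ∀ z ∈ U, dist x z < δ := by
    rintro _ ⟨z, hz, rfl⟩ _ ⟨w, hw, rfl⟩
    have hmem : ∀ z ∈ D ∩ Metric.ball 0 r, z ∈ D ∩ Metric.closedBall 0 R := fun z hz =>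
      ⟨hz.1, Metric.ball_subset_closedBall (Metric.ball_subset_ball hrR.2.le hz.2)⟩
    have h1 := he.lipschitz.dist_le_mul z (hmem z hz) w (hmem w hw)
    have h2 : dist z w ≤ 2 * r₀ := by
      have e1 : dist z 0 < r := hz.2
      have e2 : dist w 0 < r := hw.2
      linarith [dist_triangle_right z w 0, hr.2]
    exact (h1.trans (mul_le_mul_of_nonneg_left h2 L.2)).trans_lt hr₀δ
  have hsep := hN n hn _ _ (he.separates (h n) hrR)
    ⟨_, mem_image_of_mem _ (mem_image_of_mem _
      ⟨he.ofReal_mem r hrR, by simp [abs_of_pos hrR.1]⟩)⟩ (by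
    rintro _ ⟨p, hp, rfl⟩ _ ⟨q, hq, rfl⟩
    exact (hrη p hp q hq).le)
  rcases hsep with h1 | h1
  · refine (h1 _ (mem_image_of_mem _ ?_) _ (mem_image_of_mem _ ?_)).trans (min_le_left _ _)
    · obtain ⟨z, hz, rfl⟩ := hy
      exact ⟨z, ⟨hz.1, Metric.ball_subset_ball hr.1.le hz.2⟩, rfl⟩
    · exact ⟨0, ⟨he.zero_mem, Metric.mem_ball_self hrR.1⟩, rfl⟩
  -- If the complement of the disk had a small image, at most one normalizing point could lie
  -- outside the disk, because the images are `δ` apart. But at most one lies inside, and there are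
  -- three.
  · exfalso
    have hfar : ∀ x z, δ ≤ dist (h n x) (h n z) → x ∈ U ∨ z ∈ U := by
      intro x z hxz
      by_contra! hcon
      have := h1 (h n x) (fun hx => hcon.1 ((h n).injective.mem_set_image.1 hx)) (h n z)
        (fun hx => hcon.2 ((h n).injective.mem_set_image.1 hx))
      have := this.trans (min_le_right _ _)
      linarith
    have hnear : ∀ x z, δ ≤ dist x z → ¬ (x ∈ U ∧ z ∈ U) := fun x z hxz hmem =>
      absurd (hUd x hmem.1 z hmem.2) (not_lt.2 hxz)
    obtain ⟨⟨d1, d2, d3⟩, d4, d5, d6⟩ := habc n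
    have k1 := hfar _ _ d4
    have k2 := hfar _ _ d5
    have k3 := hfar _ _ d6
    have k4 := hnear _ _ d1
    have k5 := hnear _ _ d2
    have k6 := hnear _ _ d3
    tauto




/-! ### The geometry of the model surfaces -/

/-- With tolerance `lam / 2`, a positive metric derivative at the origin makes `e` bi-Lipschitz
nearby; the conditions on circles are void for the full plane. -/
theorem IsPolarChart.exists_of_hasMetricDeriv {A : Type*} [MetricSpace A] {e : ℂ → A} {lam : ℝ}
    (hlam : 0 < lam) (he : HasMetricDeriv e lam (𝓝 0))
    (hopen : ∀ r, IsOpen (e '' Metric.ball 0 r)) : ∃ R L, IsPolarChart e univ R L := by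
  obtain ⟨R, hR, hRe⟩ : ∃ R > 0, ∀ z ∈ Metric.closedBall (0 : ℂ) R,
      ∀ w ∈ Metric.closedBall (0 : ℂ) R,
      |dist (e z) (e w) - lam * dist z w| ≤ lam / 2 * dist z w := by
    have h1 := he (lam / 2) (half_pos hlam)
    rw [← nhds_prod_eq] at h1
    obtain ⟨R, hR, hsub⟩ := Metric.nhds_basis_closedBall.eventually_iff.1 h1
    refine ⟨R, hR, fun z hz w hw => hsub (x := (z, w)) ?_⟩
    rw [← closedBall_prod_same]
    exact ⟨hz, hw⟩
  refine ⟨R, ⟨max (2 * lam) (2 / lam), by positivity⟩, hR, isClosed_univ, mem_univ _,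
    fun _ _ => mem_univ _, fun _ _ _ _ _ _ _ => mem_univ _, ?_, ?_, fun r _ => by
      rw [univ_inter]; exact hopen r⟩
  · refine LipschitzOnWith.of_dist_le_mul fun z hz w hw => ?_
    have h1 := abs_le.1 (hRe z hz.2 w hw.2)
    have h2 : (2 * lam) * dist z w ≤ max (2 * lam) (2 / lam) * dist z w := by
      gcongr; exact le_max_left _ _
    have h3 := mul_nonneg hlam.le (dist_nonneg (x := z) (y := w))
    change dist (e z) (e w) ≤ max (2 * lam) (2 / lam) * dist z w
    linarith
  · intro z hz w hw
    have h1 := abs_le.1 (hRe z hz.2 w hw.2)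
    have h2 : (2 / lam) * dist (e z) (e w) ≤ max (2 * lam) (2 / lam) * dist (e z) (e w) := by
      gcongr; exact le_max_right _ _
    change dist z w ≤ max (2 * lam) (2 / lam) * dist (e z) (e w)
    refine le_trans ?_ h2
    rw [div_mul_eq_mul_div, le_div_iff₀ hlam]
    linarith

theorem IsPolarChart.isometry_comp {A B : Type*} [MetricSpace A] [MetricSpace B] {e : ℂ → A}
    {D : Set ℂ} {R : ℝ} {L : ℝ≥0} (he : IsPolarChart e D R L) (φ : A ≃ᵢ B) :
    IsPolarChart (φ ∘ e) D R L where
  pos := he.pos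
  isClosed := he.isClosed
  zero_mem := he.zero_mem
  ofReal_mem := he.ofReal_mem
  arc := he.arc
  lipschitz := by
    have := (φ.isometry.lipschitz.lipschitzOnWith (s := univ)).comp he.lipschitz (mapsTo_univ _ _)
    rwa [one_mul] at this
  antilipschitz z hz w hw := by
    rw [Function.comp, Function.comp, φ.isometry.dist_eq]
    exact he.antilipschitz z hz w hw
  isOpen_image r hr := by
    rw [image_comp]
    exact φ.toHomeomorph.isOpenMap _ (he.isOpen_image r hr)

/-! ### The sphere. -/

namespace RiemannSphere

/-- A chord of the unit sphere is twice the sine of half the angle it subtends. -/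
theorem sin_half_dist (p q : RiemannSphere) :
    Real.sin (dist p q / 2) = ‖toR3 p - toR3 q‖ / 2 := by
  have h0 : 0 ≤ Real.sin (dist p q / 2) :=
    Real.sin_nonneg_of_nonneg_of_le_pi (by positivity) (by
      have := InnerProductGeometry.angle_le_pi (toR3 p) (toR3 q)
      change dist p q ≤ _ at this
      linarith [Real.pi_pos])
  have h1 : ‖toR3 p - toR3 q‖ ^ 2 = 2 - 2 * Real.cos (dist p q) := by
    have hc : Real.cos (dist p q) = inner ℝ (toR3 p) (toR3 q) := by
      have := InnerProductGeometry.cos_angle (toR3 p) (toR3 q)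
      rw [norm_toR3, norm_toR3, mul_one, div_one] at this
      exact this
    rw [norm_sub_sq_real, norm_toR3, norm_toR3, hc]
    ring
  have h2 : Real.cos (dist p q) = 1 - 2 * Real.sin (dist p q / 2) ^ 2 := by
    have := Real.cos_two_mul (dist p q / 2)
    rw [mul_div_cancel₀ _ (two_ne_zero), Real.cos_sq'] at this
    rw [this]; ring
  have h3 : (‖toR3 p - toR3 q‖ / 2) ^ 2 = Real.sin (dist p q / 2) ^ 2 := by
    rw [div_pow, h1, h2]; ring
  exact ((pow_left_inj₀ (by positivity) h0 two_ne_zero).1 h3).symm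

theorem dist_eq_arcsin (p q : RiemannSphere) :
    dist p q = 2 * Real.arcsin (‖toR3 p - toR3 q‖ / 2) := by
  have h1 : dist p q ≤ Real.pi := InnerProductGeometry.angle_le_pi (toR3 p) (toR3 q)
  rw [← sin_half_dist, Real.arcsin_sin]
  · ring
  · linarith [Real.pi_pos, dist_nonneg (x := p) (y := q)]
  · linarith

theorem norm_toR3_sub (z w : ℂ) :
    ‖toR3 (ofComplex z) - toR3 (ofComplex w)‖ / 2 =
      ‖z - w‖ / √((1 + ‖z‖ ^ 2) * (1 + ‖w‖ ^ 2)) := by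
  have hz : (0 : ℝ) < 1 + ‖z‖ ^ 2 := by positivity
  have hw : (0 : ℝ) < 1 + ‖w‖ ^ 2 := by positivity
  rw [← pow_left_inj₀ (by positivity) (by positivity) two_ne_zero, div_pow, div_pow,
    Real.sq_sqrt (by positivity), EuclideanSpace.norm_sq_eq]
  have e1 : ∀ u : ℂ, ‖u‖ ^ 2 = u.re ^ 2 + u.im ^ 2 := fun u => by
    rw [Complex.sq_norm, Complex.normSq_apply]; ring
  change (∑ i, ‖((toR3 (some z) - toR3 (some w) : EuclideanSpace ℝ (Fin 3)) i)‖ ^ 2) / 2 ^ 2 = _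
  rw [Fin.sum_univ_three]
  simp only [toR3, Real.norm_eq_abs, sq_abs, PiLp.sub_apply]
  rw [e1] at hz hw
  simp only [e1]
  simp
  field_simp
  ring

theorem dist_ofComplex (z w : ℂ) : dist (ofComplex z) (ofComplex w) =
    2 * Real.arcsin (‖z - w‖ / √((1 + ‖z‖ ^ 2) * (1 + ‖w‖ ^ 2))) := by
  rw [dist_eq_arcsin, norm_toR3_sub]

/-- Jordan's inequality bounds the angle by `π` times half the chord, and half the chord is at most
the planar distance. -/
theorem lipschitzWith_ofComplex : LipschitzWith ⟨Real.pi, Real.pi_pos.le⟩ ofComplex := by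
  refine LipschitzWith.of_dist_le_mul fun z w => ?_
  change dist (ofComplex z) (ofComplex w) ≤ Real.pi * dist z w
  have h1 : dist (ofComplex z) (ofComplex w) ≤ Real.pi :=
    InnerProductGeometry.angle_le_pi _ _
  have h2 := Real.mul_le_sin (x := dist (ofComplex z) (ofComplex w) / 2) (by positivity)
    (by linarith)
  rw [sin_half_dist, norm_toR3_sub] at h2
  have h3 : ‖z - w‖ / √((1 + ‖z‖ ^ 2) * (1 + ‖w‖ ^ 2)) ≤ dist z w := by
    rw [dist_eq_norm]
    refine div_le_self (norm_nonneg _) (Real.one_le_sqrt.2 ?_)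
    nlinarith [sq_nonneg ‖z‖, sq_nonneg ‖w‖, mul_nonneg (sq_nonneg ‖z‖) (sq_nonneg ‖w‖)]
  have h4 := h2.trans h3
  have hpi := Real.pi_pos
  have h5 : 2 / Real.pi * (dist (ofComplex z) (ofComplex w) / 2) =
    dist (ofComplex z) (ofComplex w) / Real.pi := by ring
  rw [h5, div_le_iff₀ hpi] at h4
  linarith

/-- For small distances arcsine may be replaced by the identity, and the denominator of the chordal
distance tends to its value at `w` as both points do. -/
theorem hasMetricDeriv_ofComplex (w : ℂ) :
    HasMetricDeriv ofComplex (2 / (1 + ‖w‖ ^ 2)) (𝓝 w) := by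
  intro ε hε
  rw [← nhds_prod_eq]
  have hs : HasDerivAt Real.arcsin 1 0 := by
    have := Real.hasDerivAt_arcsin (x := 0) (by norm_num) (by norm_num)
    simpa using this
  have hs' := (hasDerivAt_iff_isLittleO.1 hs).def (c := ε / 4) (by positivity)
  have hc : Continuous fun p : ℂ × ℂ => ‖p.1 - p.2‖ / √((1 + ‖p.1‖ ^ 2) * (1 + ‖p.2‖ ^ 2)) := by
    refine Continuous.div (by fun_prop) (by fun_prop) fun p => ?_
    have : (0 : ℝ) < (1 + ‖p.1‖ ^ 2) * (1 + ‖p.2‖ ^ 2) := by positivity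
    exact (Real.sqrt_pos.2 this).ne'
  have hc2 : Continuous fun p : ℂ × ℂ => 2 / √((1 + ‖p.1‖ ^ 2) * (1 + ‖p.2‖ ^ 2)) := by
    refine Continuous.div (by fun_prop) (by fun_prop) fun p => ?_
    have : (0 : ℝ) < (1 + ‖p.1‖ ^ 2) * (1 + ‖p.2‖ ^ 2) := by positivity
    exact (Real.sqrt_pos.2 this).ne'
  have t1 : Tendsto (fun p : ℂ × ℂ => ‖p.1 - p.2‖ / √((1 + ‖p.1‖ ^ 2) * (1 + ‖p.2‖ ^ 2)))
      (𝓝 (w, w)) (𝓝 0) := by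
    have := hc.tendsto (w, w)
    simpa using this
  have t2 : Tendsto (fun p : ℂ × ℂ => 2 / √((1 + ‖p.1‖ ^ 2) * (1 + ‖p.2‖ ^ 2)))
      (𝓝 (w, w)) (𝓝 (2 / (1 + ‖w‖ ^ 2))) := by
    have := hc2.tendsto (w, w)
    simp only at this
    rwa [Real.sqrt_mul_self (by positivity)] at this
  filter_upwards [t1.eventually hs', Metric.tendsto_nhds.1 t2 (ε / 2) (half_pos hε)] with p h1 h2
  rw [dist_ofComplex]
  set c := √((1 + ‖p.1‖ ^ 2) * (1 + ‖p.2‖ ^ 2)) with hcdef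
  have hc1 : 1 ≤ c := by
    rw [hcdef, Real.one_le_sqrt]
    nlinarith [sq_nonneg ‖p.1‖, sq_nonneg ‖p.2‖, mul_nonneg (sq_nonneg ‖p.1‖) (sq_nonneg ‖p.2‖)]
  have hle : ‖p.1 - p.2‖ / c ≤ ‖p.1 - p.2‖ := div_le_self (norm_nonneg _) hc1
  rw [Real.arcsin_zero] at h1
  simp only [sub_zero, smul_eq_mul, mul_one, Real.norm_eq_abs] at h1
  rw [abs_of_nonneg (a := ‖p.1 - p.2‖ / c) (by positivity)] at h1
  rw [Real.dist_eq] at h2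
  rw [dist_eq_norm]
  have h3 : |(2 / c - 2 / (1 + ‖w‖ ^ 2)) * ‖p.1 - p.2‖| ≤ ε / 2 * ‖p.1 - p.2‖ := by
    rw [abs_mul, abs_of_nonneg (norm_nonneg (p.1 - p.2))]
    exact mul_le_mul_of_nonneg_right h2.le (norm_nonneg _)
  have h4 : 2 * Real.arcsin (‖p.1 - p.2‖ / c) - 2 / (1 + ‖w‖ ^ 2) * ‖p.1 - p.2‖ =
      2 * (Real.arcsin (‖p.1 - p.2‖ / c) - ‖p.1 - p.2‖ / c) +
        (2 / c - 2 / (1 + ‖w‖ ^ 2)) * ‖p.1 - p.2‖ := by ring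
  rw [h4]
  refine (abs_add_le _ _).trans ?_
  rw [abs_mul, abs_two]
  have h5 : ε / 4 * (‖p.1 - p.2‖ / c) ≤ ε / 4 * ‖p.1 - p.2‖ := by gcongr
  linarith

/-- The rotation `z ↦ 1 / z` of the sphere. -/
def inversion : RiemannSphere → RiemannSphere
  | none => ofComplex 0
  | some z => ofComplexInv z

/-- In space, inversion is the half turn about the first axis; this is why it is an isometry. -/
theorem toR3_inversion (p : RiemannSphere) :
    toR3 (inversion p) = !₂[toR3 p 0, -toR3 p 1, -toR3 p 2] := by
  rcases p with _ | z
  · change toR3 (some 0) = _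
    ext i
    fin_cases i <;> simp [toR3]
  · change toR3 (ofComplexInv z) = _
    by_cases hz : z = 0
    · subst hz
      have : ofComplexInv 0 = none := if_pos rfl
      rw [this]
      ext i
      fin_cases i <;> simp [toR3]
    · have : ofComplexInv z = some z⁻¹ := if_neg hz
      rw [this]
      have hn : ‖z‖ ^ 2 = z.re ^ 2 + z.im ^ 2 := by
        rw [Complex.sq_norm, Complex.normSq_apply]; ring
      have hns : Complex.normSq z = z.re ^ 2 + z.im ^ 2 := by rw [Complex.normSq_apply]; ring
      have h0 : 0 < z.re ^ 2 + z.im ^ 2 := by rw [← hns]; exact Complex.normSq_pos.2 hz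
      have h1 : 1 + (z.re ^ 2 + z.im ^ 2) ≠ 0 := by positivity
      have h2 : (z.re ^ 2 + z.im ^ 2) + 1 ≠ 0 := by positivity
      ext i
      fin_cases i <;>
        simp [toR3, Complex.inv_re, Complex.inv_im, norm_inv, inv_pow, hn, hns] <;>
        field_simp <;> ring

theorem isometry_inversion : Isometry inversion := by
  refine Isometry.of_dist_eq fun p q => ?_
  change InnerProductGeometry.angle _ _ = InnerProductGeometry.angle _ _
  unfold InnerProductGeometry.angle
  rw [norm_toR3, norm_toR3, norm_toR3, norm_toR3, toR3_inversion, toR3_inversion]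
  congr 2
  simp [EuclideanSpace.inner_eq_star_dotProduct, dotProduct, Fin.sum_univ_three]

theorem inversion_inversion (p : RiemannSphere) : inversion (inversion p) = p := by
  apply toR3_injective
  rw [toR3_inversion, toR3_inversion]
  ext i
  fin_cases i <;> simp

/-- Inversion as an isometric equivalence. -/
def inversionEquiv : RiemannSphere ≃ᵢ RiemannSphere where
  toFun := inversion
  invFun := inversion
  left_inv := inversion_inversion
  right_inv := inversion_inversion
  isometry_toFun := isometry_inversion

theorem inversionEquiv_comp_ofComplex : inversionEquiv ∘ ofComplex = ofComplexInv := rfl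

theorem ofComplexInv_zero : ofComplexInv 0 = (OnePoint.infty : OnePoint ℂ) := if_pos rfl

theorem ofComplexInv_of_ne {z : ℂ} (hz : z ≠ 0) : ofComplexInv z = ofComplex z⁻¹ := if_neg hz

theorem tendsto_ofComplex_cocompact :
    Tendsto ofComplex (cocompact ℂ) (𝓝 (ofComplexInv 0)) := by
  have h1 : Continuous ofComplexInv := by
    rw [← inversionEquiv_comp_ofComplex]
    exact inversionEquiv.continuous.comp lipschitzWith_ofComplex.continuous
  refine ((h1.tendsto 0).comp (tendsto_inv₀_cobounded (α := ℂ) |>.mono_left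
    (Metric.cobounded_eq_cocompact (α := ℂ)).ge)).congr' ?_
  filter_upwards [(isCompact_singleton (x := (0 : ℂ))).compl_mem_cocompact] with z hz
  change ofComplexInv z⁻¹ = _
  rw [ofComplexInv_of_ne (inv_ne_zero hz), inv_inv]

/-- The sphere with the spherical metric is the one-point compactification of the plane. -/
def onePointHomeomorph : OnePoint ℂ ≃ₜ RiemannSphere :=
  Continuous.homeoOfEquivCompactToT2 (f := Equiv.refl (OnePoint ℂ)) (Y := RiemannSphere) (by
    refine OnePoint.continuous_iff _ |>.2 ⟨?_, lipschitzWith_ofComplex.continuous⟩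
    have h1 := tendsto_ofComplex_cocompact
    rw [ofComplexInv_zero] at h1
    rw [coclosedCompact_eq_cocompact]
    exact h1)

instance : CompactSpace RiemannSphere := onePointHomeomorph.compactSpace

instance : ConnectedSpace RiemannSphere :=
  onePointHomeomorph.surjective.connectedSpace onePointHomeomorph.continuous

instance : Nontrivial RiemannSphere := inferInstanceAs (Nontrivial (OnePoint ℂ))

theorem isOpenEmbedding_ofComplex : IsOpenEmbedding ofComplex :=
  onePointHomeomorph.isOpenEmbedding.comp OnePoint.isOpenEmbedding_coe

theorem compl_singleton_ofComplexInv_zero :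
    ({ofComplexInv 0}ᶜ : Set RiemannSphere) = range ofComplex := by
  rw [ofComplexInv_zero]
  exact OnePoint.compl_infty (X := ℂ)

theorem exists_eq_ofComplex_or (p : RiemannSphere) :
    (∃ z, p = ofComplex z) ∨ p = ofComplexInv 0 := by
  by_cases hp : p = ofComplexInv 0
  · exact Or.inr hp
  · have h1 : p ∈ ({ofComplexInv 0}ᶜ : Set RiemannSphere) := hp
    rw [compl_singleton_ofComplexInv_zero] at h1
    obtain ⟨z, hz⟩ := h1
    exact Or.inl ⟨z, hz.symm⟩

/-- A punctured plane is connected, and the point at infinity lies in its closure. -/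
theorem isPreconnected_compl_singleton (p : RiemannSphere) :
    IsPreconnected ({p}ᶜ : Set RiemannSphere) := by
  rcases exists_eq_ofComplex_or p with ⟨z, rfl⟩ | rfl
  · have h1 : IsPreconnected (ofComplex '' {z}ᶜ) :=
      (isConnected_compl_singleton_of_one_lt_rank (by simp [Complex.rank_real_complex]) z
        ).isPreconnected.image _ lipschitzWith_ofComplex.continuous.continuousOn
    refine h1.subset_closure ?_ ?_
    · rintro _ ⟨w, hw, rfl⟩ h
      exact hw (isOpenEmbedding_ofComplex.injective h)
    · intro q hq
      rcases exists_eq_ofComplex_or q with ⟨w, rfl⟩ | rfl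
      · exact subset_closure ⟨w, fun h => hq (congrArg ofComplex h), rfl⟩
      · refine mem_closure_of_tendsto tendsto_ofComplex_cocompact ?_
        filter_upwards [(isCompact_singleton (x := z)).compl_mem_cocompact] with w hw
        exact ⟨w, hw, rfl⟩
  · rw [compl_singleton_ofComplexInv_zero]
    exact isPreconnected_range lipschitzWith_ofComplex.continuous

theorem exists_polarChart (p : RiemannSphere) :
    ∃ e D R L, IsPolarChart e D R L ∧ e 0 = p := by
  have key : ∀ w, ∃ R L, IsPolarChart (fun z => ofComplex (w + z)) univ R L := fun w => by
    refine IsPolarChart.exists_of_hasMetricDeriv (lam := 2 / (1 + ‖w‖ ^ 2)) (by positivity) ?_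
      fun r => ?_
    · intro ε hε
      have h1 := hasMetricDeriv_ofComplex w ε hε
      rw [← nhds_prod_eq] at h1 ⊢
      have h2 : Tendsto (fun p : ℂ × ℂ => (w + p.1, w + p.2)) (𝓝 (0, 0)) (𝓝 (w, w)) := by
        have : Continuous fun p : ℂ × ℂ => (w + p.1, w + p.2) := by fun_prop
        simpa using this.tendsto (0, 0)
      filter_upwards [h2.eventually h1] with q hq
      simpa using hq
    · have := isOpenEmbedding_ofComplex.isOpenMap _
        ((Homeomorph.addLeft w).isOpenMap _ (Metric.isOpen_ball (x := (0 : ℂ)) (ε := r)))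
      rwa [← image_comp] at this
  rcases exists_eq_ofComplex_or p with ⟨z, rfl⟩ | rfl
  · obtain ⟨R, L, h⟩ := key z
    exact ⟨_, _, R, L, h, by simp⟩
  · obtain ⟨R, L, h⟩ := key 0
    exact ⟨_, _, R, L, h.isometry_comp inversionEquiv, by
      simp only [Function.comp, add_zero]; rfl⟩

end RiemannSphere

/-! ### The closed disk. -/

theorem diskOfComplex_of_mem {z : ℂ} (hz : z ∈ Metric.closedBall (0 : ℂ) 1) :
    ModelSurface.diskOfComplex z = ⟨z, hz⟩ := dif_pos hz

theorem dist_diskOfComplex {z w : ℂ} (hz : z ∈ Metric.closedBall (0 : ℂ) 1)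
    (hw : w ∈ Metric.closedBall (0 : ℂ) 1) :
    dist (ModelSurface.diskOfComplex z) (ModelSurface.diskOfComplex w) = dist z w := by
  rw [diskOfComplex_of_mem hz, diskOfComplex_of_mem hw, Subtype.dist_eq]

theorem diskOfComplex_image (s : Set ℂ) :
    ModelSurface.diskOfComplex '' (s ∩ Metric.closedBall 0 1) = Subtype.val ⁻¹' s := by
  ext p
  constructor
  · rintro ⟨z, ⟨hz, hz1⟩, rfl⟩
    rw [diskOfComplex_of_mem hz1]
    exact hz
  · intro hp
    exact ⟨p, ⟨hp, p.2⟩, diskOfComplex_of_mem p.2⟩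

namespace ClosedDisk

/-- For an interior point `p`, radial retraction maps the punctured plane onto the punctured disk.
For a boundary point, the set lies between the open disk and its closure. -/
theorem isPreconnected_compl_singleton (p : Metric.closedBall (0 : ℂ) 1) :
    IsPreconnected ({p}ᶜ : Set (Metric.closedBall (0 : ℂ) 1)) := by
  rw [← Topology.IsInducing.subtypeVal.isPreconnected_image]
  have him : Subtype.val '' ({p}ᶜ : Set (Metric.closedBall (0 : ℂ) 1)) =
      Metric.closedBall (0 : ℂ) 1 \ {p.1} := by
    ext z
    constructor
    · rintro ⟨q, hq, rfl⟩
      exact ⟨q.2, fun h => hq (Subtype.ext h)⟩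
    · rintro ⟨hz, hzp⟩
      exact ⟨⟨z, hz⟩, fun h => hzp (congrArg Subtype.val h), rfl⟩
  rw [him]
  by_cases hp : ‖p.1‖ < 1
  · have hc : Continuous fun z : ℂ => ((max 1 ‖z‖)⁻¹ : ℝ) • z := by
      refine Continuous.smul (Continuous.inv₀ (continuous_const.max continuous_norm) fun z => ?_)
        continuous_id
      exact (zero_lt_one.trans_le (le_max_left _ _)).ne'
    convert (isConnected_compl_singleton_of_one_lt_rank (by simp [Complex.rank_real_complex])
      p.1).isPreconnected.image _ hc.continuousOn using 1
    ext z
    constructor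
    · rintro ⟨hz, hzp⟩
      refine ⟨z, hzp, ?_⟩
      have : ‖z‖ ≤ 1 := by simpa using hz
      simp [max_eq_left this]
    · rintro ⟨w, hw, rfl⟩
      have h0 : 0 < max 1 ‖w‖ := zero_lt_one.trans_le (le_max_left _ _)
      have hn : ‖((max 1 ‖w‖)⁻¹ : ℝ) • w‖ = ‖w‖ / max 1 ‖w‖ := by
        rw [norm_smul, norm_inv, Real.norm_of_nonneg h0.le, inv_mul_eq_div]
      refine ⟨?_, fun h => ?_⟩
      · rw [mem_closedBall_zero_iff, hn, div_le_one h0]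
        exact le_max_right _ _
      · rw [mem_singleton_iff] at h
        simp only at h hn
        rcases le_total ‖w‖ 1 with h1 | h1
        · rw [max_eq_left h1, inv_one, one_smul] at h
          exact hw h
        · rw [← h, hn, max_eq_right h1, div_self (by linarith)] at hp
          exact lt_irrefl _ hp
  · have h1 : IsPreconnected (Metric.ball (0 : ℂ) 1) := (convex_ball _ _).isPreconnected
    refine h1.subset_closure ?_ ?_
    · intro z hz
      refine ⟨Metric.ball_subset_closedBall hz, fun h => hp ?_⟩
      rw [mem_singleton_iff] at h
      rw [← h]
      simpa using hz
    · rw [closure_ball _ one_ne_zero]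
      exact sdiff_subset

/-- The coordinate `z ↦ p - u * z` is a planar isometry in which the positive real axis points from
`p` towards the centre. By the law of cosines the distance from the centre increases with the
absolute value of the angle, so the disk cuts circles around `p` in arcs symmetric about that axis,
also at boundary points. -/
theorem exists_polarChart (p : Metric.closedBall (0 : ℂ) 1) :
    ∃ e D R L, IsPolarChart e D R L ∧ e 0 = p := by
  obtain ⟨u, hu, hpu⟩ : ∃ u : ℂ, ‖u‖ = 1 ∧ (p : ℂ) = ‖(p : ℂ)‖ * u := by
    by_cases hp : (p : ℂ) = 0
    · exact ⟨1, by simp, by simp [hp]⟩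
    · have := norm_ne_zero_iff.2 hp
      refine ⟨p / ‖(p : ℂ)‖, by simp [this], ?_⟩
      rw [mul_div_cancel₀ _ (Complex.ofReal_ne_zero.2 this)]
  have hp1 : ‖(p : ℂ)‖ ≤ 1 := mem_closedBall_zero_iff.1 p.2
  set a : ℝ := ‖(p : ℂ)‖ with ha
  have ha0 : 0 ≤ a := norm_nonneg _
  have hfac : ∀ z : ℂ, (p : ℂ) - u * z = u * (a - z) := fun z => by rw [hpu]; ring
  have hnorm : ∀ z : ℂ, ‖(p : ℂ) - u * z‖ = ‖(a : ℂ) - z‖ := fun z => by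
    rw [hfac, norm_mul, hu, one_mul]
  have hdist : ∀ z w : ℂ, dist ((p : ℂ) - u * z) ((p : ℂ) - u * w) = dist z w := fun z w => by
    rw [dist_eq_norm, dist_eq_norm, sub_sub_sub_cancel_left, ← mul_sub, norm_mul, hu, one_mul,
      norm_sub_rev]
  have hu0 : u ≠ 0 := fun h => by simp [h] at hu
  have hsq : ∀ (r t : ℝ), ‖(a : ℂ) - r * Complex.exp (t * Complex.I)‖ ^ 2 =
      a ^ 2 + r ^ 2 - 2 * a * r * Real.cos t := fun r t => by
    rw [Complex.sq_norm, Complex.normSq_apply]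
    simp only [Complex.sub_re, Complex.sub_im, Complex.mul_re, Complex.mul_im, Complex.ofReal_re,
      Complex.ofReal_im, Complex.exp_ofReal_mul_I_re, Complex.exp_ofReal_mul_I_im]
    linear_combination r ^ 2 * Real.sin_sq_add_cos_sq t
  set D : Set ℂ := {z | (p : ℂ) - u * z ∈ Metric.closedBall (0 : ℂ) 1} with hD
  have hmem : ∀ z, z ∈ D ↔ ‖(a : ℂ) - z‖ ≤ 1 := fun z => by
    rw [← hnorm]; exact mem_closedBall_zero_iff
  refine ⟨fun z => ModelSurface.diskOfComplex (p - u * z), D, 1, 1, ⟨one_pos, ?_, ?_, ?_, ?_, ?_,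
    ?_, ?_⟩, ?_⟩
  · exact Metric.isClosed_closedBall.preimage (by fun_prop)
  · rw [hmem]; simpa using abs_le.2 ⟨by linarith, hp1⟩
  · intro r hr
    rw [hmem, ← Complex.ofReal_sub, Complex.norm_real, Real.norm_eq_abs, abs_le]
    constructor <;> linarith [hr.1, hr.2]
  · intro r hr s t hts hs hD
    rw [hmem, ← sq_le_one_iff₀ (norm_nonneg _), hsq] at hD ⊢
    have hcos : Real.cos s ≤ Real.cos t := by
      rw [← Real.cos_abs s, ← Real.cos_abs t]
      exact Real.cos_le_cos_of_nonneg_of_le_pi (abs_nonneg _) hs hts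
    have : 0 ≤ a * r := mul_nonneg ha0 hr.1.le
    nlinarith
  · refine LipschitzOnWith.of_dist_le_mul fun z hz w hw => ?_
    rw [dist_diskOfComplex hz.1 hw.1, hdist, NNReal.coe_one, one_mul]
  · intro z hz w hw
    rw [dist_diskOfComplex hz.1 hw.1, hdist, NNReal.coe_one, one_mul]
  · intro r hr
    have : (fun z => ModelSurface.diskOfComplex (p - u * z)) '' (D ∩ Metric.ball 0 r) =
        Subtype.val ⁻¹' Metric.ball (p : ℂ) r := by
      rw [← diskOfComplex_image]
      ext q
      constructor
      · rintro ⟨z, ⟨hz, hzr⟩, rfl⟩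
        refine ⟨_, ⟨?_, hz⟩, rfl⟩
        have := hdist z 0
        rw [mul_zero, sub_zero] at this
        rw [Metric.mem_ball, this]
        exact hzr
      · rintro ⟨z, ⟨hz, hz1⟩, rfl⟩
        have hz2 : (p : ℂ) - u * (u⁻¹ * (p - z)) = z := by
          rw [mul_inv_cancel_left₀ hu0]; ring
        refine ⟨u⁻¹ * (p - z), ⟨?_, ?_⟩, ?_⟩
        · rw [hD, Set.mem_ofPred_eq, hz2]
          exact hz1
        · have := hdist (u⁻¹ * (p - z)) 0
          rw [hz2, mul_zero, sub_zero] at this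
          rw [Metric.mem_ball, ← this]
          exact hz
        · simp only [hz2]
    rw [this]
    exact Metric.isOpen_ball.preimage continuous_subtype_val
  · simp only [mul_zero, sub_zero]
    exact diskOfComplex_of_mem p.2

end ClosedDisk

/-! ### Both model surfaces together. -/

namespace ModelSurface

instance : (Ω : ModelSurface) → CompactSpace Ω.Carrier
  | sphere => inferInstanceAs (CompactSpace RiemannSphere)
  | disk => isCompact_iff_compactSpace.1 (isCompact_closedBall (0 : ℂ) 1)

instance : (Ω : ModelSurface) → ConnectedSpace Ω.Carrier
  | sphere => inferInstanceAs (ConnectedSpace RiemannSphere)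
  | disk => isConnected_iff_connectedSpace.1
      ((convex_closedBall (0 : ℂ) 1).isConnected ⟨0, by simp⟩)

instance : (Ω : ModelSurface) → Nontrivial Ω.Carrier
  | sphere => inferInstanceAs (Nontrivial RiemannSphere)
  | disk => ⟨⟨⟨0, by simp⟩, ⟨1, by simp⟩, fun h => zero_ne_one (congrArg Subtype.val h)⟩⟩

instance (Ω : ModelSurface) (x : Ω.Carrier) : (𝓝[≠] x).NeBot :=
  ConnectedSpace.neBot_nhdsWithin_compl_of_nontrivial_of_t1space x

theorem isPreconnected_compl_singleton : (Ω : ModelSurface) → (p : Ω.Carrier) →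
    IsPreconnected ({p}ᶜ : Set Ω.Carrier)
  | sphere => RiemannSphere.isPreconnected_compl_singleton
  | disk => ClosedDisk.isPreconnected_compl_singleton

theorem exists_polarChart : (Ω : ModelSurface) → (p : Ω.Carrier) →
    ∃ e D R L, IsPolarChart (A := Ω.Carrier) e D R L ∧ e 0 = p
  | sphere => RiemannSphere.exists_polarChart
  | disk => ClosedDisk.exists_polarChart

theorem hausdorffTwo_image_closedBall_ne_top {A : Type*} [MetricSpace A] [MeasurableSpace A]
    [BorelSpace A] {e : ℂ → A} {L : ℝ≥0} (he : LipschitzOnWith L e (Metric.closedBall 0 1)) :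
    hausdorffTwo A (e '' Metric.closedBall 0 1) ≠ ∞ := by
  refine ((hausdorffTwo_image_le he).trans_lt (ENNReal.mul_lt_top
    (ENNReal.pow_lt_top ENNReal.coe_lt_top) ?_)).ne
  rw [hausdorffTwo, Measure.smul_apply, smul_eq_mul]
  refine ENNReal.mul_lt_top ENNReal.ofReal_lt_top
    ((hausdorffMeasure_two_le_volume _).trans_lt (ENNReal.mul_lt_top (by simp) ?_))
  exact (isCompact_closedBall _ _).measure_lt_top

theorem hausdorffTwo_univ_ne_top (Ω : ModelSurface) : hausdorffTwo Ω.Carrier univ ≠ ∞ := by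
  cases Ω with
  | sphere =>
    have h1 := hausdorffTwo_image_closedBall_ne_top (A := sphere.Carrier)
      (RiemannSphere.lipschitzWith_ofComplex.lipschitzOnWith)
    have h2 := hausdorffTwo_image_closedBall_ne_top (A := sphere.Carrier)
      ((RiemannSphere.isometry_inversion.lipschitz.comp
        RiemannSphere.lipschitzWith_ofComplex).lipschitzOnWith)
    refine ne_top_of_le_ne_top (ENNReal.add_ne_top.2 ⟨h1, h2⟩)
      ((measure_mono fun p _ => ?_).trans (measure_union_le _ _))
    rcases RiemannSphere.exists_eq_ofComplex_or p with ⟨z, rfl⟩ | rfl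
    · rcases le_total ‖z‖ 1 with hz | hz
      · exact Or.inl ⟨z, by simpa using hz, rfl⟩
      · refine Or.inr ⟨z⁻¹, ?_, ?_⟩
        · rw [mem_closedBall_zero_iff, norm_inv]
          exact inv_le_one_of_one_le₀ hz
        · have hz0 : z ≠ 0 := fun h => by rw [h, norm_zero] at hz; linarith
          change RiemannSphere.ofComplexInv z⁻¹ = _
          rw [RiemannSphere.ofComplexInv_of_ne (inv_ne_zero hz0), inv_inv]
    · exact Or.inr ⟨0, by simp, rfl⟩
  | disk =>
    have h1 := hausdorffTwo_image_closedBall_ne_top (A := disk.Carrier) (L := 1)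
      (e := diskOfComplex)
      (LipschitzOnWith.of_dist_le_mul fun z hz w hw => by
        rw [NNReal.coe_one, one_mul]
        exact (dist_diskOfComplex hz hw).le)
    refine ne_top_of_le_ne_top h1 (measure_mono fun p _ => ?_)
    exact ⟨p.1, p.2, diskOfComplex_of_mem p.2⟩

/-- Around every point of a model surface, conformality is tested along a local parametrization with
a positive metric derivative. -/
theorem IsConformal.exists_parametrization {Y : Type*} [MetricSpace Y]
    {S : PolyhedralRiemannSurface Y} : {Ω : ModelSurface} → {h : Ω.Carrier ≃ₜ Y} →
    Ω.IsConformal S h → ∀ x : Ω.Carrier, ∃ (e : ℂ → Ω.Carrier) (D : Set ℂ) (w : ℂ) (lam : ℝ),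
      S.IsConformalAlong D e h ∧ w ∈ D ∧ e w = x ∧ 0 < lam ∧ ContinuousOn e D ∧
        HasMetricDeriv e lam (𝓝[D] w) ∧ 𝓝 x ≤ map e (𝓝[D] w)
  | sphere, h, hh, x => by
    rcases RiemannSphere.exists_eq_ofComplex_or x with ⟨w, rfl⟩ | rfl
    · refine ⟨_, univ, w, 2 / (1 + ‖w‖ ^ 2), hh.1, mem_univ _, rfl, by positivity,
        RiemannSphere.lipschitzWith_ofComplex.continuous.continuousOn, ?_, ?_⟩
      · rw [nhdsWithin_univ]
        exact RiemannSphere.hasMetricDeriv_ofComplex w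
      · rw [nhdsWithin_univ]
        exact RiemannSphere.isOpenEmbedding_ofComplex.isOpenMap.nhds_le w
    · refine ⟨_, univ, 0, 2 / (1 + ‖(0 : ℂ)‖ ^ 2), hh.2, mem_univ _, rfl, by positivity,
        (RiemannSphere.inversionEquiv.continuous.comp
          RiemannSphere.lipschitzWith_ofComplex.continuous).continuousOn, ?_, ?_⟩
      · rw [nhdsWithin_univ]
        intro ε hε
        filter_upwards [RiemannSphere.hasMetricDeriv_ofComplex 0 ε hε] with p hp
        have := RiemannSphere.isometry_inversion.dist_eq (RiemannSphere.ofComplex p.1)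
          (RiemannSphere.ofComplex p.2)
        rw [← this] at hp
        exact hp
      · rw [nhdsWithin_univ]
        exact (RiemannSphere.inversionEquiv.toHomeomorph.isOpenMap.comp
          RiemannSphere.isOpenEmbedding_ofComplex.isOpenMap).nhds_le 0
  | disk, h, hh, x => by
    refine ⟨_, _, x.1, 1, hh, x.2, diskOfComplex_of_mem x.2, one_pos, ?_, ?_, ?_⟩
    · exact (LipschitzOnWith.of_dist_le_mul (K := 1) fun z hz w hw => by
        rw [NNReal.coe_one, one_mul]
        exact (dist_diskOfComplex hz hw).le).continuousOn
    · intro ε hε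
      have h1 : ∀ᶠ p : ℂ × ℂ in 𝓝[Metric.closedBall 0 1] x.1 ×ˢ 𝓝[Metric.closedBall 0 1] x.1,
          p.1 ∈ Metric.closedBall (0 : ℂ) 1 ∧ p.2 ∈ Metric.closedBall (0 : ℂ) 1 :=
        prod_mem_prod self_mem_nhdsWithin self_mem_nhdsWithin
      filter_upwards [h1] with p hp
      have := dist_diskOfComplex hp.1 hp.2
      change |dist (diskOfComplex p.1) (diskOfComplex p.2) - _| ≤ _
      rw [this, one_mul, sub_self, abs_zero]
      positivity
    · intro s hs
      obtain ⟨u, hu, hus⟩ := mem_nhdsWithin_iff_exists_mem_nhds_inter.1 (mem_map.1 hs)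
      have h1 : Subtype.val ⁻¹' u ∈ 𝓝 (x : Metric.closedBall (0 : ℂ) 1) :=
        continuous_subtype_val.continuousAt hu
      refine mem_of_superset h1 ?_
      rw [← diskOfComplex_image]
      rintro _ ⟨z, hz, rfl⟩
      exact hus hz

end ModelSurface




/-! ### The metric of a polyhedral surface -/

theorem edist_le_innerEDist (P : Set ℂ) (x y : ℂ) : edist x y ≤ innerEDist P x y := by
  refine le_iInf₂ fun γ hγ => ?_
  rw [← hγ.1, ← hγ.2.1]
  exact eVariationOn.edist_le _ (mem_univ _) (mem_univ _)

theorem innerEDist_le_of_segment_subset {P : Set ℂ} {x y : ℂ} (h : segment ℝ x y ⊆ P) :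
    innerEDist P x y ≤ edist x y := by
  let γ : C(I, ℂ) := ⟨fun t => AffineMap.lineMap x y (t : ℝ), by fun_prop⟩
  refine (iInf₂_le γ ⟨by simp [γ], by simp [γ], ?_⟩).trans ?_; rotate_left
  · rintro _ ⟨t, rfl⟩
    rw [segment_eq_image_lineMap] at h
    exact h ⟨t, t.2, rfl⟩
  · have h1 : LipschitzOnWith (nndist x y) (fun t : ℝ => AffineMap.lineMap x y t) univ :=
      LipschitzOnWith.of_dist_le_mul fun s _ t _ => by
        rw [dist_lineMap_lineMap, mul_comm, coe_nndist]
    have h2 := h1.comp_eVariationOn_le (f := fun t : ℝ => (AffineMap.lineMap x y t : ℂ))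
      (g := fun t : I => (t : ℝ)) (s := univ) (mapsTo_univ _ _)
    have h3 : eVariationOn (fun t : I => (t : ℝ)) univ ≤ 1 := by
      have := (show MonotoneOn (fun t : I => (t : ℝ)) univ from fun _ _ _ _ h => h).eVariationOn_eq
        (mem_univ 0) (mem_univ 1)
      simpa [Icc_zero_one_eq_univ] using this.le
    calc pathLength γ ≤ nndist x y * eVariationOn (fun t : I => (t : ℝ)) univ := h2
      _ ≤ nndist x y * 1 := by gcongr
      _ = edist x y := by rw [mul_one, edist_nndist]

theorem innerEDist_add_le {P : Set ℂ} {γ : C(I, ℂ)} (hγ : range γ ⊆ P) (t : I) :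
    innerEDist P (γ 0) (γ t) + innerEDist P (γ t) (γ 1) ≤ pathLength γ := by
  have h1 : innerEDist P (γ 0) (γ t) ≤ eVariationOn γ (Icc 0 t) := by
    refine (iInf₂_le (γ.comp ⟨fun s => t * s, by fun_prop⟩) ⟨by simp, by simp, ?_⟩).trans ?_
    rotate_left
    · rintro _ ⟨s, rfl⟩
      exact hγ ⟨_, rfl⟩
    · refine eVariationOn.comp_le_of_monotoneOn γ (fun s : I => t * s)
        (fun s _ s' _ h => mul_le_mul_right h t) fun s _ => ⟨unitInterval.nonneg', ?_⟩
      exact unitInterval.mul_le_left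
  have h2 : innerEDist P (γ t) (γ 1) ≤ eVariationOn γ (Icc t 1) := by
    -- The reparametrization `s ↦ 1 - (1 - t) * (1 - s)` runs from `t` to `1`.
    refine (iInf₂_le (γ.comp ⟨fun s => unitInterval.symm (unitInterval.symm t *
      unitInterval.symm s), by fun_prop⟩) ⟨by simp, by simp, ?_⟩).trans ?_; rotate_left
    · rintro _ ⟨s, rfl⟩
      exact hγ ⟨_, rfl⟩
    · refine eVariationOn.comp_le_of_monotoneOn γ (fun s : I => unitInterval.symm
        (unitInterval.symm t * unitInterval.symm s)) (fun s _ s' _ h => ?_)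
        fun s _ => ⟨?_, unitInterval.le_one'⟩
      · rw [unitInterval.symm_le_symm]
        exact mul_le_mul_right (unitInterval.symm_le_symm.2 h) _
      · rw [← unitInterval.symm_symm t, unitInterval.symm_le_symm, unitInterval.symm_symm]
        exact unitInterval.mul_le_left
  refine (add_le_add h1 h2).trans ?_
  rw [pathLength]
  refine (eVariationOn.add_le_union γ fun x hx y hy => hx.2.trans hy.1).trans
    (eVariationOn.mono _ (subset_univ _))

namespace PolyhedralRiemannSurface

variable {Y : Type*} [MetricSpace Y] (S : PolyhedralRiemannSurface Y)

/-- Induction along an almost optimal chain, where `Q q s` is a property of points reached from `p`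
at cost `s`. Only steps within a single face remain to be checked. -/
theorem exists_of_edist_lt {p q : Y} {Q : Y → ℝ≥0∞ → Prop} (h0 : Q p 0)
    (hstep : ∀ i, ∀ x ∈ (S.poly i).carrier, ∀ y ∈ (S.poly i).carrier, ∀ s, Q (S.glue i x) s →
      Q (S.glue i y) (s + innerEDist (S.poly i).carrier x y))
    {b : ℝ≥0∞} (hb : edist p q < b) : ∃ s < b, Q q s := by
  rw [S.edist_eq] at hb
  simp only [iInf_lt_iff] at hb
  obtain ⟨m, i, x, y, ⟨hmem, hglue, hp, hq⟩, hlt⟩ := hb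
  refine ⟨_, hlt, ?_⟩
  have key : ∀ k ≤ m, Q (S.glue (i k) (y k)) (∑ k ∈ Finset.range (k + 1),
      innerEDist (S.poly (i k)).carrier (x k) (y k)) := by
    intro k
    induction k with
    | zero =>
      intro hk
      have := hstep (i 0) (x 0) (hmem 0 hk).1 (y 0) (hmem 0 hk).2 0 (by rwa [hp])
      simpa using this
    | succ k ih =>
      intro hk
      rw [Finset.sum_range_succ]
      refine hstep _ _ (hmem _ hk).1 _ (hmem _ hk).2 _ ?_
      rw [← hglue k hk]
      exact ih (Nat.le_of_succ_le hk)
  rw [← hq]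
  exact key m le_rfl

theorem edist_glue_le {i : S.Face} {x y : ℂ} (hx : x ∈ (S.poly i).carrier)
    (hy : y ∈ (S.poly i).carrier) :
    edist (S.glue i x) (S.glue i y) ≤ innerEDist (S.poly i).carrier x y := by
  rw [S.edist_eq]
  refine (iInf_le _ 0).trans ((iInf_le _ fun _ => i).trans ((iInf_le _ fun _ => x).trans
    ((iInf_le _ fun _ => y).trans ((iInf_le _ ⟨fun _ _ => ⟨hx, hy⟩, fun k hk => absurd hk
      (Nat.not_lt_zero k), rfl, rfl⟩).trans ?_))))
  simp

/-- Every point of the surface has a natural chart. -/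
def HasCharts : Prop := ∀ y, ∃ r α ψ, S.IsNaturalChart y r α ψ

variable {S}

/-- A sector is star-shaped about its vertex `x`, so near `x` the inner distance to `x` is
Euclidean, and gluing does not increase inner distance. -/
theorem HasCharts.continuousOn_glue (hS : S.HasCharts) (i : S.Face) :
    ContinuousOn (S.glue i) (S.poly i).carrier := by
  intro x hx
  obtain ⟨r, α, ψ, hψ⟩ := hS (S.glue i x)
  obtain ⟨a, b, β, hab, -, hsec, -⟩ := hψ.sector i x hx rfl
  have hr := hψ.r_pos
  have hle : ∀ z ∈ (S.poly i).carrier ∩ Metric.ball x r,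
      edist (S.glue i x) (S.glue i z) ≤ edist x z := by
    intro z hz
    refine (S.edist_glue_le hx hz.1).trans (innerEDist_le_of_segment_subset ?_)
    rw [hsec] at hz
    obtain ⟨s, hs, θ, hθ, rfl⟩ := hz
    rw [segment_eq_image_lineMap]
    rintro _ ⟨t, ht, rfl⟩
    have : (AffineMap.lineMap x (x + s * Complex.exp (θ * Complex.I)) t : ℂ) ∈
        (S.poly i).carrier ∩ Metric.ball x r := by
      rw [hsec]
      refine ⟨t * s, ⟨mul_nonneg ht.1 hs.1, (mul_le_of_le_one_left hs.1 ht.2).trans_lt hs.2⟩, θ,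
        hθ, ?_⟩
      simp [AffineMap.lineMap_apply]
      ring
    exact this.1
  rw [ContinuousWithinAt, tendsto_iff_edist_tendsto_0]
  have h1 : Tendsto (fun z => edist x z) (𝓝[(S.poly i).carrier] x) (𝓝 0) := by
    have : Continuous fun z : ℂ => edist x z := by fun_prop
    have := (this.tendsto x).mono_left (nhdsWithin_le_nhds (s := (S.poly i).carrier))
    rwa [edist_self] at this
  refine tendsto_of_tendsto_of_tendsto_of_le_of_le' tendsto_const_nhds h1
    (Eventually.of_forall fun _ => bot_le) ?_
  filter_upwards [self_mem_nhdsWithin, mem_nhdsWithin_of_mem_nhds (Metric.ball_mem_nhds x hr)]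
    with z hz hz'
  rw [edist_comm]
  exact hle z ⟨hz, hz'⟩

/-- The union of almost shortest paths in the faces of a chain is connected, and its points are
almost between the ends. Stating the inductive property for every `δ` allows each step to halve the
permitted loss; finiteness of the cost is needed to choose the paths. -/
theorem HasCharts.isApproxGeodesic (hS : S.HasCharts) : IsApproxGeodesic Y := by
  intro p q ε hε
  have key : ∃ s < edist p q + ENNReal.ofReal (ε / 2), s ≠ ∞ → ∀ δ > 0, ∃ C : Set Y,
      IsPreconnected C ∧ p ∈ C ∧ q ∈ C ∧ ∀ z ∈ C, edist p z + edist z q ≤ s + δ := by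
    refine S.exists_of_edist_lt (p := p) (Q := fun q s => s ≠ ∞ → ∀ δ > 0, ∃ C : Set Y,
      IsPreconnected C ∧ p ∈ C ∧ q ∈ C ∧ ∀ z ∈ C, edist p z + edist z q ≤ s + δ) ?_ ?_ ?_
    · exact fun _ δ _ => ⟨{p}, isPreconnected_singleton, rfl, rfl, by rintro z rfl; simp⟩
    · intro i x hx y hy s hs hne δ hδ
      rw [ENNReal.add_ne_top] at hne
      obtain ⟨C, hC, hpC, hqC, hCs⟩ := hs hne.1 (δ / 2) (ENNReal.half_pos hδ.ne')
      obtain ⟨γ, ⟨hγ0, hγ1, hγP⟩, hγl⟩ : ∃ γ : C(I, ℂ), (γ 0 = x ∧ γ 1 = y ∧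
          range γ ⊆ (S.poly i).carrier) ∧
          pathLength γ < innerEDist (S.poly i).carrier x y + δ / 2 := by
        have := ENNReal.lt_add_right hne.2 (ENNReal.half_pos hδ.ne').ne'
        nth_rw 1 [innerEDist] at this
        simp only [iInf_lt_iff] at this
        obtain ⟨γ, h1, h2⟩ := this
        exact ⟨γ, h1, h2⟩
      have hpath : ∀ t, edist (S.glue i x) (S.glue i (γ t)) + edist (S.glue i (γ t)) (S.glue i y) ≤
          innerEDist (S.poly i).carrier x y + δ / 2 := fun t => by
        refine le_trans (add_le_add (S.edist_glue_le hx (hγP ⟨t, rfl⟩))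
          (S.edist_glue_le (hγP ⟨t, rfl⟩) hy)) ?_
        have := innerEDist_add_le hγP t
        rw [hγ0, hγ1] at this
        exact this.trans hγl.le
      have hd0 : edist (S.glue i x) (S.glue i y) ≤ innerEDist (S.poly i).carrier x y + δ / 2 := by
        have := hpath 1
        rwa [hγ1, edist_self, add_zero] at this
      refine ⟨C ∪ range fun t => S.glue i (γ t), ?_, Or.inl hpC, Or.inr ⟨1, by simp [hγ1]⟩, ?_⟩
      · refine hC.union (S.glue i x) hqC ⟨0, by simp [hγ0]⟩ (isPreconnected_range ?_)
        exact (hS.continuousOn_glue i).comp_continuous γ.continuous fun t => hγP ⟨t, rfl⟩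
      · have hsum : s + innerEDist (S.poly i).carrier x y + δ =
            (s + δ / 2) + (innerEDist (S.poly i).carrier x y + δ / 2) := by
          nth_rw 1 [← ENNReal.add_halves δ]
          ring
        rw [hsum]
        rintro z (hz | ⟨t, rfl⟩)
        · calc edist p z + edist z (S.glue i y)
              ≤ edist p z + (edist z (S.glue i x) + edist (S.glue i x) (S.glue i y)) := by
                gcongr; exact edist_triangle _ _ _
            _ = edist p z + edist z (S.glue i x) + edist (S.glue i x) (S.glue i y) := by ring
            _ ≤ _ := add_le_add (hCs z hz) hd0
        · calc edist p (S.glue i (γ t)) + edist (S.glue i (γ t)) (S.glue i y)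
              ≤ edist p (S.glue i x) + edist (S.glue i x) (S.glue i (γ t)) +
                edist (S.glue i (γ t)) (S.glue i y) := by
                gcongr; exact edist_triangle _ _ _
            _ = edist p (S.glue i x) + (edist (S.glue i x) (S.glue i (γ t)) +
                edist (S.glue i (γ t)) (S.glue i y)) := by ring
            _ ≤ _ := add_le_add (by simpa using hCs _ hqC) (hpath t)
    · exact ENNReal.lt_add_right (edist_ne_top _ _) (by simpa using hε)
  obtain ⟨s, hs, h⟩ := key
  have hsfin : s ≠ ∞ := (hs.trans_le le_top).ne
  obtain ⟨C, hC, hp, hq, hCs⟩ := h hsfin (ENNReal.ofReal (ε / 2)) (by simpa using hε)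
  refine ⟨C, hC, hp, hq, fun z hz => ?_⟩
  have h1 := (hCs z hz).trans (add_le_add_left hs.le _)
  rw [edist_dist, edist_dist, edist_dist, add_assoc, ← ENNReal.ofReal_add (by positivity)
    (by positivity), ← ENNReal.ofReal_add (by positivity) (by positivity),
    ← ENNReal.ofReal_add (by positivity) (by positivity),
    ENNReal.ofReal_le_ofReal_iff (by positivity)] at h1
  linarith

end PolyhedralRiemannSurface




/-! ### Angles of planar sectors -/

theorem exp_ofReal_mul_I_eq_iff {a b : ℝ} :
    Complex.exp (a * Complex.I) = Complex.exp (b * Complex.I) ↔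
      ∃ n : ℤ, a = b + n * (2 * Real.pi) := by
  rw [Complex.exp_eq_exp_iff_exists_int]
  refine exists_congr fun n => ?_
  have : (b * Complex.I + n * (2 * Real.pi * Complex.I) : ℂ) =
      ((b + n * (2 * Real.pi) : ℝ) : ℂ) * Complex.I := by push_cast; ring
  rw [this, mul_left_inj' Complex.I_ne_zero, Complex.ofReal_inj]

/-- `θ` agrees with an angle of `[a, b]` modulo `2π`. -/
def IsAngleIn (a b θ : ℝ) : Prop :=
  ∃ θ' ∈ Icc a b, Complex.exp (θ * Complex.I) = Complex.exp (θ' * Complex.I)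

/-- A representative of `a` selects the translate of the interval from `c` to `d`. If `b` stuck out
of it, an angle just beyond the upper end, inside the gap before the next translate, would need a
shift by an integer strictly between `n` and `n + 1`. -/
theorem exists_int_of_forall_isAngleIn {a b c d : ℝ} (hab : a ≤ b) (hcd : d - c < 2 * Real.pi)
    (h : ∀ θ ∈ Icc a b, IsAngleIn c d θ) :
    ∃ n : ℤ, c + n * (2 * Real.pi) ≤ a ∧ b ≤ d + n * (2 * Real.pi) := by
  have hpi := Real.pi_pos
  obtain ⟨a', ha', hea⟩ := h a ⟨le_rfl, hab⟩
  obtain ⟨n, hn⟩ := exp_ofReal_mul_I_eq_iff.1 hea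
  refine ⟨n, by linarith [ha'.1], ?_⟩
  by_contra! hb
  obtain ⟨θ, hθ1, hθ2⟩ := exists_between (lt_min hb (show d + n * (2 * Real.pi) <
    c + 2 * Real.pi + n * (2 * Real.pi) by linarith))
  obtain ⟨θ', hθ', he⟩ := h θ ⟨by linarith [ha'.2], hθ2.le.trans (min_le_left _ _)⟩
  obtain ⟨m, hm⟩ := exp_ofReal_mul_I_eq_iff.1 he
  have h2 := hθ2.trans_le (min_le_right _ _)
  have h3 : (n : ℝ) < m := by
    by_contra! hle
    have := mul_le_mul_of_nonneg_right hle (show (0 : ℝ) ≤ 2 * Real.pi by positivity)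
    linarith [hθ'.2]
  have h4 : (m : ℝ) < n + 1 := by
    by_contra! hle
    have := mul_le_mul_of_nonneg_right hle (show (0 : ℝ) ≤ 2 * Real.pi by positivity)
    linarith [hθ'.1]
  have h3' : n < m := by exact_mod_cast h3
  have h4' : m < n + 1 := by exact_mod_cast h4
  omega

theorem exists_int_of_isAngleIn_iff {a b c d : ℝ} (hab : a ≤ b) (hc : c ≤ d)
    (hcd : d - c < 2 * Real.pi) (h : ∀ θ, IsAngleIn a b θ ↔ IsAngleIn c d θ) :
    ∃ n : ℤ, a = c + n * (2 * Real.pi) ∧ b = d + n * (2 * Real.pi) := by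
  have hpi := Real.pi_pos
  obtain ⟨n, hn1, hn2⟩ := exists_int_of_forall_isAngleIn hab hcd fun θ hθ =>
    (h θ).1 ⟨θ, hθ, rfl⟩
  obtain ⟨m, hm1, hm2⟩ := exists_int_of_forall_isAngleIn (c := a) (d := b) hc (by linarith)
    fun θ hθ => (h θ).2 ⟨θ, hθ, rfl⟩
  have h1 : (n + m : ℝ) ≤ 0 := by
    by_contra! hlt
    have := mul_pos hlt (show 0 < 2 * Real.pi by positivity)
    linarith
  have h2 : 0 ≤ (n + m : ℝ) := by
    by_contra! hlt
    have := mul_pos (neg_pos.2 hlt) (show 0 < 2 * Real.pi by positivity)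
    linarith
  have h3 : (n + m : ℝ) * (2 * Real.pi) = 0 := by rw [le_antisymm h1 h2, zero_mul]
  exact ⟨n, by linarith, by linarith⟩

theorem isAngleIn_zero_pi_iff {θ : ℝ} : IsAngleIn 0 Real.pi θ ↔ 0 ≤ Real.sin θ := by
  constructor
  · rintro ⟨θ', hθ', he⟩
    have := congrArg Complex.im he
    rw [Complex.exp_ofReal_mul_I_im, Complex.exp_ofReal_mul_I_im] at this
    rw [this]
    exact Real.sin_nonneg_of_nonneg_of_le_pi hθ'.1 hθ'.2
  · intro h
    set z := Complex.exp (θ * Complex.I) with hz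
    refine ⟨z.arg, ⟨Complex.arg_nonneg_iff.2 ?_, Complex.arg_le_pi _⟩, ?_⟩
    · rwa [hz, Complex.exp_ofReal_mul_I_im]
    · have h1 := Complex.norm_mul_exp_arg_mul_I z
      rw [hz, Complex.norm_exp_ofReal_mul_I, Complex.ofReal_one, one_mul] at h1
      exact h1.symm

theorem isAngleIn_add_iff {a b c θ : ℝ} : IsAngleIn (c + a) (c + b) θ ↔ IsAngleIn a b (θ - c) := by
  have key : ∀ θ' : ℝ, Complex.exp (θ * Complex.I) = Complex.exp ((θ' + c : ℝ) * Complex.I) ↔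
      Complex.exp ((θ - c : ℝ) * Complex.I) = Complex.exp (θ' * Complex.I) := fun θ' => by
    rw [exp_ofReal_mul_I_eq_iff, exp_ofReal_mul_I_eq_iff]
    exact exists_congr fun n => ⟨fun h => by linarith, fun h => by linarith⟩
  constructor
  · rintro ⟨θ', hθ', he⟩
    refine ⟨θ' - c, ⟨by linarith [hθ'.1], by linarith [hθ'.2]⟩, (key _).1 ?_⟩
    rwa [sub_add_cancel]
  · rintro ⟨θ', hθ', he⟩
    exact ⟨θ' + c, ⟨by linarith [hθ'.1], by linarith [hθ'.2]⟩, (key _).2 he⟩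

/-- The sector of radius `r` at `x` between the angles `a` and `b`. -/
def planarSector (x : ℂ) (r a b : ℝ) : Set ℂ :=
  {z | ∃ s ∈ Ico 0 r, ∃ θ ∈ Icc a b, z = x + s * Complex.exp (θ * Complex.I)}

theorem eq_and_exp_eq_of_mul_exp_eq {s s' θ θ' : ℝ} (hs : 0 < s) (hs' : 0 ≤ s')
    (h : (s : ℂ) * Complex.exp (θ * Complex.I) = s' * Complex.exp (θ' * Complex.I)) :
    s = s' ∧ Complex.exp (θ * Complex.I) = Complex.exp (θ' * Complex.I) := by
  have h1 := congrArg norm h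
  rw [IsPolarChart.norm_ofReal_mul_exp hs.le, IsPolarChart.norm_ofReal_mul_exp hs'] at h1
  subst h1
  exact ⟨rfl, mul_left_cancel₀ (Complex.ofReal_ne_zero.2 hs.ne') h⟩

theorem mem_planarSector_iff {x : ℂ} {r a b s θ : ℝ} (hs : s ∈ Ioo 0 r) :
    x + s * Complex.exp (θ * Complex.I) ∈ planarSector x r a b ↔ IsAngleIn a b θ := by
  constructor
  · rintro ⟨s', hs', θ', hθ', h⟩
    exact ⟨θ', hθ', (eq_and_exp_eq_of_mul_exp_eq hs.1 hs'.1 (add_left_cancel h)).2⟩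
  · rintro ⟨θ', hθ', h⟩
    exact ⟨s, ⟨hs.1.le, hs.2⟩, θ', hθ', by rw [h]⟩

/-! ### Polygons near edge points -/

namespace PolygonalDisk

variable (P : PolygonalDisk)

/-- The other sides are closed and miss `x`, so near `x` the frontier is a piece of one edge;
staying away from its end points turns the edge into its line. -/
theorem exists_forall_dist_lt_of_mem_openSegment {k : Fin (P.extraSides + 3)} {x : ℂ}
    (hx : x ∈ openSegment ℝ (P.v k) (P.v (k + 1))) :
    ∃ ρ > 0, ∀ z, dist z x < ρ → (z ∈ frontier P.carrier ↔
      ((z - x) * (starRingEnd ℂ) (P.v (k + 1) - P.v k)).im = 0) := by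
  set u := P.v (k + 1) - P.v k with hu
  have hu0 : u ≠ 0 := by
    rw [hu, sub_ne_zero]
    exact fun h => absurd (P.v_injective h) (by simp)
  have hun : 0 < ‖u‖ := norm_pos_iff.2 hu0
  obtain ⟨ρ₁, hρ₁, h1⟩ : ∃ ρ > 0, ∀ z, dist z x < ρ → ∀ j, j ≠ k →
      z ∉ segment ℝ (P.v j) (P.v (j + 1)) := by
    have h2 : ∀ᶠ z in 𝓝 x, ∀ j, j ≠ k → z ∉ segment ℝ (P.v j) (P.v (j + 1)) := by
      refine eventually_all.2 fun j => ?_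
      by_cases hj : j = k
      · simp [hj]
      · have hcl : IsClosed (segment ℝ (P.v j) (P.v (j + 1))) := by
          rw [← convexHull_pair]
          exact ((Set.toFinite _).isCompact_convexHull (𝕜 := ℝ)).isClosed
        have hxj : x ∉ segment ℝ (P.v j) (P.v (j + 1)) := fun h =>
          (disjoint_left.1 (P.edges_disjoint k j (Ne.symm hj))) hx h
        filter_upwards [hcl.isOpen_compl.mem_nhds hxj] with z hz _
        exact hz
    obtain ⟨ρ, hρ, h⟩ := Metric.eventually_nhds_iff.1 h2
    exact ⟨ρ, hρ, fun z hz => h hz⟩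
  rw [openSegment_eq_image_lineMap] at hx
  obtain ⟨t, ht, rfl⟩ := hx
  have hlm : ∀ s : ℝ, (AffineMap.lineMap (P.v k) (P.v (k + 1)) s : ℂ) = P.v k + s * u := fun s => by
    simp [AffineMap.lineMap_apply, hu]; ring
  have huu : u * (starRingEnd ℂ) u = ((‖u‖ ^ 2 : ℝ) : ℂ) := by
    rw [Complex.mul_conj, Complex.normSq_eq_norm_sq]
  refine ⟨min ρ₁ (min t (1 - t) * ‖u‖), lt_min hρ₁ (mul_pos (lt_min ht.1 (by linarith [ht.2])) hun),
    fun z hz => ?_⟩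
  have hfr : z ∈ frontier P.carrier ↔ z ∈ segment ℝ (P.v k) (P.v (k + 1)) := by
    rw [P.frontier_eq, mem_iUnion]
    refine ⟨fun ⟨j, hj⟩ => ?_, fun h => ⟨k, h⟩⟩
    by_cases hjk : j = k
    · rwa [hjk] at hj
    · exact absurd hj (h1 z (hz.trans_le (min_le_left _ _)) j hjk)
  rw [hfr, segment_eq_image_lineMap]
  constructor
  · rintro ⟨s, -, rfl⟩
    rw [hlm, hlm, add_sub_add_left_eq_sub, ← sub_mul, mul_assoc, huu, ← Complex.ofReal_sub,
      ← Complex.ofReal_mul, Complex.ofReal_im]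
  · intro him
    set c : ℝ := ((z - AffineMap.lineMap (P.v k) (P.v (k + 1)) t) * (starRingEnd ℂ) u).re / ‖u‖ ^ 2
      with hc
    have hzc : z - AffineMap.lineMap (P.v k) (P.v (k + 1)) t = c * u := by
      have h3 : (z - AffineMap.lineMap (P.v k) (P.v (k + 1)) t) * (starRingEnd ℂ) u =
          (c * u) * (starRingEnd ℂ) u := by
        rw [mul_assoc, huu, ← Complex.ofReal_mul, hc, div_mul_cancel₀ _ (by positivity)]
        apply Complex.ext
        · simp
        · rw [him, Complex.ofReal_im]
      exact mul_right_cancel₀ (by simpa using hu0) h3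
    have hcn : |c| < min t (1 - t) := by
      have h4 := hz.trans_le (min_le_right _ _)
      rw [dist_eq_norm, hzc, norm_mul, Complex.norm_real, Real.norm_eq_abs] at h4
      exact lt_of_mul_lt_mul_right h4 hun.le
    obtain ⟨h5, h6⟩ := lt_min_iff.1 hcn
    obtain ⟨h7, h8⟩ := abs_lt.1 h5
    obtain ⟨h9, h10⟩ := abs_lt.1 h6
    refine ⟨t + c, ⟨by linarith, by linarith⟩, ?_⟩
    rw [← sub_add_cancel z (AffineMap.lineMap (P.v k) (P.v (k + 1)) t), hzc, hlm, hlm]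
    push_cast; ring

theorem _root_.IsPreconnected.subset_interior_or_disjoint {X : Type*} [TopologicalSpace X]
    {C s : Set X} (hC : IsPreconnected C) (hs : IsClosed s) (h : Disjoint C (frontier s)) :
    C ⊆ interior s ∨ Disjoint C s := by
  by_contra! hcon
  obtain ⟨a, ha, has⟩ := not_subset.1 hcon.1
  obtain ⟨b, hb, hbs⟩ := not_disjoint_iff.1 hcon.2
  have key : ∀ z ∈ C, z ∈ s → z ∈ interior s := fun z hz hzs => by
    by_contra hni
    exact disjoint_left.1 h hz (by rw [hs.frontier_eq]; exact ⟨hzs, hni⟩)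
  have has' : a ∉ s := fun h' => has (key a ha h')
  obtain ⟨z, -, hz1, hz2⟩ := hC (interior s) sᶜ isOpen_interior hs.isOpen_compl
    (fun z hz => by
      by_cases hzs : z ∈ s
      · exact Or.inl (key z hz hzs)
      · exact Or.inr hzs) ⟨b, hb, key b hb hbs⟩ ⟨a, ha, has'⟩
  exact hz2 (interior_subset hz1)

/-- Each open half-disk at `x` misses the frontier, so it lies inside or outside. Orientation puts
the left one inside; were the right one inside too, `x` would not be a frontier point. -/
theorem exists_mem_carrier_iff_of_mem_openSegment {k : Fin (P.extraSides + 3)} {x : ℂ}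
    (hx : x ∈ openSegment ℝ (P.v k) (P.v (k + 1))) :
    ∃ ρ > 0, ∀ z, dist z x < ρ → (z ∈ P.carrier ↔
      0 ≤ ((z - x) * (starRingEnd ℂ) (P.v (k + 1) - P.v k)).im) := by
  obtain ⟨ρ, hρ, hfr⟩ := P.exists_forall_dist_lt_of_mem_openSegment hx
  refine ⟨ρ, hρ, ?_⟩
  have hccw := P.counterclockwise k x hx
  set u := P.v (k + 1) - P.v k with hu
  have hu0 : u ≠ 0 := by
    rw [hu, sub_ne_zero]
    exact fun h => absurd (P.v_injective h) (by simp)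
  have hun : 0 < ‖u‖ := norm_pos_iff.2 hu0
  have hcl := P.isCompact.isClosed
  have hlin : IsLinearMap ℝ fun z : ℂ => (z * (starRingEnd ℂ) u).im :=
    ⟨fun a b => by rw [add_mul, Complex.add_im], fun c a => by
      rw [smul_mul_assoc, Complex.smul_im]⟩
  have hsub : ∀ z, ((z - x) * (starRingEnd ℂ) u).im =
      (z * (starRingEnd ℂ) u).im - (x * (starRingEnd ℂ) u).im := fun z => by
    rw [sub_mul, Complex.sub_im]
  have hup : Convex ℝ (
      Metric.ball x ρ ∩ {z | (x * (starRingEnd ℂ) u).im < (z * (starRingEnd ℂ) u).im}) :=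
    (convex_ball _ _).inter (convex_halfSpace_gt hlin _)
  have hdown : Convex ℝ (
      Metric.ball x ρ ∩ {z | (z * (starRingEnd ℂ) u).im < (x * (starRingEnd ℂ) u).im}) :=
    (convex_ball _ _).inter (convex_halfSpace_lt hlin _)
  have hupI : Metric.ball x ρ ∩ {z | (x * (starRingEnd ℂ) u).im < (z * (starRingEnd ℂ) u).im} ⊆
      interior P.carrier := by
    refine (hup.isPreconnected.subset_interior_or_disjoint hcl ?_).resolve_right ?_
    · refine disjoint_left.2 fun z hz hzf => ?_
      have h1 := (hfr z hz.1).1 hzf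
      rw [hsub] at h1
      have h2 : (x * (starRingEnd ℂ) u).im < (z * (starRingEnd ℂ) u).im := hz.2
      linarith
    · have h1 : ∀ᶠ ε : ℝ in 𝓝[>] 0, ε * ‖u‖ < ρ ∧ 0 < ε := by
        have : Tendsto (fun ε : ℝ => ε * ‖u‖) (𝓝[>] 0) (𝓝 0) := by
          have h0 : Continuous fun ε : ℝ => ε * ‖u‖ := by fun_prop
          have := (h0.tendsto 0).mono_left (nhdsWithin_le_nhds (s := Ioi 0))
          rwa [zero_mul] at this
        exact (this.eventually (gt_mem_nhds hρ)).and self_mem_nhdsWithin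
      obtain ⟨ε, hε, hερ, hε0⟩ := (hccw.and h1).exists
      refine not_disjoint_iff.2 ⟨_, ⟨?_, ?_⟩, interior_subset hε⟩
      · rw [Metric.mem_ball, dist_eq_norm, add_sub_cancel_left, norm_mul, norm_mul,
          Complex.norm_real, Complex.norm_I, mul_one, Real.norm_of_nonneg hε0.le]
        exact hερ
      · have h2 : (ε : ℂ) * Complex.I * u * (starRingEnd ℂ) u =
            ((ε * ‖u‖ ^ 2 : ℝ) : ℂ) * Complex.I := by
          rw [mul_assoc, Complex.mul_conj, Complex.normSq_eq_norm_sq]; push_cast; ring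
        rw [Set.mem_ofPred_eq, ← sub_pos, ← hsub, add_sub_cancel_left, h2, Complex.im_ofReal_mul,
          Complex.I_im, mul_one]
        positivity
  have hdownD : Disjoint (Metric.ball x ρ ∩
      {z | (z * (starRingEnd ℂ) u).im < (x * (starRingEnd ℂ) u).im}) P.carrier := by
    refine (hdown.isPreconnected.subset_interior_or_disjoint hcl ?_).resolve_left ?_
    · refine disjoint_left.2 fun z hz hzf => ?_
      have h1 := (hfr z hz.1).1 hzf
      rw [hsub] at h1
      have h2 : (z * (starRingEnd ℂ) u).im < (x * (starRingEnd ℂ) u).im := hz.2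
      linarith
    · intro hsubset
      have hxf : x ∈ frontier P.carrier := (hfr x (by simpa using hρ)).2 (by simp)
      rw [hcl.frontier_eq] at hxf
      refine hxf.2 (mem_interior.2 ⟨Metric.ball x ρ, fun z hz => ?_, Metric.isOpen_ball,
        Metric.mem_ball_self hρ⟩)
      rcases lt_trichotomy (z * (starRingEnd ℂ) u).im (x * (starRingEnd ℂ) u).im with h | h | h
      · exact interior_subset (hsubset ⟨hz, h⟩)
      · refine hcl.frontier_subset ((hfr z hz).2 ?_)
        rw [hsub, h, sub_self]
      · exact interior_subset (hupI ⟨hz, h⟩)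
  intro z hz
  rw [hsub, sub_nonneg]
  constructor
  · intro hzP
    by_contra! hlt
    exact disjoint_left.1 hdownD ⟨hz, hlt⟩ hzP
  · intro hle
    rcases hle.eq_or_lt with h | h
    · refine hcl.frontier_subset ((hfr z hz).2 ?_)
      rw [hsub, h, sub_self]
    · exact interior_subset (hupI ⟨hz, h⟩)

end PolygonalDisk




/-! ### Angles and convexity of polygons at points other than vertices. -/

namespace PolygonalDisk

variable (P : PolygonalDisk)

theorem mem_interior_or_mem_openSegment {x : ℂ} (hx : x ∈ P.carrier) (hv : ∀ k, x ≠ P.v k) :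
    x ∈ interior P.carrier ∨ ∃ k, x ∈ openSegment ℝ (P.v k) (P.v (k + 1)) := by
  by_cases hxi : x ∈ interior P.carrier
  · exact Or.inl hxi
  · have hxf : x ∈ frontier P.carrier := by
      rw [P.isCompact.isClosed.frontier_eq]; exact ⟨hx, hxi⟩
    rw [P.frontier_eq, mem_iUnion] at hxf
    obtain ⟨k, hk⟩ := hxf
    rw [← insert_endpoints_openSegment] at hk
    rcases hk with hk | hk | hk
    · exact absurd hk (hv k)
    · exact absurd hk (hv (k + 1))
    · exact Or.inr ⟨k, hk⟩

/-- A small circle around `x` lies in the polygon, so all directions occur, and an angular interval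
shorter than a full turn cannot contain them. -/
theorem eq_add_two_pi_of_mem_interior {x : ℂ} {r a b : ℝ} (hr : 0 < r)
    (hb : b ≤ a + 2 * Real.pi) (hx : x ∈ interior P.carrier)
    (hsec : P.carrier ∩ Metric.ball x r = planarSector x r a b) : b = a + 2 * Real.pi := by
  by_contra hne
  obtain ⟨ρ, hρ, hball⟩ := Metric.mem_nhds_iff.1 (mem_interior_iff_mem_nhds.1 hx)
  have hlt : b - a < 2 * Real.pi := by
    have := lt_of_le_of_ne hb hne
    linarith
  have hpi := Real.pi_pos
  set s := min r ρ / 2 with hs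
  have hs0 : 0 < s := half_pos (lt_min hr hρ)
  have hsr : s < r := (half_lt_self (lt_min hr hρ)).trans_le (min_le_left _ _)
  have hsρ : s < ρ := (half_lt_self (lt_min hr hρ)).trans_le (min_le_right _ _)
  obtain ⟨n, h1, h2⟩ := exists_int_of_forall_isAngleIn (a := 0) (b := 2 * Real.pi) (by positivity)
    hlt fun θ _ => by
      rw [← mem_planarSector_iff (x := x) (r := r) ⟨hs0, hsr⟩, ← hsec]
      have hd : dist (x + s * Complex.exp (θ * Complex.I)) x = s := by
        rw [dist_eq_norm, add_sub_cancel_left, IsPolarChart.norm_ofReal_mul_exp hs0.le]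
      exact ⟨hball (by rwa [Metric.mem_ball, hd]), by rwa [Metric.mem_ball, hd]⟩
  linarith

/-- Near `x` the polygon is the half-plane to the left of the edge. Its directions form the half
turn starting at the direction of the edge, and angular intervals shorter than a full turn are
determined modulo `2π`. -/
theorem eq_add_pi_of_mem_openSegment {k : Fin (P.extraSides + 3)} {x : ℂ} {r a b : ℝ} (hr : 0 < r)
    (hab : a < b) (hx : x ∈ openSegment ℝ (P.v k) (P.v (k + 1)))
    (hsec : P.carrier ∩ Metric.ball x r = planarSector x r a b) :
    b = a + Real.pi ∧ P.v (k + 1) - P.v k =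
      (dist (P.v k) (P.v (k + 1)) : ℂ) * Complex.exp (a * Complex.I) := by
  obtain ⟨ρ, hρ, hmem⟩ := P.exists_mem_carrier_iff_of_mem_openSegment hx
  set u := P.v (k + 1) - P.v k with hu
  have hu0 : u ≠ 0 := by
    rw [hu, sub_ne_zero]
    exact fun h => absurd (P.v_injective h) (by simp)
  have hun : 0 < ‖u‖ := norm_pos_iff.2 hu0
  have hpi := Real.pi_pos
  set s := min r ρ / 2 with hs
  have hs0 : 0 < s := half_pos (lt_min hr hρ)
  have hsr : s < r := (half_lt_self (lt_min hr hρ)).trans_le (min_le_left _ _)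
  have hsρ : s < ρ := (half_lt_self (lt_min hr hρ)).trans_le (min_le_right _ _)
  have hupol : (‖u‖ : ℂ) * Complex.exp (u.arg * Complex.I) = u := Complex.norm_mul_exp_arg_mul_I u
  obtain ⟨n, h1, h2⟩ := exists_int_of_isAngleIn_iff (c := u.arg) (d := u.arg + Real.pi) hab.le
    (by linarith) (by linarith) fun θ => by
      have e1 := isAngleIn_add_iff (a := 0) (b := Real.pi) (c := u.arg) (θ := θ)
      rw [add_zero] at e1
      rw [e1, isAngleIn_zero_pi_iff, ← mem_planarSector_iff (x := x) (r := r) ⟨hs0, hsr⟩, ← hsec]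
      have hd : dist (x + s * Complex.exp (θ * Complex.I)) x = s := by
        rw [dist_eq_norm, add_sub_cancel_left, IsPolarChart.norm_ofReal_mul_exp hs0.le]
      rw [mem_inter_iff, Metric.mem_ball, hd, and_iff_left hsr, hmem _ (by rwa [hd]),
        add_sub_cancel_left]
      have e2 : (s : ℂ) * Complex.exp (θ * Complex.I) * (starRingEnd ℂ) u =
          ((s * ‖u‖ : ℝ) : ℂ) * Complex.exp ((θ - u.arg : ℝ) * Complex.I) := by
        nth_rw 1 [← hupol]
        rw [map_mul, Complex.conj_ofReal, ← Complex.exp_conj, map_mul, Complex.conj_ofReal,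
          Complex.conj_I, Complex.ofReal_sub, sub_mul, sub_eq_add_neg, Complex.exp_add]
        push_cast
        rw [mul_neg]
        ring
      rw [e2, Complex.im_ofReal_mul, Complex.exp_ofReal_mul_I_im]
      exact mul_nonneg_iff_of_pos_left (mul_pos hs0 hun)
  refine ⟨by linarith, ?_⟩
  rw [dist_comm, dist_eq_norm, ← hu]
  nth_rw 1 [← hupol]
  congr 1
  exact exp_ofReal_mul_I_eq_iff.2 ⟨-n, by rw [h1]; push_cast; ring⟩

theorem exists_forall_convex {x : ℂ} (hx : x ∈ P.carrier) (hv : ∀ k, x ≠ P.v k) :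
    ∃ ρ > 0, ∀ s ≤ ρ, Convex ℝ (P.carrier ∩ Metric.ball x s) := by
  rcases P.mem_interior_or_mem_openSegment hx hv with h | ⟨k, h⟩
  · obtain ⟨ρ, hρ, hball⟩ := Metric.mem_nhds_iff.1 (mem_interior_iff_mem_nhds.1 h)
    refine ⟨ρ, hρ, fun s hs => ?_⟩
    rw [inter_eq_right.2 ((Metric.ball_subset_ball hs).trans hball)]
    exact convex_ball _ _
  · obtain ⟨ρ, hρ, hmem⟩ := P.exists_mem_carrier_iff_of_mem_openSegment h
    refine ⟨ρ, hρ, fun s hs => ?_⟩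
    set u := P.v (k + 1) - P.v k
    have hlin : IsLinearMap ℝ fun z : ℂ => (z * (starRingEnd ℂ) u).im :=
      ⟨fun a b => by rw [add_mul, Complex.add_im], fun c a => by
        rw [smul_mul_assoc, Complex.smul_im]⟩
    have : P.carrier ∩ Metric.ball x s =
        {z | (x * (starRingEnd ℂ) u).im ≤ (z * (starRingEnd ℂ) u).im} ∩ Metric.ball x s := by
      ext z
      refine and_congr_left fun hz => ?_
      rw [hmem z (lt_of_lt_of_le hz hs), sub_mul, Complex.sub_im, sub_nonneg]
      rfl
    rw [this]
    exact (convex_halfSpace_ge hlin _).inter (convex_ball _ _)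

end PolygonalDisk

/-! ### Natural charts have exponent one off the vertices. -/

namespace PolyhedralRiemannSurface

variable {Y : Type*} [MetricSpace Y] (S : PolyhedralRiemannSurface Y)

/-- The vertices of a polyhedral surface. -/
def vertices : Set Y := ⋃ i, range fun k => S.glue i ((S.poly i).v k)

theorem finite_vertices : S.vertices.Finite := by
  have := S.finite_face
  exact finite_iUnion fun i => finite_range _

variable {S} {y : Y} {r α : ℝ} {ψ : Y → ℂ}

theorem ne_of_notMem_vertices (hy : y ∉ S.vertices) {i : S.Face} {x : ℂ} (hxy : S.glue i x = y) :
    ∀ k, x ≠ (S.poly i).v k := by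
  rintro k rfl
  exact hy (mem_iUnion.2 ⟨i, k, hxy⟩)

namespace IsNaturalChart

theorem exp_eq_of_exp_eq (hψ : S.IsNaturalChart y r α ψ) {i : S.Face} {x : ℂ}
    (hx : x ∈ (S.poly i).carrier) (hxy : S.glue i x = y) {a b β : ℝ}
    (hsec : (S.poly i).carrier ∩ Metric.ball x r = planarSector x r a b)
    (hmap : ∀ s ∈ Ico 0 r, ∀ θ ∈ Icc a b, ψ (S.glue i (x + s * Complex.exp (θ * Complex.I))) =
      (s ^ α : ℝ) * Complex.exp ((α * θ + β : ℝ) * Complex.I)) {θ θ' : ℝ} (hθ : θ ∈ Icc a b)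
    (hθ' : θ' ∈ Icc a b) (h : Complex.exp ((α * θ + β : ℝ) * Complex.I) =
      Complex.exp ((α * θ' + β : ℝ) * Complex.I)) :
    Complex.exp (θ * Complex.I) = Complex.exp (θ' * Complex.I) := by
  have hr := hψ.r_pos
  have hs : r / 2 ∈ Ioo 0 r := ⟨half_pos hr, half_lt_self hr⟩
  have hmem : ∀ θ ∈ Icc a b, x + (r / 2 : ℝ) * Complex.exp (θ * Complex.I) ∈
      (S.poly i).carrier ∩ Metric.ball x r := fun θ hθ => by
    rw [hsec, mem_planarSector_iff hs]
    exact ⟨θ, hθ, rfl⟩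
  have hinj := injOn_iff_injective.2 hψ.isEmbedding.injective
  have h1 := hinj ⟨i, x, hx, hxy, _, hmem θ hθ, rfl⟩ ⟨i, x, hx, hxy, _, hmem θ' hθ', rfl⟩
    (by rw [hmap _ ⟨hs.1.le, hs.2⟩ θ hθ, hmap _ ⟨hs.1.le, hs.2⟩ θ' hθ', h])
  have h2 := add_left_cancel (S.glue_injOn i (hmem θ hθ).1 (hmem θ' hθ').1 h1)
  exact (eq_and_exp_eq_of_mul_exp_eq hs.1 hs.1.le h2).2

/-- For `α ≥ 2` the two directions `a` and `a + 2π / α` both belong to the sector and have the same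
image, against injectivity of the chart. -/
theorem lt_two (hψ : S.IsNaturalChart y r α ψ) {i : S.Face} {x : ℂ}
    (hx : x ∈ (S.poly i).carrier) (hxy : S.glue i x = y) {a b β : ℝ} (hab : a + Real.pi ≤ b)
    (hsec : (S.poly i).carrier ∩ Metric.ball x r = planarSector x r a b)
    (hmap : ∀ s ∈ Ico 0 r, ∀ θ ∈ Icc a b, ψ (S.glue i (x + s * Complex.exp (θ * Complex.I))) =
      (s ^ α : ℝ) * Complex.exp ((α * θ + β : ℝ) * Complex.I)) : α < 2 := by
  by_contra! hα
  have hpi := Real.pi_pos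
  have hα0 := hψ.α_pos
  have h1 : 2 * Real.pi / α ≤ Real.pi := by
    rw [div_le_iff₀ hα0]
    nlinarith
  have h2 : 0 < 2 * Real.pi / α := by positivity
  have h3 := hψ.exp_eq_of_exp_eq hx hxy hsec hmap (θ := a + 2 * Real.pi / α) (θ' := a)
    ⟨by linarith, by linarith⟩ ⟨le_rfl, by linarith⟩
    (exp_ofReal_mul_I_eq_iff.2 ⟨1, by field_simp; push_cast; ring⟩)
  obtain ⟨n, hn⟩ := exp_ofReal_mul_I_eq_iff.1 h3
  have h4 : 2 * Real.pi / α = n * (2 * Real.pi) := by linarith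
  rw [h4] at h1 h2
  have h5 : (0 : ℝ) < n := by
    by_contra! hle
    nlinarith
  have h6 : (n : ℝ) < 1 := by
    by_contra! hle
    nlinarith
  have h5' : 0 < n := by exact_mod_cast h5
  have h6' : n < 1 := by exact_mod_cast h6
  omega

theorem eq_one_of_mul_two_pi {n : ℤ} (h : α * (2 * Real.pi) = n * (2 * Real.pi)) (h0 : 0 < α)
    (h2 : α < 2) : α = 1 := by
  have h1 : α = n := mul_right_cancel₀ (by positivity) h
  subst h1
  have h0' : 0 < n := by exact_mod_cast h0
  have h2' : n < 2 := by exact_mod_cast h2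
  have : n = 1 := by omega
  rw [this, Int.cast_one]

/-- Inside a face the full-turn sector has to close up, so `α` is an integer. On a shared edge two
half turns have to close up, again making `α` an integer. As `0 < α < 2`, both cases give one. On a
free edge a half turn is mapped to an angle `α * π < 2π`, which cannot fill a disk and fills a
half-disk only for `α = 1`. -/
theorem power_eq_one (hψ : S.IsNaturalChart y r α ψ) (hy : y ∉ S.vertices) : α = 1 := by
  have hpi := Real.pi_pos
  have hr := hψ.r_pos
  have hα0 := hψ.α_pos
  obtain ⟨i, x, hx, hxy⟩ := S.glue_covers y
  obtain ⟨a, b, β, hab, hb, hsec, hmap⟩ := hψ.sector i x hx hxy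
  rcases (S.poly i).mem_interior_or_mem_openSegment hx (ne_of_notMem_vertices hy hxy) with
    hint | ⟨k, hk⟩
  · have hba := (S.poly i).eq_add_two_pi_of_mem_interior hr hb hint hsec
    have hlt := hψ.lt_two hx hxy (by linarith) hsec hmap
    have hs : r / 2 ∈ Ico 0 r := ⟨(half_pos hr).le, half_lt_self hr⟩
    have e : Complex.exp (b * Complex.I) = Complex.exp (a * Complex.I) :=
      exp_ofReal_mul_I_eq_iff.2 ⟨1, by rw [hba]; push_cast; ring⟩
    have h1 := hmap _ hs b ⟨hab.le, le_rfl⟩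
    rw [e, hmap _ hs a ⟨le_rfl, hab.le⟩] at h1
    have hpos : 0 < (r / 2) ^ α := Real.rpow_pos_of_pos (half_pos hr) _
    obtain ⟨n, hn⟩ := exp_ofReal_mul_I_eq_iff.1 (eq_and_exp_eq_of_mul_exp_eq hpos hpos.le h1.symm).2
    refine eq_one_of_mul_two_pi (n := n) ?_ hα0 hlt
    rw [hba] at hn
    linarith
  · obtain ⟨hba, hua⟩ := (S.poly i).eq_add_pi_of_mem_openSegment hr hab hk hsec
    have hlt := hψ.lt_two hx hxy hba.ge hsec hmap
    by_cases hother : ∃ j, j ≠ i ∧ ∃ x' ∈ (S.poly j).carrier, S.glue j x' = y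
    · obtain ⟨j, hji, x', hx', hxy'⟩ := hother
      obtain ⟨a', b', β', hab', hb', hsec', hmap'⟩ := hψ.sector j x' hx' hxy'
      obtain ⟨l, hl⟩ : ∃ l, x' ∈ openSegment ℝ ((S.poly j).v l) ((S.poly j).v (l + 1)) := by
        refine ((S.poly j).mem_interior_or_mem_openSegment hx'
          (ne_of_notMem_vertices hy hxy')).resolve_left fun hint => ?_
        have := S.glue_boundary j i hji x' hx' x hx (hxy'.trans hxy.symm)
        exact this.2 hint
      obtain ⟨hba', hua'⟩ := (S.poly j).eq_add_pi_of_mem_openSegment hr hab' hl hsec'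
      obtain ⟨hlen, hedge⟩ := S.glue_edge i j k l hji.symm ⟨x, hk, x', hl, hxy.trans hxy'.symm⟩
      set d := dist ((S.poly i).v k) ((S.poly i).v (k + 1)) with hd
      rw [← hlen] at hua'
      have hd0 : 0 < d := dist_pos.2 fun h => absurd ((S.poly i).v_injective h) (by simp)
      rw [openSegment_eq_image_lineMap] at hk
      obtain ⟨t, ht, rfl⟩ := hk
      have hle : ∀ s : ℝ, (AffineMap.lineMap ((S.poly i).v k) ((S.poly i).v (k + 1)) s : ℂ) =
          (S.poly i).v k + s * (d * Complex.exp (a * Complex.I)) := fun s => by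
        rw [← hua]; simp [AffineMap.lineMap_apply]; ring
      have hle' : ∀ s : ℝ, (AffineMap.lineMap ((S.poly j).v (l + 1)) ((S.poly j).v l) s : ℂ) =
          (S.poly j).v (l + 1) - s * (d * Complex.exp (a' * Complex.I)) := fun s => by
        rw [← hua']; simp [AffineMap.lineMap_apply]; ring
      have hsub : segment ℝ ((S.poly j).v l) ((S.poly j).v (l + 1)) ⊆ (S.poly j).carrier :=
        fun z hz => (S.poly j).isCompact.isClosed.frontier_subset (by
          rw [(S.poly j).frontier_eq]; exact mem_iUnion.2 ⟨l, hz⟩)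
      have hx'eq : x' = AffineMap.lineMap ((S.poly j).v (l + 1)) ((S.poly j).v l) t := by
        refine S.glue_injOn j hx' (hsub ?_) ?_
        · rw [segment_symm, segment_eq_image_lineMap]
          exact ⟨t, ⟨ht.1.le, ht.2.le⟩, rfl⟩
        · rw [← hedge t ⟨ht.1.le, ht.2.le⟩, hxy, hxy']
      -- Moving by `s` along the edge in either direction stays within the edge and within the
      -- chart.
      set s := min (r / 2) (d * min t (1 - t)) with hs
      have hs0 : 0 < s := lt_min (half_pos hr) (mul_pos hd0 (lt_min ht.1 (by linarith [ht.2])))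
      have hsr : s < r := (min_le_left _ _).trans_lt (half_lt_self hr)
      have hst : s / d ≤ min t (1 - t) := by
        rw [div_le_iff₀ hd0, mul_comm]; exact min_le_right _ _
      have hsd : 0 < s / d := by positivity
      have hpos : 0 < s ^ α := Real.rpow_pos_of_pos hs0 _
      have hdc : (d : ℂ) ≠ 0 := Complex.ofReal_ne_zero.2 hd0.ne'
      have hneg : ∀ c : ℝ, Complex.exp ((c + Real.pi : ℝ) * Complex.I) =
          -Complex.exp (c * Complex.I) := fun c => by
        push_cast
        rw [add_mul, Complex.exp_add, Complex.exp_pi_mul_I]; ring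
      have hsI : s ∈ Ico 0 r := ⟨hs0.le, hsr⟩
      -- Edges are glued in opposite directions: forward along the edge of `i`, at angle `a`, is
      -- backward along the edge of `j`, at angle `b' = a' + π`. The next claim is the reverse
      -- direction.
      have e1 : S.glue i (AffineMap.lineMap ((S.poly i).v k) ((S.poly i).v (k + 1)) t +
          s * Complex.exp (a * Complex.I)) = S.glue j (x' + s * Complex.exp (b' * Complex.I)) := by
        have h1 := hedge (t + s / d) ⟨by linarith [ht.1], by linarith [min_le_right t (1 - t)]⟩
        rw [hle, hle'] at h1
        rw [hle, hx'eq, hle', hba', hneg]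
        convert h1 using 2
        · push_cast; field_simp; ring
        · push_cast; field_simp; ring
      have e2 : S.glue i (AffineMap.lineMap ((S.poly i).v k) ((S.poly i).v (k + 1)) t +
          s * Complex.exp (b * Complex.I)) = S.glue j (x' + s * Complex.exp (a' * Complex.I)) := by
        have h1 := hedge (t - s / d) ⟨by linarith [min_le_left t (1 - t)], by linarith [ht.2]⟩
        rw [hle, hle'] at h1
        rw [hle, hx'eq, hle', hba, hneg]
        convert h1 using 2
        · push_cast; field_simp; ring
        · push_cast; field_simp; ring
      have f1 := congrArg ψ e1
      have f2 := congrArg ψ e2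
      rw [hmap s hsI a ⟨le_rfl, hab.le⟩, hmap' s hsI b' ⟨hab'.le, le_rfl⟩] at f1
      rw [hmap s hsI b ⟨hab.le, le_rfl⟩, hmap' s hsI a' ⟨le_rfl, hab'.le⟩] at f2
      obtain ⟨n, hn⟩ := exp_ofReal_mul_I_eq_iff.1 (eq_and_exp_eq_of_mul_exp_eq hpos hpos.le f1).2
      obtain ⟨m, hm⟩ := exp_ofReal_mul_I_eq_iff.1 (eq_and_exp_eq_of_mul_exp_eq hpos hpos.le f2).2
      -- Subtracting the two congruences cancels `β` and `β'` and leaves `2 * α * π` as an integral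
      -- multiple of `2π`.
      refine eq_one_of_mul_two_pi (n := m - n) ?_ hα0 hlt
      rw [hba] at hm
      rw [hba'] at hn
      push_cast
      linarith
    · push Not at hother
      have hpos : 0 < (r / 2) ^ α := Real.rpow_pos_of_pos (half_pos hr) _
      -- Only one face contains `y`, so the directions in the image of the star are exactly those of
      -- one sector, stretched by `α` and rotated by `β`.
      have hstar : ∀ θ : ℝ, ((r / 2) ^ α : ℝ) * Complex.exp (θ * Complex.I) ∈ ψ '' S.star y r ↔
          IsAngleIn (α * a + β) (α * b + β) θ := by
        intro θ
        constructor
        · rintro ⟨p, ⟨j, x', hx', hxy', z', hz', rfl⟩, hpz⟩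
          obtain rfl : j = i := by
            by_contra hji
            exact hother j hji x' hx' hxy'
          obtain rfl : x' = x := S.glue_injOn j hx' hx (hxy'.trans hxy.symm)
          rw [hsec] at hz'
          obtain ⟨s, hs, θ', hθ', rfl⟩ := hz'
          rw [hmap s hs θ' hθ'] at hpz
          refine ⟨α * θ' + β, ⟨?_, ?_⟩, (eq_and_exp_eq_of_mul_exp_eq hpos
            (Real.rpow_nonneg hs.1 _) hpz.symm).2⟩
          · have := mul_le_mul_of_nonneg_left hθ'.1 hα0.le
            linarith
          · have := mul_le_mul_of_nonneg_left hθ'.2 hα0.le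
            linarith
        · rintro ⟨θ', hθ', he⟩
          have hθ'' : (θ' - β) / α ∈ Icc a b := by
            constructor
            · rw [le_div_iff₀ hα0]; linarith [hθ'.1]
            · rw [div_le_iff₀ hα0]; linarith [hθ'.2]
          refine ⟨S.glue i (x + (r / 2 : ℝ) * Complex.exp (((θ' - β) / α : ℝ) * Complex.I)),
            ⟨i, x, hx, hxy, _, ?_, rfl⟩, ?_⟩
          · rw [hsec]
            exact ⟨_, ⟨(half_pos hr).le, half_lt_self hr⟩, _, hθ'', rfl⟩
          · rw [hmap _ ⟨(half_pos hr).le, half_lt_self hr⟩ _ hθ'', he]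
            congr 4
            field_simp; ring
      have hball : ∀ θ : ℝ, ((r / 2) ^ α : ℝ) * Complex.exp (θ * Complex.I) ∈
          Metric.ball (0 : ℂ) (r ^ α) := fun θ => by
        rw [mem_ball_zero_iff, IsPolarChart.norm_ofReal_mul_exp hpos.le]
        exact Real.rpow_lt_rpow (half_pos hr).le (half_lt_self hr) hα0
      have hαb : α * b = α * a + α * Real.pi := by rw [hba]; ring
      have hαpi : α * Real.pi < 2 * Real.pi := mul_lt_mul_of_pos_right hlt hpi
      have hαpi0 : 0 < α * Real.pi := by positivity
      rcases hψ.image_eq with him | him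
      · obtain ⟨n, h1, h2⟩ := exists_int_of_forall_isAngleIn (a := 0) (b := 2 * Real.pi)
          (c := α * a + β) (d := α * b + β) (by positivity) (by linarith) fun θ _ => by
            rw [← hstar, him]
            exact hball θ
        linarith
      · obtain ⟨n, h1, h2⟩ := exists_int_of_isAngleIn_iff (a := α * a + β) (b := α * b + β)
          (c := 0) (d := Real.pi) (by linarith) hpi.le (by linarith) fun θ => by
            rw [← hstar, him, isAngleIn_zero_pi_iff, mem_inter_iff, and_iff_right (hball θ),
              Set.mem_ofPred_eq, Complex.im_ofReal_mul, Complex.exp_ofReal_mul_I_im]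
            exact mul_nonneg_iff_of_pos_left hpos
        refine mul_right_cancel₀ hpi.ne' ?_
        linarith

end IsNaturalChart

end PolyhedralRiemannSurface




/-! ### Natural charts are local isometries off the vertices. -/

namespace PolyhedralRiemannSurface

variable {Y : Type*} [MetricSpace Y] {S : PolyhedralRiemannSurface Y} {y : Y} {r α : ℝ} {ψ : Y → ℂ}

theorem HasCharts.isCompact_glue_image (hS : S.HasCharts) (i : S.Face) {s : Set ℂ}
    (hs : IsClosed s) : IsCompact (S.glue i '' ((S.poly i).carrier ∩ s)) :=
  ((S.poly i).isCompact.inter_right hs).image_of_continuousOn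
    ((hS.continuousOn_glue i).mono inter_subset_left)

/-- Points near `y` lie in small neighbourhoods of the preimages of `y` in all faces. -/
theorem HasCharts.eventually_mem_ball (hS : S.HasCharts) (y : Y) {ρ : ℝ} (hρ : 0 < ρ) :
    ∀ᶠ p in 𝓝 y, ∀ i, ∀ z ∈ (S.poly i).carrier, S.glue i z = p →
      ∃ x ∈ (S.poly i).carrier, S.glue i x = y ∧ z ∈ Metric.ball x ρ := by
  have := S.finite_face
  refine eventually_all.2 fun i => ?_
  set s : Set ℂ := (⋃ x ∈ {x ∈ (S.poly i).carrier | S.glue i x = y}, Metric.ball x ρ)ᶜ with hs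
  have hcl : IsClosed s := (isOpen_biUnion fun _ _ => Metric.isOpen_ball).isClosed_compl
  have hy : y ∉ S.glue i '' ((S.poly i).carrier ∩ s) := by
    rintro ⟨x, ⟨hx, hxs⟩, hxy⟩
    exact hxs (mem_biUnion (x := x) ⟨hx, hxy⟩ (Metric.mem_ball_self hρ))
  filter_upwards [(hS.isCompact_glue_image i hcl).isClosed.isOpen_compl.mem_nhds hy]
    with p hp z hz hzp
  by_contra! hcon
  refine hp ⟨z, ⟨hz, fun hmem => ?_⟩, hzp⟩
  obtain ⟨x, hx, hzx⟩ := mem_iUnion₂.1 hmem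
  exact hcon x hx.1 hx.2 hzx

namespace IsNaturalChart

theorem exists_rigid (hψ : S.IsNaturalChart y r α ψ) (hy : y ∉ S.vertices) (i : S.Face) {x : ℂ}
    (hx : x ∈ (S.poly i).carrier) (hxy : S.glue i x = y) :
    ∃ c : ℂ, ‖c‖ = 1 ∧ ∀ z ∈ (S.poly i).carrier ∩ Metric.ball x r,
      ψ (S.glue i z) = c * (z - x) := by
  obtain ⟨a, b, β, -, -, hsec, hmap⟩ := hψ.sector i x hx hxy
  refine ⟨Complex.exp (β * Complex.I), Complex.norm_exp_ofReal_mul_I _, fun z hz => ?_⟩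
  rw [hsec] at hz
  obtain ⟨s, hs, θ, hθ, rfl⟩ := hz
  rw [hmap s hs θ hθ, hψ.power_eq_one hy, Real.rpow_one, one_mul, add_sub_cancel_left]
  push_cast
  rw [add_mul, Complex.exp_add]
  ring

theorem dist_eq_of_mem (hψ : S.IsNaturalChart y r α ψ) (hy : y ∉ S.vertices) (i : S.Face) {x : ℂ}
    (hx : x ∈ (S.poly i).carrier) (hxy : S.glue i x = y) {z z' : ℂ}
    (hz : z ∈ (S.poly i).carrier ∩ Metric.ball x r)
    (hz' : z' ∈ (S.poly i).carrier ∩ Metric.ball x r) :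
    dist (ψ (S.glue i z)) (ψ (S.glue i z')) = dist z z' := by
  obtain ⟨c, hc, h⟩ := hψ.exists_rigid hy i hx hxy
  rw [h z hz, h z' hz', dist_eq_norm, ← mul_sub, sub_sub_sub_cancel_right, norm_mul, hc, one_mul,
    dist_eq_norm]

/-- A chain from `p` of length less than `2 * ρ / 3` stays within `ρ` of `y`, hence in the sectors
on which the chart is rigid. There each step of the chain is at least as long as the displacement of
its image. -/
theorem eventually_dist_le (hψ : S.IsNaturalChart y r α ψ) (hS : S.HasCharts)
    (hy : y ∉ S.vertices) :
    ∀ᶠ p in 𝓝 y ×ˢ 𝓝 y, dist (ψ p.1) (ψ p.2) ≤ dist p.1 p.2 := by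
  obtain ⟨ρ, hρ, hball⟩ := Metric.eventually_nhds_iff.1 (hS.eventually_mem_ball y hψ.r_pos)
  have hU : Metric.ball y (ρ / 3) ∈ 𝓝 y := Metric.ball_mem_nhds _ (by positivity)
  filter_upwards [prod_mem_prod hU hU] with pq hpq
  obtain ⟨p, q⟩ := pq
  obtain ⟨hp, hq⟩ : dist p y < ρ / 3 ∧ dist q y < ρ / 3 := hpq
  have hpqρ : edist p q < ENNReal.ofReal (2 * ρ / 3) := by
    rw [edist_lt_ofReal]
    linarith [dist_triangle_right p q y]
  have hnear : ∀ z s, edist p z ≤ s → s < ENNReal.ofReal (2 * ρ / 3) → dist z y < ρ :=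
    fun z s h1 h2 => by
      have h3 := edist_lt_ofReal.1 (h1.trans_lt h2)
      linarith [dist_triangle_left z y p]
  have key : edist (ψ p) (ψ q) ≤ edist p q := by
    refine le_of_forall_gt_imp_ge_of_dense fun b hb => ?_
    obtain ⟨s, hsb, hs⟩ := S.exists_of_edist_lt (p := p) (q := q)
      (Q := fun q s => s < ENNReal.ofReal (2 * ρ / 3) →
        edist p q ≤ s ∧ edist (ψ p) (ψ q) ≤ s) (fun _ => by simp) (by
        intro i x hx z hz s hs hlt
        have h1 := hs (le_self_add.trans_lt hlt)
        have hxz := S.edist_glue_le hx hz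
        have h2 : edist p (S.glue i z) ≤ s + innerEDist (S.poly i).carrier x z :=
          (edist_triangle _ _ _).trans (add_le_add h1.1 hxz)
        refine ⟨h2, (edist_triangle _ _ _).trans (add_le_add h1.2 ?_)⟩
        obtain ⟨x₀, hx₀, hx₀y, hxb⟩ := hball (hnear _ _ h1.1 (le_self_add.trans_lt hlt)) i x hx rfl
        obtain ⟨x₁, hx₁, hx₁y, hzb⟩ := hball (hnear _ _ h2 hlt) i z hz rfl
        obtain rfl := S.glue_injOn i hx₀ hx₁ (hx₀y.trans hx₁y.symm)
        rw [edist_dist, hψ.dist_eq_of_mem hy i hx₀ hx₀y ⟨hx, hxb⟩ ⟨hz, hzb⟩, ← edist_dist]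
        exact edist_le_innerEDist _ _ _) (lt_min hb hpqρ)
    exact (hs (hsb.trans_le (min_le_right _ _))).2.trans (hsb.le.trans (min_le_left _ _))
  rwa [edist_dist, edist_dist, ENNReal.ofReal_le_ofReal_iff dist_nonneg] at key

theorem exists_forall_convex (hy : y ∉ S.vertices) :
    ∃ ρ > 0, ∀ i, ∀ x ∈ (S.poly i).carrier, S.glue i x = y →
      ∀ s ≤ ρ, Convex ℝ ((S.poly i).carrier ∩ Metric.ball x s) := by
  have := S.finite_face
  have key : ∀ᶠ ρ : ℝ in 𝓝[>] 0, ∀ i, ∀ x ∈ (S.poly i).carrier, S.glue i x = y →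
      ∀ s ≤ ρ, Convex ℝ ((S.poly i).carrier ∩ Metric.ball x s) := by
    refine eventually_all.2 fun i => ?_
    by_cases hx : ∃ x ∈ (S.poly i).carrier, S.glue i x = y
    · obtain ⟨x, hx, hxy⟩ := hx
      obtain ⟨ρ, hρ, h⟩ := (S.poly i).exists_forall_convex hx (ne_of_notMem_vertices hy hxy)
      filter_upwards [Ioo_mem_nhdsGT hρ] with ρ' hρ' x' hx' hxy' s hs
      obtain rfl := S.glue_injOn i hx hx' (hxy.trans hxy'.symm)
      exact h s (hs.trans hρ'.2.le)
    · push Not at hx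
      exact Eventually.of_forall fun ρ x hx' hxy => absurd hxy (hx x hx')
  obtain ⟨ρ, h1, h2⟩ := (key.and self_mem_nhdsWithin).exists
  exact ⟨ρ, h2, h1⟩

theorem exists_section (hψ : S.IsNaturalChart y r α ψ) : ∃ g : ℂ → Y,
    ContinuousOn g (ψ '' S.star y r) ∧ (∀ p ∈ S.star y r, g (ψ p) = p) := by
  classical
  set e := hψ.isEmbedding.toHomeomorph
  have hrange : ψ '' S.star y r = range ((S.star y r).domRestrict ψ) := by
    rw [Set.range_domRestrict]
  refine ⟨fun w => if hw : w ∈ range ((S.star y r).domRestrict ψ) then (e.symm ⟨w, hw⟩ : Y) else y,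
    ?_, fun p hp => ?_⟩
  · rw [hrange, continuousOn_iff_continuous_domRestrict]
    refine (continuous_subtype_val.comp e.symm.continuous).congr fun w => ?_
    simp only [Set.domRestrict_apply, Function.comp]
    rw [dif_pos w.2]
  · have hw : ψ p ∈ range ((S.star y r).domRestrict ψ) := ⟨⟨p, hp⟩, rfl⟩
    simp only
    rw [dif_pos hw]
    have : (⟨ψ p, hw⟩ : range ((S.star y r).domRestrict ψ)) = e ⟨p, hp⟩ := rfl
    rw [this, e.symm_apply_apply]

/-- The straight segment between the images is lifted by the inverse chart; it stays in the image of
the star because a disk or a half-disk is convex. Locally the lift compares points of one face,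
where gluing does not increase distances since small relative disks are convex. -/
theorem eventually_le_dist (hψ : S.IsNaturalChart y r α ψ) (hS : S.HasCharts)
    (hy : y ∉ S.vertices) :
    ∀ᶠ p in 𝓝 y ×ˢ 𝓝 y, dist p.1 p.2 ≤ dist (ψ p.1) (ψ p.2) := by
  have := S.finite_face
  have hr := hψ.r_pos
  obtain ⟨ρ, hρ, hconv⟩ := exists_forall_convex hy
  obtain ⟨g, hgc, hg⟩ := hψ.exists_section
  set ρ' := min r ρ / 2 with hρ'
  have hρ'0 : 0 < ρ' := half_pos (lt_min hr hρ)
  have hρ'm : ρ' < min r ρ := half_lt_self (lt_min hr hρ)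
  have hρ'r : ρ' < r := hρ'm.trans_le (min_le_left _ _)
  have hstarmem : ∀ p ∈ S.star y r, ‖ψ p‖ < ρ' → ∃ i, ∃ x ∈ (S.poly i).carrier, S.glue i x = y ∧
      ∃ z ∈ (S.poly i).carrier ∩ Metric.closedBall x ρ', S.glue i z = p := by
    rintro p ⟨i, x, hx, hxy, z, hz, rfl⟩ hp
    refine ⟨i, x, hx, hxy, z, ⟨hz.1, ?_⟩, rfl⟩
    obtain ⟨c, hc, h⟩ := hψ.exists_rigid hy i hx hxy
    rw [h z hz, norm_mul, hc, one_mul, ← dist_eq_norm] at hp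
    exact hp.le
  set B := ψ '' S.star y r ∩ Metric.ball 0 ρ' with hB
  have hBconv : Convex ℝ B := by
    refine Convex.inter ?_ (convex_ball _ _)
    have hlin : IsLinearMap ℝ fun z : ℂ => z.im :=
      ⟨fun a b => Complex.add_im a b, fun c a => Complex.smul_im c a⟩
    rcases hψ.image_eq with h | h <;> rw [h]
    · exact convex_ball _ _
    · exact (convex_ball _ _).inter (convex_halfSpace_ge hlin _)
  have hU := hS.eventually_mem_ball y hρ'0
  have hUB : ∀ p, (∀ i, ∀ z ∈ (S.poly i).carrier, S.glue i z = p →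
      ∃ x ∈ (S.poly i).carrier, S.glue i x = y ∧ z ∈ Metric.ball x ρ') →
      p ∈ S.star y r ∧ ψ p ∈ B := by
    intro p hp
    obtain ⟨i, z, hz, rfl⟩ := S.glue_covers p
    obtain ⟨x, hx, hxy, hzx⟩ := hp i z hz rfl
    have hzr : z ∈ (S.poly i).carrier ∩ Metric.ball x r :=
      ⟨hz, Metric.ball_subset_ball hρ'r.le hzx⟩
    have hstar : S.glue i z ∈ S.star y r := ⟨i, x, hx, hxy, z, hzr, rfl⟩
    refine ⟨hstar, ⟨_, hstar, rfl⟩, ?_⟩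
    obtain ⟨c, hc, h⟩ := hψ.exists_rigid hy i hx hxy
    rw [mem_ball_zero_iff, h z hzr, norm_mul, hc, one_mul, ← dist_eq_norm]
    exact hzx
  filter_upwards [prod_mem_prod hU hU] with pq hpq
  obtain ⟨p, q⟩ := pq
  obtain ⟨hp, hpB⟩ := hUB p hpq.1
  obtain ⟨hq, hqB⟩ := hUB q hpq.2
  set w : ℝ → ℂ := fun t => AffineMap.lineMap (ψ p) (ψ q) t with hw
  have hwc : Continuous w := AffineMap.lineMap_continuous
  have hwB : ∀ t ∈ Icc (0 : ℝ) 1, w t ∈ B := fun t ht =>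
    hBconv.segment_subset hpB hqB (by rw [segment_eq_image_lineMap]; exact ⟨t, ht, rfl⟩)
  have hwg : ∀ t ∈ Icc (0 : ℝ) 1, g (w t) ∈ S.star y r ∧ ψ (g (w t)) = w t := fun t ht => by
    obtain ⟨p', hp', h⟩ := (hwB t ht).1
    rw [← h, hg p' hp']
    exact ⟨hp', rfl⟩
  have hgw : ContinuousOn (fun t => g (w t)) (Icc 0 1) :=
    hgc.comp hwc.continuousOn fun t ht => (hwB t ht).1
  have key : dist (g (w 0)) (g (w 1)) ≤ (1 - 0) * dist (ψ p) (ψ q) := by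
    refine rel_Icc_of_locally
      (R := fun s t => dist (g (w s)) (g (w t)) ≤ (t - s) * dist (ψ p) (ψ q)) zero_le_one
      (by simp) ?_ ?_
    · intro s t _ _ _ h1 h2
      have := dist_triangle (g (w 0)) (g (w s)) (g (w t))
      linarith
    · intro u hu
      -- Pieces of faces are compact in the surface and finite in number. So for `t` near `u`, every
      -- piece containing the lift at `t` also contains the lift at `u`.
      have hev : ∀ᶠ t in 𝓝[Icc 0 1] u, ∀ i, ∀ x ∈ (S.poly i).carrier, S.glue i x = y →
          g (w t) ∈ S.glue i '' ((S.poly i).carrier ∩ Metric.closedBall x ρ') →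
          g (w u) ∈ S.glue i '' ((S.poly i).carrier ∩ Metric.closedBall x ρ') := by
        refine eventually_all.2 fun i => ?_
        by_cases hx : ∃ x ∈ (S.poly i).carrier, S.glue i x = y
        · obtain ⟨x, hx, hxy⟩ := hx
          by_cases hmem : g (w u) ∈ S.glue i '' ((S.poly i).carrier ∩ Metric.closedBall x ρ')
          · refine Eventually.of_forall fun t x' hx' hxy' _ => ?_
            obtain rfl := S.glue_injOn i hx hx' (hxy.trans hxy'.symm)
            exact hmem
          · have hopen := (hS.isCompact_glue_image i
              (Metric.isClosed_closedBall (x := x) (ε := ρ'))).isClosed.isOpen_compl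
            filter_upwards [hgw u hu (hopen.mem_nhds hmem)] with t ht x' hx' hxy' ht'
            obtain rfl := S.glue_injOn i hx hx' (hxy.trans hxy'.symm)
            exact absurd ht' ht
        · push Not at hx
          exact Eventually.of_forall fun t x hx' hxy => absurd hxy (hx x hx')
      obtain ⟨δ, hδ, hball⟩ := Metric.mem_nhdsWithin_iff.1 hev
      have hdist : ∀ t ∈ Icc (0 : ℝ) 1, |t - u| < δ →
          dist (g (w t)) (g (w u)) ≤ |t - u| * dist (ψ p) (ψ q) := by
        intro t ht htu
        have hBt : ‖ψ (g (w t))‖ < ρ' := by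
          rw [(hwg t ht).2, ← mem_ball_zero_iff]
          exact (hwB t ht).2
        obtain ⟨i, x, hx, hxy, z, hz, hzt⟩ := hstarmem _ (hwg t ht).1 hBt
        obtain ⟨z', hz', hzu⟩ := hball ⟨by rwa [Metric.mem_ball, Real.dist_eq], ht⟩ i x hx hxy
          ⟨z, hz, hzt⟩
        have hsub : ∀ s, ρ' < s → (S.poly i).carrier ∩ Metric.closedBall x ρ' ⊆
            (S.poly i).carrier ∩ Metric.ball x s := fun s hs =>
          inter_subset_inter_right _ (Metric.closedBall_subset_ball hs)
        have h1 := (S.edist_glue_le hz.1 hz'.1).trans (innerEDist_le_of_segment_subset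
          (((hconv i x hx hxy _ (min_le_right _ _)).segment_subset (hsub _ hρ'm hz)
            (hsub _ hρ'm hz')).trans inter_subset_left))
        rw [edist_dist, edist_dist, ENNReal.ofReal_le_ofReal_iff dist_nonneg,
          ← hψ.dist_eq_of_mem hy i hx hxy (hsub r hρ'r hz) (hsub r hρ'r hz'), hzt, hzu,
          (hwg t ht).2, (hwg u hu).2, hw] at h1
        rwa [dist_lineMap_lineMap, Real.dist_eq] at h1
      refine ⟨δ, hδ, fun t ht => ⟨fun h1 h2 => ?_, fun h1 h2 => ?_⟩⟩
      · have := hdist t ht (by rw [abs_lt]; constructor <;> linarith)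
        rwa [abs_sub_comm, abs_of_nonneg (by linarith)] at this
      · have := hdist t ht (by rw [abs_lt]; constructor <;> linarith)
        rwa [abs_of_nonneg (by linarith), dist_comm] at this
  have e0 : w 0 = ψ p := AffineMap.lineMap_apply_zero _ _
  have e1 : w 1 = ψ q := AffineMap.lineMap_apply_one _ _
  rw [e0, e1, hg p hp, hg q hq, sub_zero, one_mul] at key
  exact key

end IsNaturalChart

/-- Off the vertices `ψ` preserves distances near its centre, so `h ∘ e` has the factor `|F' w|` by
strict differentiability; dividing by the factor of `e` gives that of `h`. -/
theorem IsConformalAlong.hasMetricDeriv {A : Type*} [MetricSpace A] {D : Set ℂ} {e : ℂ → A}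
    {h : A → Y} (hconf : S.IsConformalAlong D e h) (hS : S.HasCharts) (hh : Continuous h) {w : ℂ}
    (hw : w ∈ D) (hy : h (e w) ∉ S.vertices) (hec : ContinuousOn e D) {lam : ℝ} (hlam : 0 < lam)
    (he : HasMetricDeriv e lam (𝓝[D] w)) (hmap : 𝓝 (e w) ≤ map e (𝓝[D] w)) :
    ∃ μ : ℝ≥0, HasMetricDeriv h μ (𝓝 (e w)) := by
  obtain ⟨r, α, ψ, hψ, F, hF, -, hFψ⟩ := hconf w hw
  refine ⟨⟨‖deriv F w‖ / lam, by positivity⟩, ?_⟩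
  refine he.of_comp (f := h) (m := 𝓝 (e w)) (μ := ‖deriv F w‖) ?_ hlam hmap
  intro ε hε
  have hst := hF.hasStrictDerivAt.hasStrictFDerivAt.isLittleO.def hε
  rw [nhds_prod_eq] at hst
  have hle : 𝓝[D] w ≤ 𝓝 w := nhdsWithin_le_nhds
  have hcont : Tendsto (fun z => h (e z)) (𝓝[D] w) (𝓝 (h (e w))) :=
    (hh.tendsto (e w)).comp (hec w hw)
  filter_upwards [(hcont.prodMap hcont).eventually (hψ.eventually_dist_le hS hy),
    (hcont.prodMap hcont).eventually (hψ.eventually_le_dist hS hy), hFψ.prod_mk hFψ,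
    prod_mono hle hle hst] with p h1 h2 h3 h4
  have hd : dist (h (e p.1)) (h (e p.2)) = ‖F p.1 - F p.2‖ := by
    have := le_antisymm h2 h1
    simp only [Prod.map] at this
    rw [this, h3.1, h3.2, dist_eq_norm]
  simp only [Function.comp]
  rw [hd, dist_eq_norm]
  simp at h4
  have h5 : ‖deriv F w‖ * ‖p.1 - p.2‖ = ‖(p.1 - p.2) * deriv F w‖ := by rw [norm_mul, mul_comm]
  rw [h5]
  exact (abs_norm_sub_norm_le _ _).trans h4

end PolyhedralRiemannSurface

/-! ### Conformal homeomorphisms are metrically conformal. -/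

namespace ModelSurface.IsConformal

variable {Ω : ModelSurface} {Y : Type*} [MetricSpace Y] {S : PolyhedralRiemannSurface Y}
  {h : Ω.Carrier ≃ₜ Y}

/-- Conformality provides a natural chart at each image point, and `h` is onto. -/
theorem hasCharts (hh : Ω.IsConformal S h) : S.HasCharts := by
  intro y
  obtain ⟨e, D, w, lam, hconf, hw, hew, -⟩ := hh.exists_parametrization (h.symm y)
  obtain ⟨r, α, ψ, hψ, -⟩ := hconf w hw
  rw [hew, h.apply_symm_apply] at hψ
  exact ⟨r, α, ψ, hψ⟩

theorem exists_isMetricConformal (hh : Ω.IsConformal S h) :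
    ∃ (g : Ω.Carrier → ℝ≥0) (P : Finset Ω.Carrier), IsMetricConformal h g P := by
  classical
  have hfin : (h ⁻¹' S.vertices).Finite := S.finite_vertices.preimage h.injective.injOn
  have key : ∀ x, ∃ μ : ℝ≥0, x ∉ hfin.toFinset → HasMetricDeriv h μ (𝓝 x) := by
    intro x
    by_cases hx : x ∈ hfin.toFinset
    · exact ⟨0, fun h => absurd hx h⟩
    · obtain ⟨e, D, w, lam, hconf, hw, rfl, hlam, hec, he, hmap⟩ := hh.exists_parametrization x
      rw [Set.Finite.mem_toFinset] at hx
      obtain ⟨μ, hμ⟩ := hconf.hasMetricDeriv hh.hasCharts h.continuous hw hx hec hlam he hmap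
      exact ⟨μ, fun _ => hμ⟩
  choose μ hμ using key
  refine ⟨fun x => if x ∈ hfin.toFinset then 0 else μ x, hfin.toFinset, h.continuous,
    fun x hx => ?_, fun x hx => if_pos hx⟩
  rw [if_neg hx]
  exact hμ x hx

end ModelSurface.IsConformal




/-! ### Existence of a convergent subsequence, and the theorem. -/

theorem exists_subseq_of_isMetricConformal {A X : Type*} [MetricSpace A] [MeasurableSpace A]
    [BorelSpace A] [CompactSpace A] [Nonempty A] [∀ x : A, (𝓝[≠] x).NeBot]
    [MetricSpace X] [CompactSpace X] [MeasurableSpace X] [BorelSpace X]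
    {Y : ℕ → Type*} [∀ n, MetricSpace (Y n)] [∀ n, MeasurableSpace (Y n)] [∀ n, BorelSpace (Y n)]
    {f : ∀ n, Y n → X} {h : ∀ n, A ≃ₜ Y n} {g : ℕ → A → ℝ≥0} {P : ℕ → Finset A}
    (hchart : ∀ p : A, ∃ e D R L, IsPolarChart e D R L ∧ e 0 = p)
    (hconn : ∀ p : X, IsPreconnected ({p}ᶜ : Set X)) (hf : IsApproxIsometricSeq f)
    (hY : ∀ n, IsApproxGeodesic (Y n)) (hconf : ∀ n, IsMetricConformal (h n) (g n) (P n))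
    {M : ℝ≥0∞} (hM : M ≠ ∞) (hYM : ∀ᶠ n in atTop, hausdorffTwo (Y n) univ ≤ M)
    (hnorm : IsNormalizedSeq (fun n => (h n : A → Y n))) :
    ∃ φ : ℕ → ℕ, StrictMono φ ∧ (∀ n, hausdorffTwo (Y (φ n)) univ ≤ M) ∧
      ∃ H : A → X, Continuous H ∧
        TendstoUniformly (fun n x => f (φ n) (h (φ n) x)) H atTop := by
  obtain ⟨N₀, hN₀⟩ := eventually_atTop.1 hYM
  -- The area bound holds only from some index on; shifting makes it uniform in `n`.
  set τ : ℕ → ℕ := fun n => n + N₀ with hτ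
  have hτt : Tendsto τ atTop atTop := tendsto_add_atTop_nat N₀
  have hτM : ∀ n, hausdorffTwo (Y (τ n)) univ ≤ M := fun n => hN₀ _ (Nat.le_add_left _ _)
  have hτf : IsApproxIsometricSeq fun n => f (τ n) := hf.comp hτt
  obtain ⟨δ, hδ, a, b, c, habc⟩ := hnorm
  have hτn : IsNormalizedSeq fun n => (h (τ n) : A → Y (τ n)) :=
    ⟨δ, hδ, a ∘ τ, b ∘ τ, c ∘ τ, fun n => habc (τ n)⟩
  have hgM : ∀ n, ∫⁻ x, (g (τ n) x : ℝ≥0∞) ^ 2 ∂(hausdorffTwo A) ≤ M := fun n => by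
    rw [← setLIntegral_univ]
    exact ((hconf (τ n)).setLIntegral_sq_le MeasurableSet.univ).trans
      ((measure_mono (subset_univ _)).trans (hτM n))
  obtain ⟨ε, -, hε, hfε⟩ := id hτf
  obtain ⟨φ, hφ, H, hH, hlim⟩ := exists_tendstoUniformly_subseq
    (F := fun n x => f (τ n) (h (τ n) x)) fun x ε' hε' => by
      obtain ⟨e, D, R, L, he, rfl⟩ := hchart x
      obtain ⟨V, hV, N, hN⟩ := exists_nhds_dist_le_of_polarChart hconn hτf (fun n => hY (τ n))
        (fun n => hconf (τ n)) hM hgM hτn he (half_pos hε')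
      obtain ⟨N', hN'⟩ := eventually_atTop.1 (hε.eventually (gt_mem_nhds (half_pos hε')))
      -- Half of `ε'` is spent on the oscillation of `h`, the other half on the distortion of `f`,
      -- which is small for large `n`.
      refine ⟨V, hV, max N N', fun n hn y hy => ?_⟩
      have h1 := hN n ((le_max_left _ _).trans hn) y hy
      have h2 := (abs_lt.1 ((hfε n).2 (h (τ n) y) (h (τ n) (e 0)))).1
      have h3 := hN' n ((le_max_right _ _).trans hn)
      linarith
  exact ⟨fun n => τ (φ n), fun _ _ hmn => Nat.add_lt_add_right (hφ hmn) _, fun n => hτM _, H, hH,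
    hlim⟩


end

theorem theorem6p1 (Ω : ModelSurface)
    {X : Type*} [MetricSpace X] [MeasurableSpace X] [BorelSpace X]
    (hX_length : IsLengthSpace X) (hX_homeo : Nonempty (Ω.Carrier ≃ₜ X))
    (hX_area : hausdorffTwo X univ < ∞)
    {Y : ℕ → Type*} [∀ n, MetricSpace (Y n)] [∀ n, MeasurableSpace (Y n)]
    [∀ n, BorelSpace (Y n)]
    (S : ∀ n, PolyhedralRiemannSurface (Y n))
    (f : ∀ n, Y n → X) (hf : IsApproxIsometricSeq f)
    (K : ℝ) (hK : 1 ≤ K)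
    (hf_area : ∀ A : Set X, IsCompact A →
      limsup (fun n => hausdorffTwo (Y n) (f n ⁻¹' A)) atTop ≤
        ENNReal.ofReal K * hausdorffTwo X A)
    (h : ∀ n, Ω.Carrier ≃ₜ Y n) (h_conf : ∀ n, Ω.IsConformal (S n) (h n))
    (h_norm : IsNormalizedSeq (fun n => (h n : Ω.Carrier → Y n))) :
    ∃ φ : ℕ → ℕ, StrictMono φ ∧ ∃ g : Ω.Carrier → X,
      TendstoUniformly (fun n x => f (φ n) (h (φ n) x)) g atTop ∧
      IsWeaklyQuasiconformal K g ∧ MemSobolevN12 g := by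
  obtain ⟨Φ⟩ := hX_homeo
  have : CompactSpace X := Φ.compactSpace
  have hconn : ∀ p : X, IsPreconnected ({p}ᶜ : Set X) := fun p => by
    have h1 := (Ω.isPreconnected_compl_singleton (Φ.symm p)).image Φ Φ.continuous.continuousOn
    rwa [image_compl_eq Φ.bijective, image_singleton, Φ.apply_symm_apply] at h1
  choose g P hconf using fun n => (h_conf n).exists_isMetricConformal
  have hY : ∀ n, IsApproxGeodesic (Y n) := fun n => (h_conf n).hasCharts.isApproxGeodesic
  set M : ℝ≥0∞ := ENNReal.ofReal K * hausdorffTwo X univ + 1 with hM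
  have hMt : ENNReal.ofReal K * hausdorffTwo X univ ≠ ∞ :=
    ENNReal.mul_ne_top ENNReal.ofReal_ne_top hX_area.ne
  -- The area hypothesis for the whole of `X`; adding one turns the bound on the limsup into a bound
  -- for almost all `n`.
  have hYM : ∀ᶠ n in atTop, hausdorffTwo (Y n) univ ≤ M := by
    have h1 := (hf_area univ isCompact_univ).trans_lt (ENNReal.lt_add_right hMt one_ne_zero)
    filter_upwards [eventually_lt_of_limsup_lt h1] with n hn
    simpa using hn.le
  obtain ⟨φ, hφ, hφM, H, hH, hlim⟩ := exists_subseq_of_isMetricConformal Ω.exists_polarChart hconn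
    hf hY hconf (ENNReal.add_ne_top.2 ⟨hMt, ENNReal.one_ne_top⟩) hYM h_norm
  have hφf : IsApproxIsometricSeq fun n => f (φ n) := hf.comp hφ.tendsto_atTop
  -- Passing to a subsequence can only decrease the limsup.
  have harea : ∀ s : Set X, IsCompact s →
      limsup (fun n => hausdorffTwo (Y (φ n)) (f (φ n) ⁻¹' s)) atTop ≤
        ENNReal.ofReal K * hausdorffTwo X s := fun s hs => by
    refine le_trans ?_ (hf_area s hs)
    rw [← Function.comp_def (fun n => hausdorffTwo (Y n) (f n ⁻¹' s)) φ, limsup_comp]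
    exact limsup_le_limsup_of_le hφ.tendsto_atTop
  obtain ⟨hmod, hsob⟩ := modulus_le_and_memSobolev_of_limit (h := fun n => h (φ n))
    Ω.hausdorffTwo_univ_ne_top hX_area.ne (zero_lt_one.trans_le hK) hφf hlim hH
    (fun n => hconf (φ n)) harea (ENNReal.add_ne_top.2 ⟨hMt, ENNReal.one_ne_top⟩) hφM
  exact ⟨φ, hφ, H, hlim, ⟨hH, surjective_of_limit hφf hlim hH,
    isConnected_preimage_of_limit hφf (fun n => hY (φ n)) hlim hH, hmod⟩, hsob⟩
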